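/- Let $D$ be a set, $S\subseteq D$ a finite non-empty set with $n=|S|$, $k\ge 0$ an integer and $f:S\to\{0,1\}^k$. Fix a real number $c>2$ and an integer $m\ge 2^k$, and identify $\{0,1\}^k$ with the residues $0,\dots,2^k-1$ in $\mathbb Z/m\mathbb Z$ (binary expansion). Hash functions are modelled as fully random: all hash values of all generated functions are independent and uniformly distributed on the range. *Creation.* Let $V=\{0,\dots,\lceil cn\rceil-1\}$. Repeatedly generate a fresh pair $h_1,h_2:D\to V$ until the graph on $V$ that has one edge between $h_1(x)$ and $h_2(x)$ for every $x\in S$ is simple (no loops, no repeated edges) and acyclic. Then generate $h_3:D\to\mathbb Z/m\mathbb Z$ and compute, by traversing each component of the graph from a root with table value $0$ (back-substitution, $g[w]=f(x)-g[u]-h_3(x)$ along the edge $uw$ of $x$), a table $g:V\to\mathbb Z/m\mathbb Z$; isolated vertices get the value $0$. The table is stored as a bit string. *Query.* For $x\in D$ compute $v=g(h_1(x))+g(h_2(x))+h_3(x) \bmod m$; output $v$ if $v<2^k$, and $\bot$ otherwise. Time is the number of steps on a unit-cost random access machine whose unit-cost operations are copying, increment, comparison, addition and subtraction modulo $m$,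 reading or writing one array cell, generating hash functions (a fresh pair $(h_1,h_2)$ or a fresh $h_3$), and evaluating a hash function at a key. Then this is a Bloomier filter for $f$ with the following properties: 1. The creation algorithm terminates with probability $1$, and its expected running time is at most $C\,n$, where $C$ depends only on $c$. Whenever it terminates, its pair $h_1,h_2$ is the first generated pair whose graph is simple and acyclic, and $g(h_1(x))+g(h_2(x))+h_3(x)\equiv f(x)\pmod m$ for all $x\in S$. 2. The stored table has exactly $\lceil cn\rceil\lceil\log_2 m\rceil$ bits. 3. A query at any $x\in D$ takes $O(1)$ time, with an absolute constant, and uses exactly $3$ hash function evaluations and $2$ memory lookups. 4. For $x\in S$ the query outputs $f(x)$, whenever the filter was created. 5. For each fixed $x\in D\setminus S$ the query outputs $\bot$ with probability exactly $1-2^k/m$ over the choice of the hash functions. -/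

import Mathlib

open scoped ENNReal

namespace Bloomier

/-! ## The machine

A unit-cost random access machine.  It has named registers and named arrays, all holding natural
numbers.  Arithmetic is limited to "increment by one" and to addition and subtraction modulo `m`,
so no instruction can build or process long numbers at unit cost.  Keys (elements of the universe
`D`) are opaque: a program names a key by its position in the list of keys it was given, and the
only thing it can do with a key is to evaluate a hash function at it. -/

/-- Register names. `n`, `N`, `range`, `zero`, `one` are inputs and are never written. -/
inductive Reg
  | n | N | range | zero | one
  | bad | v | i | r | x | y | t | u | p | e | w | a | b | d | qh | qt | found
  deriving DecidableEq

/-- Array names. `val` is an input array, `g` is the table that is produced. -/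
inductive Arr
  | val | g | end1 | end2 | head1 | head2 | next1 | next2 | seen | order | parent | parentEdge
  deriving DecidableEq

/-- The environment of a run: the modulus and the available hash functions.
`h₁ t i` and `h₂ t i` are the values at the `i`-th key of the `t`-th pair of hash functions
into the vertex set; `h₃ t i` is the value at the `i`-th key of the `t`-th hash function
into `ℤ/m`. -/
structure Env where
  modulus : ℕ
  h₁ : ℕ → ℕ → ℕ
  h₂ : ℕ → ℕ → ℕ
  h₃ : ℕ → ℕ → ℕ

/-- A machine state. `pair` is the number of pairs `(h₁, h₂)` drawn so far and `third` the number
of functions `h₃` drawn so far; the one drawn last is the current one. -/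
structure State where
  reg : Reg → ℕ
  arr : Arr → ℕ → ℕ
  pair : ℕ
  third : ℕ

/-- Elementary instructions; each of them takes one step. -/
inductive Instr
  /-- `dst ← src` -/
  | copy (dst src : Reg)
  /-- `dst ← dst + 1` -/
  | incr (dst : Reg)
  /-- `dst ← (dst + src) mod m` -/
  | addMod (dst src : Reg)
  /-- `dst ← (dst - src) mod m` -/
  | subMod (dst src : Reg)
  /-- `dst ← A[idx]` -/
  | load (dst : Reg) (A : Arr) (idx : Reg)
  /-- `A[idx] ← src` -/
  | store (A : Arr) (idx src : Reg)
  /-- generate a fresh pair of hash functions `h₁, h₂` -/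
  | drawPair
  /-- generate a fresh hash function `h₃` -/
  | drawThird
  /-- `dst ← h₁ (key number idx)` -/
  | hash1 (dst idx : Reg)
  /-- `dst ← h₂ (key number idx)` -/
  | hash2 (dst idx : Reg)
  /-- `dst ← h₃ (key number idx)` -/
  | hash3 (dst idx : Reg)

/-- The cost of a run: the total number of steps, and among them the number of evaluations of
hash functions and the number of memory lookups. -/
@[ext] structure Cost where
  steps : ℕ
  hashes : ℕ
  lookups : ℕ

instance : Zero Cost := ⟨⟨0, 0, 0⟩⟩

instance : Add Cost :=
  ⟨fun c d => ⟨c.steps + d.steps, c.hashes + d.hashes, c.lookups + d.lookups⟩⟩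

/-- One step which is neither a hash evaluation nor a memory lookup. -/
def Cost.tick : Cost := ⟨1, 0, 0⟩

def State.setReg (s : State) (q : Reg) (z : ℕ) : State :=
  { s with reg := Function.update s.reg q z }

def State.setArr (s : State) (A : Arr) (j z : ℕ) : State :=
  { s with arr := Function.update s.arr A (Function.update (s.arr A) j z) }

/-- The effect of an instruction. -/
def Instr.apply (E : Env) (s : State) : Instr → State
  | .copy dst src => s.setReg dst (s.reg src)
  | .incr dst => s.setReg dst (s.reg dst + 1)
  | .addMod dst src => s.setReg dst ((s.reg dst + s.reg src) % E.modulus)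
  | .subMod dst src =>
      s.setReg dst ((s.reg dst + (E.modulus - s.reg src % E.modulus)) % E.modulus)
  | .load dst A idx => s.setReg dst (s.arr A (s.reg idx))
  | .store A idx src => s.setArr A (s.reg idx) (s.reg src)
  | .drawPair => { s with pair := s.pair + 1 }
  | .drawThird => { s with third := s.third + 1 }
  | .hash1 dst idx => s.setReg dst (E.h₁ s.pair (s.reg idx))
  | .hash2 dst idx => s.setReg dst (E.h₂ s.pair (s.reg idx))
  | .hash3 dst idx => s.setReg dst (E.h₃ s.third (s.reg idx))

/-- The cost of an instruction. -/
def Instr.cost : Instr → Cost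
  | .load _ _ _ => ⟨1, 0, 1⟩
  | .hash1 _ _ => ⟨1, 1, 0⟩
  | .hash2 _ _ => ⟨1, 1, 0⟩
  | .hash3 _ _ => ⟨1, 1, 0⟩
  | _ => Cost.tick

/-- Tests that compare two registers. -/
inductive Test
  | lt (q q' : Reg)
  | eq (q q' : Reg)
  | ne (q q' : Reg)

def Test.Holds (s : State) : Test → Prop
  | .lt q q' => s.reg q < s.reg q'
  | .eq q q' => s.reg q = s.reg q'
  | .ne q q' => s.reg q ≠ s.reg q'

/-- Structured programs: straight-line blocks, sequential composition, conditionals and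
while-loops. -/
inductive Cmd
  | block (l : List Instr)
  | seq (c c' : Cmd)
  | ite (b : Test) (c c' : Cmd)
  | loop (b : Test) (c : Cmd)

infixr:60 " ;; " => Cmd.seq

/-- `Exec E c s κ s'`: in the environment `E`, the program `c` started in the state `s`
terminates in the state `s'`, and the run has cost `κ`.  Every elementary instruction and every
evaluation of a test takes one step. -/
inductive Exec (E : Env) : Cmd → State → Cost → State → Prop
  | block (l : List Instr) (s : State) :
      Exec E (.block l) s (l.map Instr.cost).sum (l.foldl (Instr.apply E) s)
  | seq {c c' : Cmd} {s s' s'' : State} {κ κ' : Cost} :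
      Exec E c s κ s' → Exec E c' s' κ' s'' → Exec E (c ;; c') s (κ + κ') s''
  | ite_true {b : Test} {c c' : Cmd} {s s' : State} {κ : Cost} :
      b.Holds s → Exec E c s κ s' → Exec E (.ite b c c') s (Cost.tick + κ) s'
  | ite_false {b : Test} {c c' : Cmd} {s s' : State} {κ : Cost} :
      ¬ b.Holds s → Exec E c' s κ s' → Exec E (.ite b c c') s (Cost.tick + κ) s'
  | loop_done {b : Test} {c : Cmd} {s : State} :
      ¬ b.Holds s → Exec E (.loop b c) s Cost.tick s
  | loop_step {b : Test} {c : Cmd} {s s' s'' : State} {κ κ' : Cost} :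
      b.Holds s → Exec E c s κ s' → Exec E (.loop b c) s' κ' s'' →
        Exec E (.loop b c) s (Cost.tick + κ + κ') s''

/-! ## Generating the table

The keys are `x₀, …, x_{n-1}`, the vertices are `0, …, N-1`, and key number `e` gives the edge
number `e` between `h₁(x_e)` and `h₂(x_e)`.  The number `n` serves as the "no edge" marker. -/

/-- Clear the adjacency lists and the marks of all vertices. -/
def clearGraph : Cmd :=
  .block [.copy .v .zero] ;;
  .loop (.lt .v .N)
    (.block [.store .head1 .v .n, .store .head2 .v .n, .store .seen .v .zero, .incr .v])

/-- Compute all edges. The edges `e` with `h₁(x_e) = v` are chained in a linked list that starts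
at `head1[v]` and continues with `next1`, the edges `e` with `h₂(x_e) = v` in one that starts at
`head2[v]` and continues with `next2`. -/
def buildGraph : Cmd :=
  .block [.copy .i .zero] ;;
  .loop (.lt .i .n)
    (.block [.hash1 .x .i, .hash2 .y .i, .store .end1 .i .x, .store .end2 .i .y,
      .load .t .head1 .x, .store .next1 .i .t, .store .head1 .x .i,
      .load .t .head2 .y, .store .next2 .i .t, .store .head2 .y .i, .incr .i])

/-- Mark the vertex in register `q`, reached along the edge in register `l` from the vertex in
register `u`, and append it to the queue `order`. -/
def visit (q l : Reg) : Cmd :=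
  .block [.store .seen q .one, .store .parentEdge q l, .store .parent q .u,
    .store .order .qt q, .incr .qt]

/-- Go through one adjacency list of the vertex `u`. `head, next` describe the list and `other`
holds the other endpoints. An edge that leads to a vertex already seen, and is not the edge along
which `u` was reached, closes a cycle (a loop and a repeated edge count as cycles). -/
def scan (head next other : Arr) : Cmd :=
  .block [.load .e head .u] ;;
  .loop (.ne .e .n)
    (.ite (.ne .e .p)
        (.block [.load .w other .e, .load .t .seen .w] ;;
          .ite (.eq .t .zero) (visit .w .e) (.block [.copy .bad .one]))
        (.block []) ;;
      .block [.load .e next .e])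

/-- Breadth-first search of every connected component, which records in `order` the order in
which the vertices are reached, in `parent` and `parentEdge` from where they are reached, and in
`bad` whether there is a cycle. -/
def search : Cmd :=
  .block [.copy .qh .zero, .copy .qt .zero, .copy .r .zero] ;;
  .loop (.lt .r .N)
    (.block [.load .t .seen .r] ;;
      .ite (.eq .t .zero)
        (visit .r .n ;;
          .loop (.lt .qh .qt)
            (.block [.load .u .order .qh, .incr .qh, .load .p .parentEdge .u] ;;
              scan .head1 .next1 .end2 ;;
              scan .head2 .next2 .end1))
        (.block []) ;;
      .block [.incr .r])

/-- Back-substitution along the search order: the root of a component gets the value `0`, and a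
vertex `w` reached from `u` along edge `e` gets `f(x_e) - g[u] - h₃(x_e) mod m`. -/
def solve : Cmd :=
  .block [.copy .i .zero] ;;
  .loop (.lt .i .N)
    (.block [.load .w .order .i, .load .e .parentEdge .w] ;;
      .ite (.eq .e .n)
        (.block [.store .g .w .zero])
        (.block [.load .u .parent .w, .load .b .g .u, .load .d .val .e, .subMod .d .b,
          .hash3 .b .e, .subMod .d .b, .store .g .w .d]) ;;
      .block [.incr .i])

/-- Repeat with fresh `h₁, h₂` until the graph is simple and acyclic; then draw `h₃` and compute
the table `g`. -/
def createProgram : Cmd :=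
  .block [.copy .bad .one] ;;
  .loop (.eq .bad .one)
    (.block [.drawPair, .copy .bad .zero] ;; clearGraph ;; buildGraph ;; search) ;;
  .block [.drawThird] ;;
  solve

/-! ## Querying

The query key is key number `0`, and `range` holds `2 ^ k`. -/

/-- Compute `g[h₁(x)] + g[h₂(x)] + h₃(x) mod m` and compare it with `2 ^ k`; `found = 1` means that
the value in register `a` is output, `found = 0` means that `⊥` is output. -/
def queryProgram : Cmd :=
  .block [.hash1 .x .zero, .hash2 .y .zero, .load .a .g .x, .load .b .g .y, .addMod .a .b,
    .hash3 .d .zero, .addMod .a .d] ;;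
  .ite (.lt .a .range) (.block [.copy .found .one]) (.block [.copy .found .zero])

/-! ## Random hash functions -/

/-- The random source: an infinite supply of pairs of functions `D → {0, …, N-1}` (the pair
number `t` consists of `ω.1 (t, false, ·)` and `ω.1 (t, true, ·)`) and of functions
`D → {0, …, m-1}` (number `t` is `ω.2 (t, ·)`). -/
abbrev HashSource (D : Type*) (N m : ℕ) : Type _ :=
  (ℕ × Bool × D → Fin N) × (ℕ × D → Fin m)

/-- All hash values are independent and uniformly distributed. -/
noncomputable def hashMeasure (D : Type*) (N m : ℕ) [NeZero N] [NeZero m] :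
    MeasureTheory.Measure (HashSource D N m) :=
  (MeasureTheory.Measure.infinitePi
      fun _ : ℕ × Bool × D => (PMF.uniformOfFintype (Fin N)).toMeasure).prod
    (MeasureTheory.Measure.infinitePi
      fun _ : ℕ × D => (PMF.uniformOfFintype (Fin m)).toMeasure)

/-! ## The filter -/

/-- What is stored: a string of bits (the table), and the hash functions in use. -/
@[ext] structure Filter (D : Type*) (N m : ℕ) where
  bits : List Bool
  h₁ : D → Fin N
  h₂ : D → Fin N
  h₃ : D → Fin m

/-- The first `N` entries of a table, written as consecutive binary numbers of `b` bits each. -/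
def tableBits (N b : ℕ) (g : ℕ → ℕ) : List Bool :=
  (List.range N).flatMap fun j => (List.range b).map fun i => (g j).testBit i

/-- The `j`-th number in a string of consecutive binary numbers of `b` bits each. -/
def readCell (b : ℕ) (bits : List Bool) (j : ℕ) : ℕ :=
  ∑ i ∈ Finset.range b, (bits.getD (j * b + i) false).toNat * 2 ^ i

section Create

variable {D : Type*} {S : Finset D} {k N m : ℕ}

/-- The environment in which the table is generated: `key` lists the elements of `S`. -/
def createEnv (key : Fin S.card ≃ S) (ω : HashSource D N m) : Env where
  modulus := m
  h₁ t i := if hi : i < S.card then (ω.1 (t, false, (key ⟨i, hi⟩ : D)) : ℕ) else 0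
  h₂ t i := if hi : i < S.card then (ω.1 (t, true, (key ⟨i, hi⟩ : D)) : ℕ) else 0
  h₃ t i := if hi : i < S.card then (ω.2 (t, (key ⟨i, hi⟩ : D)) : ℕ) else 0

/-- The initial state: `n = |S|`, `N`, the constants `0`, `1`, and the list of the values of `f`,
read as binary numbers. Everything else is zero. -/
def createInit (N : ℕ) (f : S → BitVec k) (key : Fin S.card ≃ S) : State where
  reg
    | .n => S.card
    | .N => N
    | .one => 1
    | _ => 0
  arr
    | .val => fun i => if hi : i < S.card then (f (key ⟨i, hi⟩)).toNat else 0
    | _ => fun _ => 0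
  pair := 0
  third := 0

/-- With the random source `ω`, the creation algorithm terminates and produces the filter `F`. -/
def Creates (f : S → BitVec k) (key : Fin S.card ≃ S) (ω : HashSource D N m)
    (F : Filter D N m) : Prop :=
  ∃ (κ : Cost) (s : State), Exec (createEnv key ω) createProgram (createInit N f key) κ s ∧
    F = { bits := tableBits N (Nat.clog 2 m) (s.arr .g)
          h₁ := fun x => ω.1 (s.pair, false, x)
          h₂ := fun x => ω.1 (s.pair, true, x)
          h₃ := fun x => ω.2 (s.third, x) }

/-- The running time of the creation algorithm; it is `∞` if the algorithm does not terminate. -/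
noncomputable def creationTime (f : S → BitVec k) (key : Fin S.card ≃ S)
    (ω : HashSource D N m) : ℝ≥0∞ :=
  ⨅ (κ : Cost) (s : State)
    (_ : Exec (createEnv key ω) createProgram (createInit N f key) κ s), (κ.steps : ℝ≥0∞)

/-- The graph with vertex set `{0, …, N-1}` and one edge between `h₁ x` and `h₂ x` for each
`x ∈ S` is simple (it has no loops and no repeated edges) and acyclic. -/
def SimpleAcyclic (S : Finset D) (h₁ h₂ : D → Fin N) : Prop :=
  (∀ x ∈ S, h₁ x ≠ h₂ x) ∧ Set.InjOn (fun x => s(h₁ x, h₂ x)) (S : Set D) ∧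
    (SimpleGraph.fromEdgeSet ((fun x => s(h₁ x, h₂ x)) '' (S : Set D))).IsAcyclic

end Create

section Query

variable {D : Type*} {N m : ℕ}

/-- The environment of a query at `x`. -/
def queryEnv (F : Filter D N m) (x : D) : Env where
  modulus := m
  h₁ _ _ := F.h₁ x
  h₂ _ _ := F.h₂ x
  h₃ _ _ := F.h₃ x

/-- The initial state of a query: the memory holds the stored table, in cells of `⌈log₂ m⌉` bits. -/
def queryInit (k : ℕ) (F : Filter D N m) : State where
  reg
    | .range => 2 ^ k
    | .one => 1
    | _ => 0
  arr
    | .g => readCell (Nat.clog 2 m) F.bits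
    | _ => fun _ => 0
  pair := 0
  third := 0

/-- The query of `F` at `x` terminates with the output `o` at cost `κ`; here `none` is `⊥`. -/
def Answers {k : ℕ} (F : Filter D N m) (x : D) (o : Option (BitVec k)) (κ : Cost) : Prop :=
  ∃ s : State, Exec (queryEnv F x) queryProgram (queryInit k F) κ s ∧
    o = if s.reg .found = 1 then some (BitVec.ofNat k (s.reg .a)) else none

end Query

end Bloomier

/-! Correctness is back-substitution on a forest. A breadth-first search of a forest reaches every
edge from an end whose table value is already fixed towards an end whose value is still free. Each
key's equation can therefore be met by the value at the new end, and no later write disturbs it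
(`solve_runs`, `solve_spec`). The search detects failure because an edge that leads to a reached
vertex, other than the one along which the current vertex was reached, has ends already joined by
tree edges (`BFS.close_cycle`, `BFS.isForest_iff`).

The probability that one attempt succeeds is bounded below by counting. Let `F t` be the number of
sequences of `t` ordered pairs of vertices that form a forest, and `P t` the number of such forests
together with an ordered pair of connected vertices. Adding an edge gives `F (t+1) + P t = N² F t`.
Removing the last edge of a path gives `P (t+1) ≤ N F (t+1) + 2 (t+1) N P t`. While `2t/N ≤ 2/c <
1`, the second relation contracts and yields `P t ≤ K N F t` with `K` depending on `c` only. Hence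
every further edge keeps a fraction of at least `1 - K/N`, and after `n ≤ N/2` edges a positive
constant fraction `p` of all sequences is left (`exists_le_card_forests`).

An attempt costs `O(n + N)` steps on every input, and successive attempts are independent. The
expected number of attempts is thus at most `1/p`, a geometric series, and the expected time is
linear (`lintegral_creationTime_le`). A finite expectation also yields termination almost surely.

For `x ∉ S` the creation never looks at `h₃ x`. Adding `1` to this value preserves the measure and
the table and adds `1` to the value computed by the query. All `m` residues are therefore equally
likely (`hashMeasure_queryEvent_singleton`), and `m - 2 ^ k` of them give `⊥`.

The program is verified in a calculus of time budgets (`Runs`), which proves that some run exists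
and bounds its cost. `Exec.deterministic` carries the result over to every run. -/

namespace Bloomier

/-! ### Forests given by numbered edges. -/

section Forest

variable {ι V : Type*}

/-- The edge number `i` joins `u` and `v`. -/
def Joins (E : ι → V × V) (i : ι) (u v : V) : Prop := E i = (u, v) ∨ E i = (v, u)

/-- `u` and `v` are connected by edges whose number is in `A`. -/
def Conn (E : ι → V × V) (A : Set ι) : V → V → Prop :=
  Relation.ReflTransGen fun u v => ∃ i ∈ A, Joins E i u v

/-- The edges whose number is in `A` form a forest: the ends of each of them are not connected by
the other ones. -/
def IsForest (E : ι → V × V) (A : Set ι) : Prop :=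
  ∀ i ∈ A, ¬ Conn E (A \ {i}) (E i).1 (E i).2

variable {E : ι → V × V} {A B : Set ι} {i : ι} {u v w : V}

theorem Joins.symm (h : Joins E i u v) : Joins E i v u := Or.symm h

theorem joins_ends (E : ι → V × V) (i : ι) : Joins E i (E i).1 (E i).2 := Or.inl rfl

theorem Conn.refl (u : V) : Conn E A u u := Relation.ReflTransGen.refl

theorem Conn.trans (h : Conn E A u v) (h' : Conn E A v w) : Conn E A u w :=
  Relation.ReflTransGen.trans h h'

theorem Conn.symm (h : Conn E A u v) : Conn E A v u := by
  induction h with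
  | refl => exact Conn.refl u
  | tail _ hbc ih =>
    obtain ⟨i, hi, h⟩ := hbc
    exact Relation.ReflTransGen.head ⟨i, hi, h.symm⟩ ih

theorem Conn.mono (hAB : A ⊆ B) (h : Conn E A u v) : Conn E B u v :=
  Relation.ReflTransGen.mono (fun _ _ ⟨i, hi, h⟩ => ⟨i, hAB hi, h⟩) _ _ h

theorem Conn.of_joins (hi : i ∈ A) (h : Joins E i u v) : Conn E A u v :=
  Relation.ReflTransGen.single ⟨i, hi, h⟩

theorem IsForest.mono (hAB : A ⊆ B) (h : IsForest E B) : IsForest E A := fun i hi hc =>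
  h i (hAB hi) (hc.mono (Set.sdiff_subset_sdiff_left hAB))

/-- Repeated crossings of the new edge cancel: a second crossing returns to an end that was already
reached without it. At most one crossing, in one of the two directions, is ever needed. -/
theorem Conn.insert_cases (h : Conn E (insert i A) u v) :
    Conn E A u v ∨ (Conn E A u (E i).1 ∧ Conn E A (E i).2 v) ∨
      (Conn E A u (E i).2 ∧ Conn E A (E i).1 v) := by
  induction h with
  | refl => exact Or.inl (Conn.refl u)
  | @tail b c _ hbc ih =>
    obtain ⟨j, hj, hJ⟩ := hbc
    rcases eq_or_ne j i with rfl | hne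
    · rcases hJ with hJ | hJ <;> rw [hJ] at ih ⊢ <;> dsimp only at ih ⊢
      · rcases ih with ih | ih | ih
        · exact Or.inr (Or.inl ⟨ih, Conn.refl _⟩)
        · exact Or.inr (Or.inl ⟨ih.1, Conn.refl _⟩)
        · exact Or.inl ih.1
      · rcases ih with ih | ih | ih
        · exact Or.inr (Or.inr ⟨ih, Conn.refl _⟩)
        · exact Or.inl ih.1
        · exact Or.inr (Or.inr ⟨ih.1, Conn.refl _⟩)
    · have hc : Conn E A b c := Conn.of_joins (hj.resolve_left hne) hJ
      rcases ih with ih | ih | ih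
      · exact Or.inl (ih.trans hc)
      · exact Or.inr (Or.inl ⟨ih.1, ih.2.trans hc⟩)
      · exact Or.inr (Or.inr ⟨ih.1, ih.2.trans hc⟩)

/-- This is an exchange argument. If the ends of an old edge `j` become connected by a path through
`i`, that path closed up by `j` connects the ends of `i` without using `i`. -/
theorem isForest_insert (hi : i ∉ A) :
    IsForest E (insert i A) ↔ IsForest E A ∧ ¬ Conn E A (E i).1 (E i).2 := by
  constructor
  · intro h
    refine ⟨h.mono (Set.subset_insert _ _), fun hc => h i (Set.mem_insert _ _) ?_⟩
    rwa [Set.insert_sdiff_self_of_notMem hi]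
  · rintro ⟨h, hc⟩ j hj hj'
    rcases eq_or_ne j i with rfl | hne
    · rw [Set.insert_sdiff_self_of_notMem hi] at hj'
      exact hc hj'
    · have hjA := hj.resolve_left hne
      have hs : insert i A \ {j} = insert i (A \ {j}) :=
        Set.insert_sdiff_of_notMem _ (by simpa using hne.symm)
      rw [hs] at hj'
      have hm : ∀ {x y}, Conn E (A \ {j}) x y → Conn E A x y := fun h => h.mono Set.sdiff_subset
      have hJ : Conn E A (E j).1 (E j).2 := Conn.of_joins hjA (joins_ends E j)
      rcases hj'.insert_cases with h' | ⟨h1, h2⟩ | ⟨h1, h2⟩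
      · exact h j hjA h'
      · exact hc ((hm h1).symm.trans (hJ.trans (hm h2).symm))
      · exact hc ((hm h2).trans (hJ.symm.trans (hm h1)))

/-- Two connected vertices are equal, or joined by a path whose last edge is not used before. -/
theorem Conn.last_edge {A : Finset ι} (h : Conn E A u v) :
    u = v ∨ ∃ i ∈ A, ∃ w, Joins E i w v ∧ Conn E (A \ {i} : Set ι) u w := by
  classical
  induction A using Finset.strongInduction with
  | H A ih =>
    rcases Relation.ReflTransGen.cases_tail h with h | ⟨w, hw, j, hj, hJ⟩
    · exact Or.inl h.symm
    · have hw' : Conn E (insert j (A \ {j} : Set ι)) u w := by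
        rwa [Set.insert_sdiff_singleton, Set.insert_eq_of_mem hj]
      have hsub : Conn E (A \ {j} : Set ι) u v →
          u = v ∨ ∃ i ∈ A, ∃ w, Joins E i w v ∧ Conn E (A \ {i} : Set ι) u w := by
        intro hv
        rcases ih (A \ {j}) (Finset.sdiff_ssubset (by simpa using hj) (by simp))
          (by simpa using hv) with h | ⟨i, hi, x, hx, hc⟩
        · exact Or.inl h
        · refine Or.inr ⟨i, (Finset.mem_sdiff.1 hi).1, x, hx, hc.mono ?_⟩
          intro y hy
          simp only [Finset.coe_sdiff, Set.mem_sdiff] at hy ⊢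
          exact ⟨hy.1.1, hy.2⟩
      -- The walk to `w` is split at the edge `j`. Either an end of `j` opposite to `v` is reached
      -- without `j`, so that `j` is a last edge, or `v` itself is reached without `j` and the
      -- induction hypothesis applies to the smaller edge set.
      rcases hw'.insert_cases with h' | ⟨h1, h2⟩ | ⟨h1, h2⟩
      · exact Or.inr ⟨j, hj, w, hJ, h'⟩
      · rcases hJ with hJ | hJ <;> rw [hJ] at h1
        · exact Or.inr ⟨j, hj, w, Or.inl hJ, h1⟩
        · exact hsub h1
      · rcases hJ with hJ | hJ <;> rw [hJ] at h1
        · exact hsub h1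
        · exact Or.inr ⟨j, hj, w, Or.inr hJ, h1⟩

section Transfer

variable {κ W : Type*} {E' : κ → W × W} {f : ι → κ} {g : V → W}

/-- An edge of the image has both ends in the range of `g`, so a walk that starts there lifts. This
allows edges to be numbered by keys, by `Fin` or by natural numbers as convenient. -/
theorem conn_image (hg : Function.Injective g) (hE : ∀ i ∈ A, E' (f i) = Prod.map g g (E i)) :
    Conn E' (f '' A) (g u) (g v) ↔ Conn E A u v := by
  constructor
  · intro h
    have : ∀ y, Conn E' (f '' A) (g u) y → ∃ x, y = g x ∧ Conn E A u x := by
      intro y hy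
      induction hy with
      | refl => exact ⟨u, rfl, Conn.refl u⟩
      | @tail b c _ hbc ih =>
        obtain ⟨x, rfl, hx⟩ := ih
        obtain ⟨_, ⟨i, hi, rfl⟩, hJ⟩ := hbc
        rw [Joins, hE i hi] at hJ
        rcases hJ with hJ | hJ
        · have h1 := hg (congrArg Prod.fst hJ)
          exact ⟨(E i).2, (congrArg Prod.snd hJ).symm,
            hx.trans (h1 ▸ Conn.of_joins hi (joins_ends E i))⟩
        · have h1 := hg (congrArg Prod.snd hJ)
          exact ⟨(E i).1, (congrArg Prod.fst hJ).symm,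
            hx.trans (h1 ▸ Conn.of_joins hi (joins_ends E i).symm)⟩
    obtain ⟨x, hx, hc⟩ := this _ h
    rwa [hg hx]
  · intro h
    refine Relation.ReflTransGen.lift g (fun a b hab => ?_) _ _ h
    obtain ⟨i, hi, hJ⟩ := hab
    refine ⟨f i, ⟨i, hi, rfl⟩, ?_⟩
    rw [Joins, hE i hi]
    rcases hJ with hJ | hJ <;> simp [hJ]

theorem isForest_image (hf : Set.InjOn f A) (hg : Function.Injective g)
    (hE : ∀ i ∈ A, E' (f i) = Prod.map g g (E i)) :
    IsForest E' (f '' A) ↔ IsForest E A := by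
  unfold IsForest
  rw [Set.forall_mem_image]
  refine forall₂_congr fun i hi => not_congr ?_
  have hs : f '' A \ {f i} = f '' (A \ {i}) := by
    ext y
    constructor
    · rintro ⟨⟨j, hj, rfl⟩, hne⟩
      exact ⟨j, ⟨hj, fun h => hne (by rw [Set.mem_singleton_iff.1 h]; rfl)⟩, rfl⟩
    · rintro ⟨j, ⟨hj, hne⟩, rfl⟩
      exact ⟨⟨j, hj, rfl⟩, fun h => hne (hf hj hi h)⟩
  rw [hs, hE i hi]
  exact conn_image hg fun j hj => hE j hj.1

end Transfer

end Forest

/-! ### Simple acyclic graphs are forests of edges. -/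

section Simple

variable {D : Type*} {S : Finset D} {N : ℕ} {h₁ h₂ : D → Fin N}

theorem joins_iff_sym2 {x : D} {u v : Fin N} :
    Joins (fun x => (h₁ x, h₂ x)) x u v ↔ s(h₁ x, h₂ x) = s(u, v) := by
  simp [Joins]

theorem reachable_fromEdgeSet_iff {A : Set D} {u v : Fin N} :
    (SimpleGraph.fromEdgeSet ((fun x => s(h₁ x, h₂ x)) '' A)).Reachable u v ↔
      Conn (fun x => (h₁ x, h₂ x)) A u v := by
  rw [SimpleGraph.reachable_fromEdgeSet_eq_reflTransGen_toRel, Conn]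
  have : Sym2.ToRel ((fun x => s(h₁ x, h₂ x)) '' A) =
      fun u v => ∃ i ∈ A, Joins (fun x => (h₁ x, h₂ x)) i u v := by
    ext u v
    simp only [Sym2.ToRel, Set.mem_image, joins_iff_sym2]
  rw [this]

/-- A graph is acyclic iff every edge is a bridge, and when no edge is repeated, deleting the edge
of `x` means dropping the index `x`. A loop or a repeated edge violates the forest condition
directly: its ends are equal, or joined by its twin. -/
theorem simpleAcyclic_iff_isForest :
    SimpleAcyclic S h₁ h₂ ↔ IsForest (fun x => (h₁ x, h₂ x)) (S : Set D) := by
  set E : D → Fin N × Fin N := fun x => (h₁ x, h₂ x) with hEdef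
  have hdel : ∀ x ∈ S, Set.InjOn (fun x => s(h₁ x, h₂ x)) (S : Set D) →
      (SimpleGraph.fromEdgeSet ((fun x => s(h₁ x, h₂ x)) '' (S : Set D))).deleteEdges
        {s(h₁ x, h₂ x)} =
      SimpleGraph.fromEdgeSet ((fun x => s(h₁ x, h₂ x)) '' ((S : Set D) \ {x})) := by
    intro x hx hinj
    rw [Set.InjOn.image_sdiff_subset hinj (by simpa using hx), Set.image_singleton]
    ext a b
    simp only [SimpleGraph.deleteEdges_adj, SimpleGraph.fromEdgeSet_adj, Set.mem_sdiff]
    tauto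
  constructor
  · rintro ⟨hloop, hinj, hac⟩ x hx hc
    rw [SimpleGraph.isAcyclic_iff_forall_adj_isBridge] at hac
    have hadj : (SimpleGraph.fromEdgeSet ((fun x => s(h₁ x, h₂ x)) '' (S : Set D))).Adj
        (h₁ x) (h₂ x) := by
      rw [SimpleGraph.fromEdgeSet_adj]
      exact ⟨⟨x, hx, rfl⟩, hloop x hx⟩
    have := hac hadj
    rw [SimpleGraph.isBridge_iff, hdel x hx hinj, reachable_fromEdgeSet_iff] at this
    exact this hc
  · intro hF
    have hinj : Set.InjOn (fun x => s(h₁ x, h₂ x)) (S : Set D) := by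
      intro x hx y hy hxy
      by_contra hne
      refine hF x hx (Conn.of_joins (i := y) ⟨hy, fun h => hne (Set.mem_singleton_iff.1 h).symm⟩ ?_)
      rw [joins_iff_sym2]
      exact hxy.symm
    refine ⟨fun x hx he => hF x hx ?_, hinj, ?_⟩
    · change Conn _ _ (h₁ x) (h₂ x)
      rw [he]
      exact Conn.refl _
    · rw [SimpleGraph.isAcyclic_iff_forall_adj_isBridge]
      intro a b hab
      rw [SimpleGraph.fromEdgeSet_adj] at hab
      obtain ⟨⟨x, hx, hxe⟩, -⟩ := hab
      dsimp only at hxe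
      rw [← hxe, SimpleGraph.isBridge_iff, hdel x hx hinj, reachable_fromEdgeSet_iff]
      exact hF x hx

end Simple

/-! ### A sparse random graph is a forest with probability bounded below. -/

section Counting

theorem isForest_insertNth {V : Type*} {t : ℕ} (p : Fin (t + 1)) (e : V × V)
    (E : Fin t → V × V) :
    IsForest (Fin.insertNth p e E : Fin (t + 1) → V × V) Set.univ ↔
      IsForest E Set.univ ∧ ¬ Conn E Set.univ e.1 e.2 := by
  set E' : Fin (t + 1) → V × V := Fin.insertNth p e E
  have hE : ∀ i ∈ (Set.univ : Set (Fin t)), E' (p.succAbove i) = Prod.map id id (E i) := by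
    intro i _
    simp [E']
  have hu : (Set.univ : Set (Fin (t + 1))) = insert p (p.succAbove '' Set.univ) := by
    rw [Set.image_univ, Fin.range_succAbove, Set.insert_eq, Set.union_compl_self]
  have hp : p ∉ p.succAbove '' Set.univ := by
    rw [Set.image_univ, Fin.range_succAbove]
    simp
  have he : E' p = e := by simp [E']
  rw [hu, isForest_insert hp, isForest_image Fin.succAbove_right_injective.injOn
    Function.injective_id hE, he]
  exact and_congr_right fun _ => not_congr (conn_image Function.injective_id hE)

theorem conn_removeNth {V : Type*} {t : ℕ} (p : Fin (t + 1)) (E : Fin (t + 1) → V × V) {u v : V} :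
    Conn (p.removeNth E) Set.univ u v ↔ Conn E (Set.univ \ {p}) u v := by
  have hu : (Set.univ : Set (Fin (t + 1))) \ {p} = p.succAbove '' Set.univ := by
    rw [Set.image_univ, Fin.range_succAbove, Set.compl_eq_univ_sdiff]
  rw [hu]
  exact (conn_image (E := p.removeNth E) (E' := E) (g := id) Function.injective_id
    fun i _ => rfl).symm

/-- A vertex which is not touched by an edge is connected to itself only. -/
theorem Conn.eq_of_untouched {ι V : Type*} {E : ι → V × V} {A : Set ι} {u v : V}
    (hu : ∀ i ∈ A, (E i).1 ≠ u ∧ (E i).2 ≠ u) (h : Conn E A u v) : u = v := by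
  rcases Relation.ReflTransGen.cases_head h with h | ⟨w, ⟨i, hi, hJ⟩, -⟩
  · exact h
  · rcases hJ with hJ | hJ <;> have := hu i hi <;> simp [hJ] at this

open Classical in
/-- The sequences of `t` edges on `{0, …, N-1}` which form a forest. -/
noncomputable def forests (N t : ℕ) : Finset (Fin t → Fin N × Fin N) :=
  {E | IsForest E Set.univ}

open Classical in
/-- The forests with `t` edges on `{0, …, N-1}` with a pair of connected vertices. -/
noncomputable def connectedPairs (N t : ℕ) : Finset ((Fin t → Fin N × Fin N) × (Fin N × Fin N)) :=
  {p | IsForest p.1 Set.univ ∧ Conn p.1 Set.univ p.2.1 p.2.2}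

theorem mem_forests {N t : ℕ} {E : Fin t → Fin N × Fin N} :
    E ∈ forests N t ↔ IsForest E Set.univ := by simp [forests]

theorem mem_connectedPairs {N t : ℕ} {p : (Fin t → Fin N × Fin N) × (Fin N × Fin N)} :
    p ∈ connectedPairs N t ↔ IsForest p.1 Set.univ ∧ Conn p.1 Set.univ p.2.1 p.2.2 := by
  simp [connectedPairs]

/-- Put any of the `N ^ 2` pairs in front of a forest: the result is again a forest exactly if the
two vertices were not connected before. -/
theorem card_forests_succ (N t : ℕ) :
    (forests N (t + 1)).card + (connectedPairs N t).card = N ^ 2 * (forests N t).card := by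
  classical
  have h1 : (forests N (t + 1)).card =
      ((forests N t ×ˢ (Finset.univ : Finset (Fin N × Fin N))).filter
        fun p => ¬ Conn p.1 Set.univ p.2.1 p.2.2).card := by
    refine Finset.card_bij' (fun E _ => ((0 : Fin (t + 1)).removeNth E, E 0))
      (fun p _ => Fin.insertNth 0 p.2 p.1) ?_ ?_ ?_ ?_
    · intro E hE
      rw [mem_forests, ← Fin.insertNth_self_removeNth 0 E, isForest_insertNth] at hE
      simpa [mem_forests] using hE
    · intro p hp
      rw [mem_forests, isForest_insertNth]
      simpa [mem_forests] using hp
    · intro E _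
      exact Fin.insertNth_self_removeNth 0 E
    · intro p _
      simp
  have h2 : connectedPairs N t =
      (forests N t ×ˢ (Finset.univ : Finset (Fin N × Fin N))).filter
        fun p => Conn p.1 Set.univ p.2.1 p.2.2 := by
    ext p
    simp [mem_connectedPairs, mem_forests]
  rw [h1, h2, add_comm, Finset.card_filter_add_card_filter_not, Finset.card_product]
  simp
  ring

/-- A connected pair `(u, v)` either has `u = v`, or is joined by a path with a last edge. That edge
has `t + 1` possible positions, two orientations and `N` possible ends `v`; removing it leaves a
forest with `t` edges in which `u` is connected to the other end. -/
theorem card_connectedPairs_succ_le (N t : ℕ) :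
    (connectedPairs N (t + 1)).card ≤
      N * (forests N (t + 1)).card + 2 * (t + 1) * N * (connectedPairs N t).card := by
  classical
  let T : Finset ((Fin (t + 1) × Bool × Fin N) × ((Fin t → Fin N × Fin N) × (Fin N × Fin N))) :=
    Finset.univ ×ˢ connectedPairs N t
  have hsub : connectedPairs N (t + 1) ⊆
      ((forests N (t + 1) ×ˢ (Finset.univ : Finset (Fin N))).image fun p => (p.1, (p.2, p.2))) ∪
      T.image fun p =>
        ((Fin.insertNth p.1.1 (if p.1.2.1 then (p.2.2.2, p.1.2.2) else (p.1.2.2, p.2.2.2)) p.2.1 :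
          Fin (t + 1) → Fin N × Fin N), (p.2.2.1, p.1.2.2)) := by
    rintro ⟨E, u, v⟩ h
    obtain ⟨hF, hc⟩ := mem_connectedPairs.1 h
    dsimp only at hF hc
    rw [Finset.mem_union, Finset.mem_image, Finset.mem_image]
    have hc' : Conn E ((Finset.univ : Finset (Fin (t + 1))) : Set (Fin (t + 1))) u v := by simpa
    rcases hc'.last_edge with rfl | ⟨i, -, w, hJ, hc⟩
    · exact Or.inl ⟨(E, u), by simpa [mem_forests] using hF, rfl⟩
    · right
      rw [Finset.coe_univ, ← conn_removeNth] at hc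
      have hF' : IsForest (i.removeNth E) Set.univ := by
        rw [← Fin.insertNth_self_removeNth i E, isForest_insertNth] at hF
        exact hF.1
      have hm : (i.removeNth E, (u, w)) ∈ connectedPairs N t := mem_connectedPairs.2 ⟨hF', hc⟩
      rcases hJ with hJ | hJ
      · refine ⟨((i, true, v), (i.removeNth E, (u, w))), by simp [T, hm], ?_⟩
        simp [← hJ]
      · refine ⟨((i, false, v), (i.removeNth E, (u, w))), by simp [T, hm], ?_⟩
        simp [← hJ]
  refine (Finset.card_le_card hsub).trans ((Finset.card_union_le _ _).trans (add_le_add ?_ ?_))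
  · refine Finset.card_image_le.trans ?_
    rw [Finset.card_product, Finset.card_univ, Fintype.card_fin, mul_comm]
  · refine Finset.card_image_le.trans ?_
    rw [Finset.card_product, Finset.card_univ]
    simp only [Fintype.card_prod, Fintype.card_fin, Fintype.card_bool]
    exact le_of_eq (by ring)

/-- The star with centre `0` is a forest: its leaf `i + 1` is touched by the edge `i` only. -/
theorem card_forests_pos {N t : ℕ} (h : t < N) : 0 < (forests N t).card := by
  rw [Finset.card_pos]
  refine ⟨fun i => (⟨0, by omega⟩, ⟨i + 1, by omega⟩), mem_forests.2 fun i _ hc => ?_⟩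
  have := hc.symm.eq_of_untouched (by
    rintro j ⟨-, hj⟩
    have hj : j ≠ i := hj
    simp only [ne_eq, Fin.mk.injEq]
    omega)
  simp at this

/-- Divided by `N F (t+1)`, the recursion has the form `x ↦ 1 + ρ x` up to a factor `N / (N - K)`.
Its fixed point is `1 / (1 - ρ)`; taking `K` twice as large absorbs that factor once `K ^ 2 ≤ N`. -/
theorem card_connectedPairs_le {N : ℕ} {ρ K : ℝ} (hρ : 0 ≤ ρ) (hK : K * (1 - ρ) = 2)
    (hK2 : 2 ≤ K) (hKN : K ^ 2 ≤ N) {t : ℕ} (ht : 2 * (t : ℝ) ≤ ρ * N) :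
    ((connectedPairs N t).card : ℝ) ≤ K * N * (forests N t).card := by
  have hN : (4 : ℝ) ≤ N := by nlinarith
  induction t with
  | zero =>
    have hle : ((connectedPairs N 0).card : ℝ) ≤ 1 * N * (forests N 0).card := by
      have hsub : connectedPairs N 0 ⊆
          (forests N 0 ×ˢ (Finset.univ : Finset (Fin N))).image fun p => (p.1, (p.2, p.2)) := by
        rintro ⟨E, u, v⟩ h
        obtain ⟨hF, hc⟩ := mem_connectedPairs.1 h
        have : u = v := hc.eq_of_untouched fun i => i.elim0
        subst this
        exact Finset.mem_image.2 ⟨(E, u), by simpa [mem_forests] using hF, rfl⟩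
      have := (Finset.card_le_card hsub).trans Finset.card_image_le
      rw [Finset.card_product, Finset.card_univ, Fintype.card_fin, mul_comm] at this
      rw [one_mul]
      exact_mod_cast this
    refine hle.trans ?_
    gcongr
    linarith
  | succ t ih =>
    push_cast at ht
    have ih := ih (by linarith)
    have h1 : ((forests N (t + 1)).card : ℝ) + (connectedPairs N t).card =
        N ^ 2 * (forests N t).card := by exact_mod_cast card_forests_succ N t
    have h2 : ((connectedPairs N (t + 1)).card : ℝ) ≤
        N * (forests N (t + 1)).card + 2 * (t + 1) * N * (connectedPairs N t).card := by
      exact_mod_cast card_connectedPairs_succ_le N t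
    set a : ℝ := ((forests N t).card : ℝ)
    set a' : ℝ := ((forests N (t + 1)).card : ℝ)
    set Q : ℝ := ((connectedPairs N t).card : ℝ)
    have ha : 0 ≤ a := Nat.cast_nonneg _
    have ha' : N * (N - K) * a ≤ a' := by nlinarith
    have hNK : 0 < (N : ℝ) - K := by nlinarith
    -- By `K (1 - ρ) = 2` this says `K ^ 2 ≤ N + K`.
    have hK1 : (N - K) + ρ * N * K ≤ K * (N - K) := by nlinarith
    have h3 : 2 * (t + 1) * N * Q ≤ ρ * N * N * (K * N * a) := by
      have : (2 * (t + 1) * N : ℝ) ≤ ρ * N * N := by nlinarith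
      have hQ : 0 ≤ Q := Nat.cast_nonneg _
      gcongr
    -- `ha'` replaces `N (N - K) a` by `a'`; the factor `N - K` introduced for this is cancelled in
    -- `h6`.
    have h4 : ρ * N * N * (K * N * a) * (N - K) ≤ (ρ * N * K) * N * a' := by
      have h0 : 0 ≤ ρ * N * K * N := by positivity
      calc ρ * N * N * (K * N * a) * (N - K) = ρ * N * K * N * (N * (N - K) * a) := by ring
        _ ≤ ρ * N * K * N * a' := mul_le_mul_of_nonneg_left ha' h0
    have ha0 : 0 ≤ a' := Nat.cast_nonneg _
    have h5 : (N * a' + ρ * N * N * (K * N * a)) * (N - K) ≤ (K * N * a') * (N - K) := by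
      calc (N * a' + ρ * N * N * (K * N * a)) * (N - K)
          ≤ N * a' * (N - K) + (ρ * N * K) * N * a' := by linarith
        _ = ((N - K) + ρ * N * K) * (N * a') := by ring
        _ ≤ (K * (N - K)) * (N * a') := mul_le_mul_of_nonneg_right hK1 (by positivity)
        _ = (K * N * a') * (N - K) := by ring
    have h6 := le_of_mul_le_mul_right h5 hNK
    linarith

/-- At most `K N` of the `N ^ 2` choices for the next edge are bad on average over the forests. -/
theorem pow_le_card_forests {N : ℕ} {ρ K : ℝ} (hρ : 0 ≤ ρ) (hK : K * (1 - ρ) = 2)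
    (hK2 : 2 ≤ K) (hKN : K ^ 2 ≤ N) {t : ℕ} (ht : 2 * (t : ℝ) ≤ ρ * N) :
    ((N : ℝ) * (N - K)) ^ t ≤ (forests N t).card := by
  have hNK : 0 < (N : ℝ) - K := by nlinarith
  induction t with
  | zero =>
    have : 0 < (forests N 0).card := card_forests_pos (by
      have : (0 : ℝ) < N := by linarith
      exact_mod_cast this)
    rw [pow_zero]
    exact_mod_cast this
  | succ t ih =>
    push_cast at ht
    have ih := ih (by linarith)
    have h1 : ((forests N (t + 1)).card : ℝ) + (connectedPairs N t).card =
        N ^ 2 * (forests N t).card := by exact_mod_cast card_forests_succ N t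
    have h2 := card_connectedPairs_le hρ hK hK2 hKN (t := t) (by linarith)
    have h3 : 0 ≤ (N : ℝ) * (N - K) := by positivity
    rw [pow_succ]
    nlinarith [mul_le_mul_of_nonneg_right ih h3]

/-- A random graph with `n` edges on `⌈c n⌉` vertices is a forest with probability bounded below,
if `c > 2`. -/
theorem exists_le_card_forests {c : ℝ} (hc : 2 < c) : ∃ p : ℝ, 0 < p ∧ p ≤ 1 ∧ ∀ n N : ℕ, 0 < n →
    N = ⌈c * (n : ℝ)⌉₊ → p * ((N : ℝ) ^ 2) ^ n ≤ (forests N n).card := by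
  -- `ρ` bounds the mean degree `2 n / N`. It is below `1` exactly because `c > 2`.
  set ρ : ℝ := 2 / c
  have hρ0 : 0 < ρ := by positivity
  have hρ1 : ρ < 1 := by rw [div_lt_one (by linarith)]; exact hc
  set K : ℝ := 2 / (1 - ρ)
  have hK : K * (1 - ρ) = 2 := div_mul_cancel₀ _ (by linarith)
  have hK2 : 2 ≤ K := by
    rw [le_div_iff₀ (by linarith)]
    nlinarith
  set M : ℕ := ⌈K ^ 2⌉₊
  have hM : 1 ≤ M := Nat.one_le_ceil_iff.2 (by positivity)
  have hMpos : (0 : ℝ) < 1 / (M : ℝ) ^ M := by positivity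
  refine ⟨min (Real.exp (-K)) (1 / (M : ℝ) ^ M), lt_min (Real.exp_pos _) hMpos,
    (min_le_left _ _).trans (by rw [Real.exp_le_one_iff]; linarith), fun n N hn hN => ?_⟩
  have hcn : c * n ≤ N := hN ▸ Nat.le_ceil _
  have hn' : (1 : ℝ) ≤ n := by exact_mod_cast hn
  have h2n : 2 * (n : ℝ) ≤ ρ * N := by
    rw [show ρ * (N : ℝ) = 2 * N / c by simp only [ρ]; ring, le_div_iff₀ (by linarith)]
    linarith
  have hnN : 2 * (n : ℝ) ≤ N := by nlinarith
  have hN0 : (0 : ℝ) < N := by linarith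
  rcases le_or_gt (K ^ 2) N with hKN | hKN
  · refine le_trans ?_ (pow_le_card_forests hρ0.le hK hK2 hKN h2n)
    have hx : K / N ≤ 1 / 2 := by rw [div_le_div_iff₀ hN0 two_pos]; nlinarith
    have hx0 : 0 < K / N := by positivity
    set x := K / N
    -- For `0 < x ≤ 1/2` one has `1 / (1 - x) ≤ 1 + 2 x ≤ exp (2 x)`. With `2 n ≤ N` the `n`-th
    -- power is then at least `exp (-K)`.
    have hexp : Real.exp (-(2 * x)) ≤ 1 - x := by
      have h1 : (1 - x)⁻¹ ≤ Real.exp (2 * x) := by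
        have h2 := Real.add_one_le_exp (2 * x)
        refine le_trans ?_ h2
        rw [inv_le_iff_one_le_mul₀ (by linarith)]
        nlinarith
      rw [Real.exp_neg]
      exact inv_le_of_inv_le₀ (by linarith) h1
    have h1 : Real.exp (-K) ≤ (1 - x) ^ n := by
      refine le_trans ?_ (pow_le_pow_left₀ (Real.exp_pos _).le hexp n)
      rw [← Real.exp_nat_mul, Real.exp_le_exp]
      have : x * N = K := div_mul_cancel₀ _ hN0.ne'
      nlinarith
    have h2 : ((N : ℝ) * (N - K)) ^ n = (1 - x) ^ n * ((N : ℝ) ^ 2) ^ n := by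
      rw [← mul_pow]
      congr 1
      have : x * N = K := div_mul_cancel₀ _ hN0.ne'
      rw [← this]
      ring
    rw [h2]
    gcongr
    exact (min_le_left _ _).trans h1
  -- Only finitely many `N` remain. A single forest suffices, since the number of all sequences is
  -- at most `M ^ M`.
  · have hNM : N ≤ M := by
      have : (N : ℝ) ≤ M := hKN.le.trans (Nat.le_ceil _)
      exact_mod_cast this
    have hcard : (1 : ℝ) ≤ (forests N n).card := by
      have : 0 < (forests N n).card := card_forests_pos (by
        have : (n : ℝ) < N := by linarith
        exact_mod_cast this)
      exact_mod_cast this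
    refine le_trans ?_ hcard
    have h2nN : 2 * n ≤ N := by exact_mod_cast hnN
    have hpow : ((N : ℝ) ^ 2) ^ n ≤ (M : ℝ) ^ M := by
      rw [← pow_mul]
      have h1 : N ^ (2 * n) ≤ M ^ M :=
        (Nat.pow_le_pow_left hNM _).trans (Nat.pow_le_pow_right hM (h2nN.trans hNM))
      exact_mod_cast h1
    calc min (Real.exp (-K)) (1 / (M : ℝ) ^ M) * ((N : ℝ) ^ 2) ^ n
        ≤ 1 / (M : ℝ) ^ M * (M : ℝ) ^ M := by
          gcongr
          exact min_le_right _ _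
      _ = 1 := div_mul_cancel₀ _ (by positivity)

end Counting

/-! ### Runs: determinism, dependence on the hash functions, time budgets. -/

section Execution

variable {E : Env}

@[simp] theorem Cost.zero_steps : (0 : Cost).steps = 0 := rfl
@[simp] theorem Cost.add_steps (a b : Cost) : (a + b).steps = a.steps + b.steps := rfl
@[simp] theorem Cost.tick_steps : Cost.tick.steps = 1 := rfl

theorem Instr.cost_steps (a : Instr) : a.cost.steps = 1 := by cases a <;> rfl

theorem block_steps (l : List Instr) : (l.map Instr.cost).sum.steps = l.length := by
  induction l with
  | nil => rfl
  | cons a l ih => simp [ih, Instr.cost_steps, add_comm]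

/-- This turns the existence statements of the budget calculus into statements about every run. -/
theorem Exec.deterministic {c : Cmd} {s s₁ s₂ : State} {κ₁ κ₂ : Cost} (h₁ : Exec E c s κ₁ s₁)
    (h₂ : Exec E c s κ₂ s₂) : κ₁ = κ₂ ∧ s₁ = s₂ := by
  induction h₁ generalizing κ₂ s₂ with
  | block l s => cases h₂; exact ⟨rfl, rfl⟩
  | seq _ _ ih ih' =>
    cases h₂ with
    | seq h h' =>
      obtain ⟨rfl, rfl⟩ := ih h
      obtain ⟨rfl, rfl⟩ := ih' h'
      exact ⟨rfl, rfl⟩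
  | ite_true hb _ ih =>
    cases h₂ with
    | ite_true _ h => obtain ⟨rfl, rfl⟩ := ih h; exact ⟨rfl, rfl⟩
    | ite_false hb' _ => exact absurd hb hb'
  | ite_false hb _ ih =>
    cases h₂ with
    | ite_true hb' _ => exact absurd hb' hb
    | ite_false _ h => obtain ⟨rfl, rfl⟩ := ih h; exact ⟨rfl, rfl⟩
  | loop_done hb =>
    cases h₂ with
    | loop_done => exact ⟨rfl, rfl⟩
    | loop_step hb' => exact absurd hb' hb
  | loop_step hb _ _ ih ih' =>
    cases h₂ with
    | loop_done hb' => exact absurd hb hb'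
    | loop_step _ h h' =>
      obtain ⟨rfl, rfl⟩ := ih h
      obtain ⟨rfl, rfl⟩ := ih' h'
      exact ⟨rfl, rfl⟩

theorem Instr.counters_le (a : Instr) (s : State) :
    s.pair ≤ (a.apply E s).pair ∧ s.third ≤ (a.apply E s).third := by
  cases a <;> simp [Instr.apply, State.setReg, State.setArr]

theorem block_counters_le (l : List Instr) (s : State) :
    s.pair ≤ (l.foldl (Instr.apply E) s).pair ∧ s.third ≤ (l.foldl (Instr.apply E) s).third := by
  induction l generalizing s with
  | nil => exact ⟨le_rfl, le_rfl⟩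
  | cons a l ih =>
    have h1 := a.counters_le (E := E) s
    have h2 := ih (a.apply E s)
    exact ⟨h1.1.trans h2.1, h1.2.trans h2.2⟩

/-- Since the counters only grow, the final ones bound the numbers of all hash functions consulted
in a run. -/
theorem Exec.counters_le {c : Cmd} {s s' : State} {κ : Cost} (h : Exec E c s κ s') :
    s.pair ≤ s'.pair ∧ s.third ≤ s'.third := by
  induction h with
  | block l s => exact block_counters_le l s
  | seq _ _ ih ih' => exact ⟨ih.1.trans ih'.1, ih.2.trans ih'.2⟩
  | ite_true _ _ ih => exact ih
  | ite_false _ _ ih => exact ih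
  | loop_done => exact ⟨le_rfl, le_rfl⟩
  | loop_step _ _ _ ih ih' => exact ⟨ih.1.trans ih'.1, ih.2.trans ih'.2⟩

/-- The hash functions up to the pair number `p` and up to the function number `q` agree. -/
structure Env.AgreeUpTo (E E' : Env) (p q : ℕ) : Prop where
  modulus : E.modulus = E'.modulus
  h₁ : ∀ t ≤ p, E.h₁ t = E'.h₁ t
  h₂ : ∀ t ≤ p, E.h₂ t = E'.h₂ t
  h₃ : ∀ t ≤ q, E.h₃ t = E'.h₃ t

theorem Env.AgreeUpTo.mono {E E' : Env} {p q p' q' : ℕ} (h : E.AgreeUpTo E' p q) (hp : p' ≤ p)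
    (hq : q' ≤ q) : E.AgreeUpTo E' p' q' :=
  ⟨h.modulus, fun t ht => h.h₁ t (ht.trans hp), fun t ht => h.h₂ t (ht.trans hp),
    fun t ht => h.h₃ t (ht.trans hq)⟩

theorem Env.AgreeUpTo.apply_eq {E' : Env} {s : State} (h : E.AgreeUpTo E' s.pair s.third)
    (a : Instr) : a.apply E s = a.apply E' s := by
  cases a <;> simp [Instr.apply, h.modulus, h.h₁ _ le_rfl, h.h₂ _ le_rfl, h.h₃ _ le_rfl]

theorem Env.AgreeUpTo.foldl_eq {E' : Env} (l : List Instr) (s : State)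
    (h : E.AgreeUpTo E' (l.foldl (Instr.apply E) s).pair (l.foldl (Instr.apply E) s).third) :
    l.foldl (Instr.apply E) s = l.foldl (Instr.apply E') s := by
  induction l generalizing s with
  | nil => rfl
  | cons a l ih =>
    have h1 := block_counters_le (E := E) (a :: l) s
    simp only [List.foldl_cons] at h h1 ⊢
    rw [ih _ h, (h.mono h1.1 h1.2).apply_eq a]

/-- A run depends only on the hash functions which are drawn in it. -/
theorem Exec.congr_env {E' : Env} {c : Cmd} {s s' : State} {κ : Cost} (h : Exec E c s κ s')
    (hE : E.AgreeUpTo E' s'.pair s'.third) : Exec E' c s κ s' := by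
  induction h with
  | block l s => rw [Env.AgreeUpTo.foldl_eq l s hE]; exact Exec.block l s
  | seq h h' ih ih' =>
    exact Exec.seq (ih (hE.mono h'.counters_le.1 h'.counters_le.2)) (ih' hE)
  | ite_true hb _ ih => exact Exec.ite_true hb (ih hE)
  | ite_false hb _ ih => exact Exec.ite_false hb (ih hE)
  | loop_done hb => exact Exec.loop_done hb
  | loop_step hb h h' ih ih' =>
    exact Exec.loop_step hb (ih (hE.mono h'.counters_le.1 h'.counters_le.2)) (ih' hE)

/-- `c`, started in `s` with a budget of `φ` steps, terminates within its budget in a state which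
satisfies `P` together with the rest of the budget. -/
def Runs (E : Env) (c : Cmd) (s : State) (φ : ℕ) (P : ℕ → State → Prop) : Prop :=
  ∃ (κ : Cost) (s' : State) (φ' : ℕ), Exec E c s κ s' ∧ κ.steps + φ' ≤ φ ∧ P φ' s'

variable {c c' : Cmd} {b : Test} {s : State} {φ : ℕ} {P Q : ℕ → State → Prop}

theorem Runs.weaken (h : Runs E c s φ P) (hPQ : ∀ φ' s', P φ' s' → Q φ' s') : Runs E c s φ Q := by
  obtain ⟨κ, s', φ', h1, h2, h3⟩ := h
  exact ⟨κ, s', φ', h1, h2, hPQ _ _ h3⟩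

theorem Runs.mono (h : Runs E c s φ P) {ψ : ℕ} (hφ : φ ≤ ψ) : Runs E c s ψ P := by
  obtain ⟨κ, s', φ', h1, h2, h3⟩ := h
  exact ⟨κ, s', φ', h1, h2.trans hφ, h3⟩

theorem Runs.block (l : List Instr) (φ' : ℕ) (hφ : l.length + φ' ≤ φ)
    (h : P φ' (l.foldl (Instr.apply E) s)) : Runs E (.block l) s φ P :=
  ⟨_, _, φ', Exec.block l s, by rwa [block_steps], h⟩

theorem Runs.seq (h : Runs E c s φ Q) (h' : ∀ φ' s', Q φ' s' → Runs E c' s' φ' P) :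
    Runs E (c ;; c') s φ P := by
  obtain ⟨κ, s', φ', h1, h2, h3⟩ := h
  obtain ⟨κ', s'', φ'', h1', h2', h3'⟩ := h' _ _ h3
  exact ⟨κ + κ', s'', φ'', h1.seq h1', by rw [Cost.add_steps]; omega, h3'⟩

theorem Runs.block_seq (l : List Instr) (φ' : ℕ) (hφ : l.length + φ' ≤ φ)
    (h : Runs E c (l.foldl (Instr.apply E) s) φ' P) : Runs E (.block l ;; c) s φ P :=
  Runs.seq (Q := fun ψ s' => ψ = φ' ∧ s' = l.foldl (Instr.apply E) s)
    (Runs.block l φ' hφ ⟨rfl, rfl⟩) (by rintro _ _ ⟨rfl, rfl⟩; exact h)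

theorem Runs.ite (φ' : ℕ) (hφ : 1 + φ' ≤ φ) (ht : b.Holds s → Runs E c s φ' P)
    (hf : ¬ b.Holds s → Runs E c' s φ' P) : Runs E (.ite b c c') s φ P := by
  by_cases hb : b.Holds s
  · obtain ⟨κ, s', ψ, h1, h2, h3⟩ := ht hb
    exact ⟨_, s', ψ, Exec.ite_true hb h1, by simp; omega, h3⟩
  · obtain ⟨κ, s', ψ, h1, h2, h3⟩ := hf hb
    exact ⟨_, s', ψ, Exec.ite_false hb h1, by simp; omega, h3⟩

/-- The rule for loops: the invariant holds together with a budget, from which every round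
consumes at least the step for the test. -/
theorem Runs.loop (I : ℕ → State → Prop)
    (hstep : ∀ φ s, I φ s → b.Holds s → ∃ φ', 1 + φ' ≤ φ ∧ Runs E c s φ' I)
    (hφ : 1 + φ' ≤ φ) (hI : I φ' s) : Runs E (.loop b c) s φ fun ψ s' => I ψ s' ∧ ¬ b.Holds s' := by
  -- The test in each round uses up a step, so the budget strictly decreases, and the induction
  -- proves termination as well.
  induction φ' using Nat.strong_induction_on generalizing s φ with
  | _ φ' ih =>
    by_cases hb : b.Holds s
    · obtain ⟨φ₁, h1, κ, s', φ₂, h2, h3, h4⟩ := hstep _ _ hI hb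
      obtain ⟨κ', s'', φ₃, h5, h6, h7⟩ := ih φ₂ (by omega) (φ := 1 + φ₂) le_rfl h4
      exact ⟨_, s'', φ₃, Exec.loop_step hb h2 h5, by simp; omega, h7⟩
    · exact ⟨_, s, φ', Exec.loop_done hb, by simpa using hφ, hI, hb⟩

end Execution

/-! ### What a program leaves unchanged. -/

section Frame

variable {E : Env}

/-- The registers which an instruction may write. -/
def Instr.regs : Instr → List Reg
  | .copy dst _ | .incr dst | .addMod dst _ | .subMod dst _ | .load dst _ _ => [dst]
  | .hash1 dst _ | .hash2 dst _ | .hash3 dst _ => [dst]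
  | _ => []

/-- The arrays which an instruction may write. -/
def Instr.arrs : Instr → List Arr
  | .store A _ _ => [A]
  | _ => []

/-- Whether an instruction generates hash functions. -/
def Instr.draws : Instr → Bool
  | .drawPair | .drawThird => true
  | _ => false

/-- The registers which a program may write. -/
def Cmd.regs : Cmd → List Reg
  | .block l => l.flatMap Instr.regs
  | .seq c c' | .ite _ c c' => c.regs ++ c'.regs
  | .loop _ c => c.regs

/-- The arrays which a program may write. -/
def Cmd.arrs : Cmd → List Arr
  | .block l => l.flatMap Instr.arrs
  | .seq c c' | .ite _ c c' => c.arrs ++ c'.arrs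
  | .loop _ c => c.arrs

/-- Whether a program may generate hash functions. -/
def Cmd.draws : Cmd → Bool
  | .block l => l.any Instr.draws
  | .seq c c' | .ite _ c c' => c.draws || c'.draws
  | .loop _ c => c.draws

/-- `s` and `s'` differ only where `c` may write. -/
structure Cmd.Fixes (c : Cmd) (s s' : State) : Prop where
  reg : ∀ q, q ∉ c.regs → s'.reg q = s.reg q
  arr : ∀ A, A ∉ c.arrs → s'.arr A = s.arr A
  pair : c.draws = false → s'.pair = s.pair
  third : c.draws = false → s'.third = s.third

theorem Cmd.Fixes.refl (c : Cmd) (s : State) : c.Fixes s s :=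
  ⟨fun _ _ => rfl, fun _ _ => rfl, fun _ => rfl, fun _ => rfl⟩

theorem Cmd.Fixes.trans {c : Cmd} {s s' s'' : State} (h : c.Fixes s s') (h' : c.Fixes s' s'') :
    c.Fixes s s'' :=
  ⟨fun q hq => (h'.reg q hq).trans (h.reg q hq), fun A hA => (h'.arr A hA).trans (h.arr A hA),
    fun hd => (h'.pair hd).trans (h.pair hd), fun hd => (h'.third hd).trans (h.third hd)⟩

theorem Cmd.Fixes.mono {c c' : Cmd} {s s' : State} (h : c.Fixes s s')
    (hr : ∀ q, q ∈ c.regs → q ∈ c'.regs) (ha : ∀ A, A ∈ c.arrs → A ∈ c'.arrs)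
    (hd : c'.draws = false → c.draws = false) : c'.Fixes s s' :=
  ⟨fun q hq => h.reg q fun h => hq (hr q h), fun A hA => h.arr A fun h => hA (ha A h),
    fun h' => h.pair (hd h'), fun h' => h.third (hd h')⟩

theorem Instr.fixes (a : Instr) (s : State) : (Cmd.block [a]).Fixes s (a.apply E s) := by
  constructor <;> cases a <;>
    simp +contextual [Cmd.regs, Instr.regs, Cmd.arrs, Instr.arrs, Cmd.draws, Instr.draws,
      Instr.apply, State.setReg, State.setArr]

theorem block_fixes (l : List Instr) (s : State) :
    (Cmd.block l).Fixes s (l.foldl (Instr.apply E) s) := by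
  induction l generalizing s with
  | nil => exact Cmd.Fixes.refl _ _
  | cons a l ih =>
    refine Cmd.Fixes.trans (s' := a.apply E s) ((a.fixes s).mono ?_ ?_ ?_)
      ((ih _).mono ?_ ?_ ?_) <;>
      simp +contextual [Cmd.regs, Cmd.arrs, Cmd.draws]

/-- The sets of written registers and arrays are syntactic, so for a concrete program the facts
about unchanged memory reduce to a decidable membership. -/
theorem Exec.fixes {c : Cmd} {s s' : State} {κ : Cost} (h : Exec E c s κ s') : c.Fixes s s' := by
  induction h with
  | block l s => exact block_fixes l s
  | seq _ _ ih ih' =>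
    refine (ih.mono ?_ ?_ ?_).trans (ih'.mono ?_ ?_ ?_) <;>
      simp +contextual [Cmd.regs, Cmd.arrs, Cmd.draws]
  | ite_true _ _ ih =>
    refine ih.mono ?_ ?_ ?_ <;> simp +contextual [Cmd.regs, Cmd.arrs, Cmd.draws]
  | ite_false _ _ ih =>
    refine ih.mono ?_ ?_ ?_ <;> simp +contextual [Cmd.regs, Cmd.arrs, Cmd.draws]
  | loop_done => exact Cmd.Fixes.refl _ _
  | @loop_step b c _ _ _ _ _ _ _ _ ih ih' =>
    exact (ih.mono (c' := .loop b c) (fun _ h => h) (fun _ h => h) (fun h => h)).trans ih'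

variable {c c' : Cmd} {b : Test} {s : State} {φ φ' : ℕ} {P : ℕ → State → Prop}

theorem Runs.fixes (h : Runs E c s φ P) :
    Runs E c s φ fun φ' s' => P φ' s' ∧ c.Fixes s s' := by
  obtain ⟨κ, s', φ', h1, h2, h3⟩ := h
  exact ⟨κ, s', φ', h1, h2, h3, h1.fixes⟩

/-- The rule for loops, in which the invariant need not mention what the loop does not write. -/
theorem Runs.loop_fixes (I : ℕ → State → Prop)
    (hstep : ∀ φ s', I φ s' → c.Fixes s s' → b.Holds s' → ∃ φ', 1 + φ' ≤ φ ∧ Runs E c s' φ' I)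
    (hφ : 1 + φ' ≤ φ) (hI : I φ' s) :
    Runs E (.loop b c) s φ fun ψ s' => I ψ s' ∧ ¬ b.Holds s' ∧ c.Fixes s s' := by
  refine (Runs.loop (fun ψ s' => I ψ s' ∧ c.Fixes s s') ?_ hφ ⟨hI, Cmd.Fixes.refl c s⟩).weaken
    fun ψ s' h => ⟨h.1.1, h.2, h.1.2⟩
  rintro ψ s' ⟨h1, h2⟩ hb
  obtain ⟨ψ', h3, h4⟩ := hstep ψ s' h1 h2 hb
  exact ⟨ψ', h3, h4.fixes.weaken fun _ _ h => ⟨h.1, h2.trans h.2⟩⟩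

end Frame

/-! ### The adjacency lists. -/

section Build

variable {Ev : Env} {s : State} {n N R : ℕ}

/-- The input registers have their values. -/
structure Inputs (n N : ℕ) (s : State) : Prop where
  n : s.reg .n = n
  N : s.reg .N = N
  zero : s.reg .zero = 0
  one : s.reg .one = 1

theorem Inputs.of_fixes {c : Cmd} {s s' : State} (h : Inputs n N s) (hc : c.Fixes s s')
    (hn : Reg.n ∉ c.regs ∧ Reg.N ∉ c.regs ∧ Reg.zero ∉ c.regs ∧ Reg.one ∉ c.regs) :
    Inputs n N s' :=
  ⟨(hc.reg _ hn.1).trans h.n, (hc.reg _ hn.2.1).trans h.N, (hc.reg _ hn.2.2.1).trans h.zero,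
    (hc.reg _ hn.2.2.2).trans h.one⟩

/-- A vertex costs four instructions and a test. Here and below, `R` is the part of the budget
reserved for whatever runs afterwards. -/
theorem clearGraph_runs (hs : Inputs n N s) :
    Runs Ev clearGraph s (5 * N + 2 + R) fun φ s' => R ≤ φ ∧
      ∀ v < N, s'.arr .head1 v = n ∧ s'.arr .head2 v = n ∧ s'.arr .seen v = 0 := by
  refine Runs.block_seq _ (5 * N + 1 + R) (by simp; omega) ?_
  refine (Runs.loop_fixes (φ' := 5 * N + R) (fun φ s' => s'.reg .v ≤ N ∧
    5 * (N - s'.reg .v) + R ≤ φ ∧ ∀ v < s'.reg .v,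
      s'.arr .head1 v = n ∧ s'.arr .head2 v = n ∧ s'.arr .seen v = 0)
    ?_ (by omega) ?_).weaken ?_
  · rintro φ s' ⟨h1, h2, h3⟩ hf hb
    have hin : Inputs n N s' := (hs.of_fixes (block_fixes _ _) (by decide)).of_fixes hf (by decide)
    simp only [Test.Holds, hin.N] at hb
    refine ⟨φ - 1, by omega, Runs.block _ (φ - 5) (by simp; omega) ?_⟩
    simp only [List.foldl_cons, List.foldl_nil, Instr.apply, State.setReg, State.setArr]
    simp only [Function.update_apply, reduceCtorEq, if_true, if_false, hin.n, hin.zero]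
    refine ⟨by omega, by omega, fun v hv => ?_⟩
    rcases eq_or_ne v (s'.reg .v) with rfl | hne
    · simp
    · simpa [hne] using h3 v (by omega)
  · simp [Instr.apply, State.setReg, hs.zero]
  · rintro φ s' ⟨⟨h1, h2, h3⟩, hb, hf⟩
    have hin : Inputs n N s' := (hs.of_fixes (block_fixes _ _) (by decide)).of_fixes hf (by decide)
    simp only [Test.Holds, hin.N] at hb
    exact ⟨by omega, fun v hv => h3 v (by omega)⟩

/-- `next` links the members of the list, starting at `e`, and `n` marks its end. -/
def Linked (next : ℕ → ℕ) (n : ℕ) : ℕ → List ℕ → Prop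
  | e, [] => e = n
  | e, a :: l => e = a ∧ a ≠ n ∧ Linked next n (next a) l

theorem linked_update {next : ℕ → ℕ} {i z e : ℕ} {l : List ℕ} (hi : i ∉ l) :
    Linked (Function.update next i z) n e l ↔ Linked next n e l := by
  induction l generalizing e with
  | nil => rfl
  | cons a l ih =>
    rw [List.mem_cons, not_or] at hi
    simp only [Linked]
    rw [Function.update_of_ne (Ne.symm hi.1), ih hi.2]

/-- The numbers `e < n` with `h e = v`, in decreasing order. -/
def incident (h : ℕ → ℕ) : ℕ → ℕ → List ℕ
  | 0, _ => []
  | n + 1, v => if h n = v then n :: incident h n v else incident h n v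

theorem mem_incident {h : ℕ → ℕ} {n v e : ℕ} : e ∈ incident h n v ↔ e < n ∧ h e = v := by
  induction n with
  | zero => simp [incident]
  | succ n ih =>
    rw [incident]
    split_ifs with hv
    · rw [List.mem_cons, ih]
      constructor
      · rintro (rfl | h)
        · exact ⟨by omega, hv⟩
        · exact ⟨by omega, h.2⟩
      · rintro ⟨h1, h2⟩
        rcases Nat.lt_succ_iff_lt_or_eq.1 h1 with h | h
        · exact Or.inr ⟨h, h2⟩
        · exact Or.inl h
    · rw [ih]
      constructor
      · exact fun h => ⟨by omega, h.2⟩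
      · rintro ⟨h1, h2⟩
        rcases Nat.lt_succ_iff_lt_or_eq.1 h1 with h | rfl
        · exact ⟨h, h2⟩
        · exact absurd h2 hv

theorem nodup_incident {h : ℕ → ℕ} {n v : ℕ} : (incident h n v).Nodup := by
  induction n with
  | zero => exact List.nodup_nil
  | succ n ih =>
    rw [incident]
    split_ifs
    · exact List.nodup_cons.2 ⟨fun hm => by simpa using (mem_incident.1 hm).1, ih⟩
    · exact ih

/-- Every edge lies in exactly one of these lists. This is what makes the total time of all scans
linear. -/
theorem sum_length_incident {h : ℕ → ℕ} {n N : ℕ} (hh : ∀ e < n, h e < N) :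
    ∑ v ∈ Finset.range N, (incident h n v).length = n := by
  induction n with
  | zero => simp [incident]
  | succ n ih =>
    have : ∀ v, (incident h (n + 1) v).length =
        (incident h n v).length + if h n = v then 1 else 0 := by
      intro v
      rw [incident]
      split_ifs <;> simp
    simp only [this, Finset.sum_add_distrib]
    rw [ih fun e he => hh e (by omega)]
    simp [hh n (by omega)]

/-- The new edge is put in front of the list of `h i`. The cell `next i` lies on no older list,
because these contain only numbers below `i`. -/
theorem linked_store {next head h : ℕ → ℕ} {i v : ℕ}
    (hl : Linked next n (head v) (incident h i v)) (hi : i < n) :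
    Linked (Function.update next i (head (h i))) n (Function.update head (h i) i v)
      (incident h (i + 1) v) := by
  have hni : i ∉ incident h i v := fun hm => by simpa using (mem_incident.1 hm).1
  rw [incident]
  split_ifs with hv
  · subst hv
    simp only [Linked, Function.update_self]
    exact ⟨trivial, hi.ne, (linked_update hni).2 hl⟩
  · rw [Function.update_of_ne (Ne.symm hv)]
    exact (linked_update hni).2 hl

/-- The arrays which describe the graph are correct. -/
structure GraphStored (n N : ℕ) (h₁ h₂ : ℕ → ℕ) (s : State) : Prop where
  end1 : ∀ e < n, s.arr .end1 e = h₁ e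
  end2 : ∀ e < n, s.arr .end2 e = h₂ e
  list1 : ∀ v < N, Linked (s.arr .next1) n (s.arr .head1 v) (incident h₁ n v)
  list2 : ∀ v < N, Linked (s.arr .next2) n (s.arr .head2 v) (incident h₂ n v)

/-- An edge costs eleven instructions and a test. -/
theorem buildGraph_runs (hs : Inputs n N s)
    (hh : ∀ v < N, s.arr .head1 v = n ∧ s.arr .head2 v = n) :
    Runs Ev buildGraph s (12 * n + 2 + R) fun φ s' => R ≤ φ ∧
      GraphStored n N (Ev.h₁ s.pair) (Ev.h₂ s.pair) s' := by
  refine Runs.block_seq _ (12 * n + 1 + R) (by simp; omega) ?_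
  refine (Runs.loop_fixes (φ' := 12 * n + R) (fun φ s' => s'.reg .i ≤ n ∧
    12 * (n - s'.reg .i) + R ≤ φ ∧
    (∀ e < s'.reg .i, s'.arr .end1 e = Ev.h₁ s.pair e ∧ s'.arr .end2 e = Ev.h₂ s.pair e) ∧
    (∀ v < N, Linked (s'.arr .next1) n (s'.arr .head1 v) (incident (Ev.h₁ s.pair) (s'.reg .i) v)) ∧
    (∀ v < N, Linked (s'.arr .next2) n (s'.arr .head2 v) (incident (Ev.h₂ s.pair) (s'.reg .i) v)))
    ?_ (by omega) ?_).weaken ?_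
  · rintro φ s' ⟨h1, h2, h3, h4, h5⟩ hf hb
    have hin : Inputs n N s' := (hs.of_fixes (block_fixes _ _) (by decide)).of_fixes hf (by decide)
    have hp : s'.pair = s.pair := hf.pair (by decide)
    simp only [Test.Holds, hin.n] at hb
    refine ⟨φ - 1, by omega, Runs.block _ (φ - 12) (by simp; omega) ?_⟩
    simp only [List.foldl_cons, List.foldl_nil, Instr.apply, State.setReg, State.setArr]
    simp only [Function.update_apply, reduceCtorEq, if_true, if_false, hp]
    simp only [← Function.update_apply]
    refine ⟨by omega, by omega, fun e he => ?_, fun v hv => ?_, fun v hv => ?_⟩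
    · rcases eq_or_ne e (s'.reg .i) with rfl | hne
      · simp
      · simpa [hne] using h3 e (by omega)
    · exact linked_store (h4 v hv) hb
    · exact linked_store (h5 v hv) hb
  · simp only [List.foldl_cons, List.foldl_nil, Instr.apply, State.setReg]
    simp only [Function.update_apply, if_true, hs.zero]
    exact ⟨by omega, by omega, by simp, fun v hv => (hh v hv).1, fun v hv => (hh v hv).2⟩
  · rintro φ s' ⟨⟨h1, h2, h3, h4, h5⟩, hb, hf⟩
    have hin : Inputs n N s' := (hs.of_fixes (block_fixes _ _) (by decide)).of_fixes hf (by decide)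
    simp only [Test.Holds, hin.n] at hb
    have hi : s'.reg .i = n := by omega
    rw [hi] at h3 h4 h5
    exact ⟨by omega, fun e he => (h3 e he).1, fun e he => (h3 e he).2, h4, h5⟩

end Build

/-! ### The invariant of the breadth-first search. -/

section Search

/-- The end of an edge on the given side. -/
def half (E : ℕ → ℕ × ℕ) (e : ℕ) (σ : Bool) : ℕ := if σ then (E e).2 else (E e).1

/-- The edges along which the vertices have been reached. -/
def treeEdges (n : ℕ) (ord : ℕ → ℕ) (qt : ℕ) (pe : ℕ → ℕ) : Set ℕ :=
  {e | e < n ∧ ∃ i < qt, pe (ord i) = e}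

/-- The invariant of the breadth-first search of the graph with the edges `E e`, `e < n`, and the
vertices `v < N`. The vertices `ord i` with `i < qt` have been reached, the vertex `ord i` from
`par (ord i)` along the edge `pe (ord i)`, where the number `n` marks the roots; those with `i < q`
have been processed; the half-edges in `H` have been handled; the mark `bad` signals a cycle. -/
structure BFS (n N : ℕ) (E : ℕ → ℕ × ℕ) (ord : ℕ → ℕ) (qt : ℕ) (par pe : ℕ → ℕ) (bad q : ℕ)
    (H : Set (ℕ × Bool)) : Prop where
  inj : ∀ i < qt, ∀ j < qt, ord i = ord j → i = j
  lt : ∀ i < qt, ord i < N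
  q_le : q ≤ qt
  tree : ∀ i < qt, pe (ord i) ≠ n → pe (ord i) < n ∧ ∃ j < i, ord j = par (ord i) ∧
    ∃ σ, (pe (ord i), σ) ∈ H ∧ half E (pe (ord i)) σ = ord j ∧ half E (pe (ord i)) (!σ) = ord i
  forest : IsForest E (treeEdges n ord qt pe)
  handled : ∀ e σ, (e, σ) ∈ H → e < n ∧ (∃ i < qt, ord i = half E e (!σ)) ∧
    Conn E (treeEdges n ord qt pe) (half E e σ) (half E e (!σ)) ∧
    (bad = 0 → e ∈ treeEdges n ord qt pe)
  processed : ∀ i < q, ∀ e < n, ∀ σ, half E e σ = ord i → (e, σ) ∈ H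
  comp : ∀ i j, q ≤ i → i < qt → q ≤ j → j < qt →
    Conn E (treeEdges n ord qt pe) (ord i) (ord j)
  bad : bad = 0 ∨ bad = 1 ∧ ¬ IsForest E {e | e < n}

variable {n N : ℕ} {E : ℕ → ℕ × ℕ} {ord : ℕ → ℕ} {qt : ℕ} {par pe : ℕ → ℕ} {bad q : ℕ}
  {H : Set (ℕ × Bool)} {w e : ℕ} {σ : Bool}

theorem joins_half : Joins E e (half E e σ) (half E e (!σ)) := by
  cases σ
  · exact joins_ends E e
  · exact (joins_ends E e).symm

theorem bfs_start : BFS n N E ord 0 par pe 0 0 ∅ where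
  inj := by simp
  lt := by simp
  q_le := le_rfl
  tree := by simp
  forest := fun e he => by simp [treeEdges] at he
  handled := by simp
  processed := by simp
  comp := by simp
  bad := Or.inl rfl

/-- The marker `n` of a root is not the number of an edge. -/
theorem treeEdges_root (hw : ∀ i < qt, ord i ≠ w) :
    treeEdges n (Function.update ord qt w) (qt + 1) (Function.update pe w n) =
      treeEdges n ord qt pe := by
  ext e
  refine and_congr_right fun he => ?_
  constructor
  · rintro ⟨i, hi, h⟩
    rcases Nat.lt_succ_iff_lt_or_eq.1 hi with hi' | rfl
    · rw [Function.update_of_ne hi'.ne, Function.update_of_ne (hw i hi')] at h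
      exact ⟨i, hi', h⟩
    · rw [Function.update_self, Function.update_self] at h
      omega
  · rintro ⟨i, hi, h⟩
    refine ⟨i, by omega, ?_⟩
    rw [Function.update_of_ne hi.ne, Function.update_of_ne (hw i hi)]
    exact h

theorem treeEdges_edge (hw : ∀ i < qt, ord i ≠ w) (he : e < n) :
    treeEdges n (Function.update ord qt w) (qt + 1) (Function.update pe w e) =
      insert e (treeEdges n ord qt pe) := by
  ext a
  constructor
  · rintro ⟨ha, i, hi, h⟩
    rcases Nat.lt_succ_iff_lt_or_eq.1 hi with hi' | rfl
    · rw [Function.update_of_ne hi'.ne, Function.update_of_ne (hw i hi')] at h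
      exact Or.inr ⟨ha, i, hi', h⟩
    · rw [Function.update_self, Function.update_self] at h
      exact Or.inl h.symm
  · rintro (rfl | ⟨ha, i, hi, h⟩)
    · exact ⟨he, qt, by omega, by rw [Function.update_self, Function.update_self]⟩
    · refine ⟨ha, i, by omega, ?_⟩
      rw [Function.update_of_ne hi.ne, Function.update_of_ne (hw i hi)]
      exact h

namespace BFS

/-- Both ends of a tree edge have been reached. -/
theorem reached_of_tree (h : BFS n N E ord qt par pe bad q H) (he : e ∈ treeEdges n ord qt pe)
    (σ : Bool) : ∃ i < qt, ord i = half E e σ := by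
  obtain ⟨hen, i, hi, rfl⟩ := he
  obtain ⟨-, j, hj, -, τ, -, h1, h2⟩ := h.tree i hi hen.ne
  rcases Bool.eq_or_eq_not σ τ with rfl | rfl
  · exact ⟨j, by omega, h1.symm⟩
  · exact ⟨i, hi, h2.symm⟩

/-- A root is taken only when the queue is empty (`q = qt`). It is then the only pending vertex,
which keeps all pending vertices in one component. -/
theorem visit_root (h : BFS n N E ord qt par pe bad q H) (hq : q = qt) (hw : ∀ i < qt, ord i ≠ w)
    (hwN : w < N) (u : ℕ) : BFS n N E (Function.update ord qt w) (qt + 1)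
      (Function.update par w u) (Function.update pe w n) bad q H := by
  have hT := treeEdges_root (n := n) (pe := pe) hw
  have hord : ∀ i < qt, Function.update ord qt w i = ord i := fun i hi =>
    Function.update_of_ne hi.ne _ _
  constructor
  · intro i hi j hj hij
    rcases Nat.lt_succ_iff_lt_or_eq.1 hi with hi' | rfl <;>
      rcases Nat.lt_succ_iff_lt_or_eq.1 hj with hj' | rfl
    · rw [hord i hi', hord j hj'] at hij
      exact h.inj i hi' j hj' hij
    · rw [hord i hi', Function.update_self] at hij
      exact absurd hij (hw i hi')
    · rw [hord j hj', Function.update_self] at hij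
      exact absurd hij.symm (hw j hj')
    · rfl
  · intro i hi
    rcases Nat.lt_succ_iff_lt_or_eq.1 hi with hi' | rfl
    · rw [hord i hi']; exact h.lt i hi'
    · rwa [Function.update_self]
  · omega
  · intro i hi hpe
    rcases Nat.lt_succ_iff_lt_or_eq.1 hi with hi' | rfl
    · rw [hord i hi', Function.update_of_ne (hw i hi')] at hpe ⊢
      rw [Function.update_of_ne (hw i hi')]
      obtain ⟨h1, j, hj, h2⟩ := h.tree i hi' hpe
      exact ⟨h1, j, hj, by rwa [hord j (by omega)]⟩
    · rw [Function.update_self, Function.update_self] at hpe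
      exact absurd rfl hpe
  · rw [hT]; exact h.forest
  · rw [hT]
    intro e σ he
    obtain ⟨h1, ⟨i, hi, h2⟩, h3⟩ := h.handled e σ he
    exact ⟨h1, ⟨i, by omega, by rwa [hord i hi]⟩, h3⟩
  · intro i hi e he σ hσ
    rw [hord i (by omega)] at hσ
    exact h.processed i hi e he σ hσ
  · intro i j h1 h2 h3 h4
    have hi : i = j := by omega
    subst hi
    exact Conn.refl _
  · exact h.bad

/-- Tree edges have both ends among the reached vertices, so none touches the new vertex `w`. The
new edge therefore cannot close a cycle, and it joins `w` to the component of the current vertex. -/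
theorem visit_edge (h : BFS n N E ord qt par pe bad q H) (hq : q < qt) (hw : ∀ i < qt, ord i ≠ w)
    (hwN : w < N) (he : e < n) (hu : half E e σ = ord q) (hwe : half E e (!σ) = w) :
    BFS n N E (Function.update ord qt w) (qt + 1) (Function.update par w (ord q))
      (Function.update pe w e) bad q (insert (e, σ) H) := by
  have hT := treeEdges_edge (pe := pe) hw he
  have hord : ∀ i < qt, Function.update ord qt w i = ord i := fun i hi =>
    Function.update_of_ne hi.ne _ _
  have heT : e ∉ treeEdges n ord qt pe := fun heT => by
    obtain ⟨i, hi, h1⟩ := h.reached_of_tree heT (!σ)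
    exact hw i hi (h1.trans hwe)
  have hsub : treeEdges n ord qt pe ⊆ insert e (treeEdges n ord qt pe) := Set.subset_insert _ _
  have hJ : Joins E e (ord q) w := hu ▸ hwe ▸ joins_half
  have huw : Conn E (insert e (treeEdges n ord qt pe)) (ord q) w :=
    Conn.of_joins (Set.mem_insert _ _) hJ
  have hnc : ¬ Conn E (treeEdges n ord qt pe) w (ord q) := fun hc => by
    refine hw q hq (Eq.symm (hc.eq_of_untouched fun a ha => ?_))
    obtain ⟨i, hi, h1⟩ := h.reached_of_tree ha false
    obtain ⟨j, hj, h2⟩ := h.reached_of_tree ha true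
    exact ⟨fun h' => hw i hi (h1.trans h'), fun h' => hw j hj (h2.trans h')⟩
  constructor
  · intro i hi j hj hij
    rcases Nat.lt_succ_iff_lt_or_eq.1 hi with hi' | rfl <;>
      rcases Nat.lt_succ_iff_lt_or_eq.1 hj with hj' | rfl
    · rw [hord i hi', hord j hj'] at hij
      exact h.inj i hi' j hj' hij
    · rw [hord i hi', Function.update_self] at hij
      exact absurd hij (hw i hi')
    · rw [hord j hj', Function.update_self] at hij
      exact absurd hij.symm (hw j hj')
    · rfl
  · intro i hi
    rcases Nat.lt_succ_iff_lt_or_eq.1 hi with hi' | rfl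
    · rw [hord i hi']; exact h.lt i hi'
    · rwa [Function.update_self]
  · omega
  · intro i hi hpe
    rcases Nat.lt_succ_iff_lt_or_eq.1 hi with hi' | rfl
    · rw [hord i hi', Function.update_of_ne (hw i hi')] at hpe ⊢
      rw [Function.update_of_ne (hw i hi')]
      obtain ⟨h1, j, hj, h2, τ, h3, h4⟩ := h.tree i hi' hpe
      exact ⟨h1, j, hj, by rwa [hord j (by omega)], τ, Or.inr h3, by rwa [hord j (by omega)]⟩
    · simp only [Function.update_self]
      refine ⟨he, q, hq, hord q hq, σ, Or.inl rfl, ?_, hwe⟩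
      rw [hord q hq, hu]
  · rw [hT, isForest_insert heT]
    refine ⟨h.forest, fun hc => ?_⟩
    cases σ
    · exact hnc (by rw [← hu, ← hwe]; exact hc.symm)
    · exact hnc (by rw [← hu, ← hwe]; exact hc)
  · rw [hT]
    rintro a τ (ha | ha)
    · obtain ⟨rfl, rfl⟩ := Prod.mk.inj ha
      refine ⟨he, ⟨qt, by omega, ?_⟩, ?_, fun _ => Set.mem_insert _ _⟩
      · rw [Function.update_self, hwe]
      · rw [hu, hwe]; exact huw
    · obtain ⟨h1, ⟨i, hi, h2⟩, h3, h4⟩ := h.handled a τ ha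
      exact ⟨h1, ⟨i, by omega, by rwa [hord i hi]⟩, h3.mono hsub, fun hb => hsub (h4 hb)⟩
  · intro i hi a ha τ hτ
    rw [hord i (by omega)] at hτ
    exact Or.inr (h.processed i hi a ha τ hτ)
  · rw [hT]
    have key : ∀ i, q ≤ i → i < qt + 1 →
        Conn E (insert e (treeEdges n ord qt pe)) (ord q) (Function.update ord qt w i) := by
      intro i h1 h2
      rcases Nat.lt_succ_iff_lt_or_eq.1 h2 with hi' | rfl
      · rw [hord i hi']
        exact (h.comp q i le_rfl hq h1 hi').mono hsub
      · rwa [Function.update_self]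
    exact fun i j h1 h2 h3 h4 => (key i h1 h2).symm.trans (key j h3 h4)
  · exact h.bad

/-- The edge along which the current vertex was reached is met again from its far end. It is already
a tree edge, so only the record of handled half-edges changes. -/
theorem skip_edge (h : BFS n N E ord qt par pe bad q H) (hq : q < qt) (he : e < n)
    (hp : e = pe (ord q)) : BFS n N E ord qt par pe bad q (insert (e, σ) H) := by
  have heT : e ∈ treeEdges n ord qt pe := ⟨he, q, hq, hp.symm⟩
  refine { h with tree := ?_, handled := ?_, processed := ?_ }
  · intro i hi hpe
    obtain ⟨h1, j, hj, h2, τ, h3, h4⟩ := h.tree i hi hpe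
    exact ⟨h1, j, hj, h2, τ, Or.inr h3, h4⟩
  · rintro a τ (ha | ha)
    · obtain ⟨rfl, rfl⟩ := Prod.mk.inj ha
      exact ⟨he, h.reached_of_tree heT _, Conn.of_joins heT joins_half, fun _ => heT⟩
    · exact h.handled a τ ha
  · exact fun i hi a ha τ hτ => Or.inr (h.processed i hi a ha τ hτ)

/-- The edge is not a tree edge, but its ends are connected by tree edges, so the whole graph cannot
be a forest. Edges are compared by number and not by their ends, so this includes loops and repeated
edges. -/
theorem close_cycle (h : BFS n N E ord qt par pe bad q H) (hq : q < qt) (he : e < n)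
    (hH : (e, σ) ∉ H) (hp : e ≠ pe (ord q)) (hu : half E e σ = ord q)
    (hw : ∃ i < qt, ord i = half E e (!σ)) :
    BFS n N E ord qt par pe 1 q (insert (e, σ) H) := by
  -- A tree edge has its half-edge at the parent in `H`. Met through a half-edge outside `H`, it
  -- would be met from the child, and then it would be the parent edge of the current vertex.
  have heT : e ∉ treeEdges n ord qt pe := by
    rintro ⟨-, i, hi, rfl⟩
    obtain ⟨-, j, hj, -, τ, h2, h3, h4⟩ := h.tree i hi he.ne
    rcases Bool.eq_or_eq_not σ τ with rfl | rfl
    · exact hH h2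
    · exact hp (by rw [← hu, h4])
  have hc : Conn E (treeEdges n ord qt pe) (half E e σ) (half E e (!σ)) := by
    obtain ⟨i, hi, hiw⟩ := hw
    -- If the other end has been processed, the opposite half-edge was handled and connectivity was
    -- recorded then. Otherwise both ends are pending, hence in one component.
    rcases lt_or_ge i q with hiq | hiq
    · have := (h.handled e (!σ) (h.processed i hiq e he _ hiw.symm)).2.2.1
      rw [Bool.not_not] at this
      exact this.symm
    · rw [hu, ← hiw]
      exact h.comp q i le_rfl hq hiq hi
  refine { h with tree := ?_, handled := ?_, processed := ?_, bad := ?_ }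
  · intro i hi hpe
    obtain ⟨h1, j, hj, h2, τ, h3, h4⟩ := h.tree i hi hpe
    exact ⟨h1, j, hj, h2, τ, Or.inr h3, h4⟩
  · rintro a τ (ha | ha)
    · obtain ⟨rfl, rfl⟩ := Prod.mk.inj ha
      exact ⟨he, hw, hc, fun h => absurd h one_ne_zero⟩
    · obtain ⟨h1, h2, h3, -⟩ := h.handled a τ ha
      exact ⟨h1, h2, h3, fun h => absurd h one_ne_zero⟩
  · exact fun i hi a ha τ hτ => Or.inr (h.processed i hi a ha τ hτ)
  · refine Or.inr ⟨rfl, fun hF => hF e he ?_⟩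
    have hc' : Conn E ({e | e < n} \ {e}) (half E e σ) (half E e (!σ)) := hc.mono fun a ha =>
      ⟨ha.1, fun hae => heT (Set.mem_singleton_iff.1 hae ▸ ha)⟩
    cases σ
    · exact hc'
    · exact hc'.symm

theorem advance (h : BFS n N E ord qt par pe bad q H) (hq : q < qt)
    (hH : ∀ e < n, ∀ σ, half E e σ = ord q → (e, σ) ∈ H) :
    BFS n N E ord qt par pe bad (q + 1) H := by
  refine { h with q_le := hq, processed := ?_, comp := ?_ }
  · intro i hi
    rcases Nat.lt_succ_iff_lt_or_eq.1 hi with hi' | rfl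
    · exact h.processed i hi'
    · exact hH
  · exact fun i j h1 h2 h3 h4 => h.comp i j (by omega) h2 (by omega) h4

/-- At the end all edges are tree edges, unless there is a cycle. -/
theorem mem_treeEdges (h : BFS n N E ord qt par pe 0 qt H)
    (hN : ∀ v < N, ∃ i < qt, ord i = v) (hE : ∀ e < n, (E e).1 < N) (he : e < n) :
    e ∈ treeEdges n ord qt pe := by
  obtain ⟨i, hi, h1⟩ := hN _ (hE e he)
  exact (h.handled e false (h.processed i hi e he false h1.symm)).2.2.2 rfl

/-- Without an alarm all edges are tree edges, and these form a forest. The converse is part of the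
invariant. -/
theorem isForest_iff (h : BFS n N E ord qt par pe bad qt H)
    (hN : ∀ v < N, ∃ i < qt, ord i = v) (hE : ∀ e < n, (E e).1 < N) :
    bad = 0 ↔ IsForest E {e | e < n} := by
  constructor
  · rintro rfl
    exact h.forest.mono fun e he => h.mem_treeEdges hN hE he
  · exact fun hF => h.bad.resolve_right fun hb => hb.2 hF

end BFS

end Search

/-! ### Scanning one adjacency list. -/

section SearchProgram

variable {Ev : Env} {s : State} {n N R q : ℕ} {E : ℕ → ℕ × ℕ} {H : Set (ℕ × Bool)}

/-- The memory holds a state of the breadth-first search. -/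
structure Searching (n N : ℕ) (E : ℕ → ℕ × ℕ) (s : State) (q : ℕ) (H : Set (ℕ × Bool)) :
    Prop where
  bfs : BFS n N E (s.arr .order) (s.reg .qt) (s.arr .parent) (s.arr .parentEdge) (s.reg .bad) q H
  seen : ∀ v < N, s.arr .seen v = 0 ↔ ∀ i < s.reg .qt, s.arr .order i ≠ v

/-- The queue of `s` is an initial segment of the one of `s'`. -/
def Extends (s s' : State) : Prop :=
  s.reg .qt ≤ s'.reg .qt ∧ ∀ i < s.reg .qt, s'.arr .order i = s.arr .order i

theorem Extends.refl (s : State) : Extends s s := ⟨le_rfl, fun _ _ => rfl⟩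

theorem Extends.trans {s s' s'' : State} (h : Extends s s') (h' : Extends s' s'') :
    Extends s s'' :=
  ⟨h.1.trans h'.1, fun i hi => (h'.2 i (hi.trans_le h.1)).trans (h.2 i hi)⟩

theorem Extends.reached {s s' : State} (h : Extends s s') {v : ℕ}
    (hv : ∃ i < s.reg .qt, s.arr .order i = v) : ∃ i < s'.reg .qt, s'.arr .order i = v := by
  obtain ⟨i, hi, hiv⟩ := hv
  exact ⟨i, hi.trans_le h.1, (h.2 i hi).trans hiv⟩

/-- `s'` arises from `s` by a visit of `w` along the edge `l`. -/
structure Visited (s : State) (w l : ℕ) (s' : State) : Prop where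
  seen : s'.arr .seen = Function.update (s.arr .seen) w 1
  parentEdge : s'.arr .parentEdge = Function.update (s.arr .parentEdge) w l
  parent : s'.arr .parent = Function.update (s.arr .parent) w (s.reg .u)
  order : s'.arr .order = Function.update (s.arr .order) (s.reg .qt) w
  reg : s'.reg = Function.update s.reg .qt (s.reg .qt + 1)

theorem visit_runs (hs : Inputs n N s) (z l : Reg) :
    Runs Ev (visit z l) s (5 + R) fun φ s' => φ = R ∧ Visited s (s.reg z) (s.reg l) s' := by
  refine Runs.block _ R (by simp) ⟨rfl, ?_⟩
  constructor <;>
    simp [Instr.apply, State.setReg, State.setArr, hs.one]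

theorem Visited.extends {s' : State} {w l : ℕ} (h : Visited s w l s') : Extends s s' := by
  refine ⟨by simp [h.reg], fun i hi => ?_⟩
  rw [h.order, Function.update_of_ne hi.ne]

theorem Visited.seen_iff {s' : State} {w l : ℕ} (h : Visited s w l s')
    (hseen : ∀ v < N, s.arr .seen v = 0 ↔ ∀ i < s.reg .qt, s.arr .order i ≠ v) :
    ∀ v < N, s'.arr .seen v = 0 ↔ ∀ i < s'.reg .qt, s'.arr .order i ≠ v := by
  intro v hv
  rw [h.seen, h.order, h.reg, Function.update_self]
  rcases eq_or_ne v w with rfl | hne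
  · rw [Function.update_self]
    exact ⟨fun h => absurd h one_ne_zero,
      fun h => absurd (Function.update_self _ _ _) (h (s.reg .qt) (by omega))⟩
  · rw [Function.update_of_ne hne, hseen v hv]
    constructor
    · intro h i hi
      rcases Nat.lt_succ_iff_lt_or_eq.1 hi with hi' | rfl
      · rw [Function.update_of_ne hi'.ne]; exact h i hi'
      · rw [Function.update_self]; exact hne.symm
    · intro h i hi
      have := h i (by omega)
      rwa [Function.update_of_ne hi.ne] at this

theorem Searching.visit_root {s' : State} {w : ℕ} (h : Searching n N E s q H)
    (hv : Visited s w n s') (hq : q = s.reg .qt) (hw : s.arr .seen w = 0) (hwN : w < N) :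
    Searching n N E s' q H := by
  refine ⟨?_, hv.seen_iff h.seen⟩
  rw [hv.order, hv.parent, hv.parentEdge, hv.reg, Function.update_self,
    Function.update_of_ne (by decide)]
  exact h.bfs.visit_root hq ((h.seen w hwN).1 hw) hwN _

theorem Searching.visit_edge {s' : State} {e : ℕ} {σ : Bool} (h : Searching n N E s q H)
    (hv : Visited s (half E e (!σ)) e s') (hq : q < s.reg .qt) (he : e < n)
    (hu : half E e σ = s.reg .u) (hou : s.arr .order q = s.reg .u)
    (hw : s.arr .seen (half E e (!σ)) = 0) (hwN : half E e (!σ) < N) :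
    Searching n N E s' q (insert (e, σ) H) := by
  refine ⟨?_, hv.seen_iff h.seen⟩
  rw [hv.order, hv.parent, hv.parentEdge, hv.reg, Function.update_self,
    Function.update_of_ne (by decide), ← hou]
  exact h.bfs.visit_edge hq ((h.seen _ hwN).1 hw) hwN he (hu.trans hou.symm) rfl

/-- What is known about the edge in register `e` while it is being scanned. -/
structure Scanned (n N : ℕ) (E : ℕ → ℕ × ℕ) (s s' : State) (q : ℕ) (H : Set (ℕ × Bool)) :
    Prop where
  searching : Searching n N E s' q H
  ext : Extends s s'
  parentEdge : s'.arr .parentEdge (s.reg .u) = s.reg .p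

/-- The worst round costs eleven steps: three tests, two loads, five instructions of a visit, and
the load of the next edge. The half-edges of the list must be new to `H`, since otherwise a tree
edge to a child could be mistaken for a cycle. -/
theorem scan_runs (head next other : Arr) {σ : Bool} {L : List ℕ} (hs : Inputs n N s)
    (hnext : next ∉ [Arr.seen, .parentEdge, .parent, .order])
    (hother : other ∉ [Arr.seen, .parentEdge, .parent, .order])
    (hS : Searching n N E s q H) (hq : q < s.reg .qt) (hu : s.arr .order q = s.reg .u)
    (hp : s.arr .parentEdge (s.reg .u) = s.reg .p)
    (hL : Linked (s.arr next) n (s.arr head (s.reg .u)) L) (hnd : L.Nodup)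
    (hLe : ∀ e ∈ L, e < n ∧ half E e σ = s.reg .u ∧ (e, σ) ∉ H)
    (hend : ∀ e < n, s.arr other e = half E e (!σ)) (hEN : ∀ e < n, ∀ τ, half E e τ < N) :
    Runs Ev (scan head next other) s (11 * L.length + 2 + R) fun φ s' => R ≤ φ ∧
      Scanned n N E s s' q (H ∪ {x | x.1 ∈ L ∧ x.2 = σ}) := by
  refine Runs.block_seq _ (11 * L.length + 1 + R) (by simp; omega) ?_
  -- `d` is the part of the list already scanned and `l` the part still to come.
  refine (Runs.loop_fixes (φ' := 11 * L.length + R) (fun φ s' => ∃ d l, L = d ++ l ∧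
    Linked (s.arr next) n (s'.reg .e) l ∧ 11 * l.length + R ≤ φ ∧
    Scanned n N E s s' q (H ∪ {x | x.1 ∈ d ∧ x.2 = σ})) ?_ (by omega) ?_).weaken ?_
  · rintro φ s' ⟨d, l, rfl, hl, hφ, hsc⟩ hf hb
    have hin : Inputs n N s' := by
      refine (hs.of_fixes (block_fixes _ _) ?_).of_fixes hf ?_ <;>
        simp [Cmd.regs, Instr.regs, visit]
    have hnx : s'.arr next = s.arr next := hf.arr next (by
      simpa [Cmd.arrs, Instr.arrs, visit] using hnext)
    have hot : s'.arr other = s.arr other := hf.arr other (by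
      simpa [Cmd.arrs, Instr.arrs, visit] using hother)
    have hru : s'.reg .u = s.reg .u := hf.reg _ (by simp [Cmd.regs, Instr.regs, visit])
    have hrp : s'.reg .p = s.reg .p := hf.reg _ (by simp [Cmd.regs, Instr.regs, visit])
    simp only [Test.Holds, hin.n] at hb
    rcases l with _ | ⟨e, l⟩
    · exact absurd hl hb
    obtain ⟨hre, hen, hl⟩ := hl
    obtain ⟨he, heu, heH⟩ := hLe e (by simp)
    have hed : e ∉ d := fun h => by
      have := List.disjoint_of_nodup_append hnd h
      simp at this
    have hq' : q < s'.reg .qt := hq.trans_le hsc.ext.1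
    have hu' : s'.arr .order q = s.reg .u := (hsc.ext.2 q hq).trans hu
    have hHins : (H ∪ {x : ℕ × Bool | x.1 ∈ d ++ [e] ∧ x.2 = σ}) =
        insert (e, σ) (H ∪ {x | x.1 ∈ d ∧ x.2 = σ}) := by
      ext ⟨a, τ⟩
      simp only [Set.mem_union, Set.mem_ofPred_eq, List.mem_append, List.mem_singleton,
        Set.mem_insert_iff, Prod.mk.injEq]
      tauto
    simp only [List.length_cons] at hφ
    refine ⟨φ - 1, by omega, ?_⟩
    refine Runs.seq (Q := fun ψ s'' => 11 * l.length + 1 + R ≤ ψ ∧ s''.reg .e = e ∧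
      s''.arr next = s.arr next ∧
      Scanned n N E s s'' q (H ∪ {x | x.1 ∈ d ++ [e] ∧ x.2 = σ})) ?_ ?_
    · rw [hHins]
      refine Runs.ite (φ - 2) (by omega) (fun hep => ?_) (fun hep => ?_)
      · simp only [Test.Holds, hre, hrp] at hep
        have hw : s'.arr other (s'.reg .e) = half E e (!σ) := by rw [hot, hre, hend e he]
        refine Runs.block_seq _ (φ - 4) (by simp; omega) ?_
        generalize hs1 : List.foldl (Instr.apply Ev) s'
          [Instr.load .w other .e, .load .t .seen .w] = s1
        have hin1 : Inputs n N s1 := hs1 ▸ hin.of_fixes (block_fixes _ _) (by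
          simp [Cmd.regs, Instr.regs])
        have h1w : s1.reg .w = half E e (!σ) := by
          simp [← hs1, Instr.apply, State.setReg, hw]
        have h1t : s1.reg .t = s'.arr .seen (half E e (!σ)) := by
          simp [← hs1, Instr.apply, State.setReg, hw]
        have h1e : s1.reg .e = e := by simp [← hs1, Instr.apply, State.setReg, hre]
        have h1u : s1.reg .u = s.reg .u := by simp [← hs1, Instr.apply, State.setReg, hru]
        have h1q : s1.reg .qt = s'.reg .qt := by simp [← hs1, Instr.apply, State.setReg]
        have h1b : s1.reg .bad = s'.reg .bad := by simp [← hs1, Instr.apply, State.setReg]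
        have h1a : s1.arr = s'.arr := by simp [← hs1, Instr.apply, State.setReg]
        have hS1 : Searching n N E s1 q (H ∪ {x | x.1 ∈ d ∧ x.2 = σ}) := by
          refine ⟨?_, ?_⟩ <;> rw [h1a, h1q]
          · rw [h1b]; exact hsc.searching.bfs
          · exact hsc.searching.seen
        have hext1 : Extends s s1 := by
          unfold Extends
          rw [h1a, h1q]
          exact hsc.ext
        have hwN : half E e (!σ) < N := hEN e he _
        refine Runs.ite (φ - 5) (by omega) (fun ht => ?_) (fun ht => ?_)
        · simp only [Test.Holds, hin1.zero, h1t] at ht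
          rw [show φ - 5 = 5 + (φ - 10) by omega]
          refine (visit_runs hin1 .w .e).fixes.weaken ?_
          rintro ψ s'' ⟨⟨rfl, hv⟩, hfx⟩
          rw [h1w, h1e] at hv
          refine ⟨by omega, by rw [hv.reg, Function.update_of_ne (by decide), h1e], ?_, ?_⟩
          · rw [hfx.arr next (by simpa [visit, Cmd.arrs, Instr.arrs] using hnext), h1a, hnx]
          · refine ⟨hS1.visit_edge hv (h1q ▸ hq') he (heu.trans h1u.symm) ?_ ?_ hwN,
              hext1.trans hv.extends, ?_⟩
            · rw [h1a, h1u, hu']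
            · rw [h1a, ht]
            -- The entry at the current vertex is not overwritten: that vertex has been reached,
            -- while the visited one was unseen.
            · rw [hv.parentEdge, Function.update_of_ne, h1a, hsc.parentEdge]
              rw [← hu']
              exact ((hsc.searching.seen _ hwN).1 ht q hq')
        · simp only [Test.Holds, hin1.zero, h1t] at ht
          refine Runs.block _ (φ - 6) (by simp; omega) ?_
          simp only [List.foldl_cons, List.foldl_nil, Instr.apply, State.setReg]
          refine ⟨by omega, by simp [h1e], by rw [h1a, hnx], ?_, ?_, ?_⟩
          · refine ⟨?_, ?_⟩
            · simp only [hin1.one, Function.update_self]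
              simp only [ne_eq, reduceCtorEq, not_false_eq_true, Function.update_of_ne]
              refine hS1.bfs.close_cycle (h1q ▸ hq') he ?_ ?_ ?_ ?_
              · rintro (h | h)
                · exact heH h
                · exact hed h.1
              · rw [h1a, hu', hsc.parentEdge]
                exact hep
              · rw [h1a, hu', heu]
              · rw [h1a, h1q]
                by_contra hcon
                exact ht ((hsc.searching.seen _ hwN).2 fun i hi h => hcon ⟨i, hi, h⟩)
            · simpa using hS1.seen
          · simpa [Extends] using hext1
          · simpa [h1a] using hsc.parentEdge
      · simp only [Test.Holds, hre, hrp, not_not] at hep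
        refine Runs.block _ (φ - 2) (by simp) ?_
        refine ⟨by omega, hre, hnx, ⟨?_, hsc.searching.seen⟩, hsc.ext, hsc.parentEdge⟩
        refine hsc.searching.bfs.skip_edge hq' he ?_
        rw [hep]
        exact (by rw [← hsc.parentEdge, ← hu'])
    · rintro ψ s'' ⟨h1, h2, h3, h4⟩
      refine Runs.block _ (ψ - 1) (by simp; omega) ⟨d ++ [e], l, by simp, ?_, by omega, ?_⟩
      · simpa [Instr.apply, State.setReg, h2, h3] using hl
      · refine ⟨⟨?_, ?_⟩, ?_, ?_⟩
        · simpa [Instr.apply, State.setReg] using h4.searching.bfs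
        · simpa [Instr.apply, State.setReg] using h4.searching.seen
        · simpa [Extends, Instr.apply, State.setReg] using h4.ext
        · simpa [Instr.apply, State.setReg] using h4.parentEdge
  · refine ⟨[], L, rfl, by simpa [Instr.apply, State.setReg] using hL, le_rfl, ⟨?_, ?_⟩, ?_, ?_⟩
    · simpa [Instr.apply, State.setReg] using hS.bfs
    · simpa [Instr.apply, State.setReg] using hS.seen
    · simp [Extends, Instr.apply, State.setReg]
    · simpa [Instr.apply, State.setReg] using hp
  · rintro φ s' ⟨⟨d, l, rfl, hl, hφ, hsc⟩, hb, hf⟩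
    have hin : Inputs n N s' := by
      refine (hs.of_fixes (block_fixes _ _) ?_).of_fixes hf ?_ <;>
        simp [Cmd.regs, Instr.regs, visit]
    simp only [Test.Holds, hin.n, not_not] at hb
    rcases l with _ | ⟨e, l⟩
    · rw [List.append_nil]
      exact ⟨by omega, hsc⟩
    · exact absurd (hl.1.symm.trans hb) hl.2.1

end SearchProgram

/-! ### The complete search in linear time. -/

section SearchLoop

variable {Ev : Env} {s : State} {n N R q : ℕ} {E : ℕ → ℕ × ℕ} {H : Set (ℕ × Bool)}

/-- The budget for processing the vertex `v`. -/
def vertexBudget (n : ℕ) (E : ℕ → ℕ × ℕ) (v : ℕ) : ℕ :=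
  8 + 11 * (incident (fun e => (E e).1) n v).length + 11 * (incident (fun e => (E e).2) n v).length

/-- The budget which has been used when `q` vertices have been processed. -/
def spent (n : ℕ) (E : ℕ → ℕ × ℕ) (s : State) (q : ℕ) : ℕ :=
  ∑ i ∈ Finset.range q, vertexBudget n E (s.arr .order i)

/-- No vertex enters the queue twice, and on each side the list lengths add up to `n`. -/
theorem spent_le (hE : ∀ e < n, ∀ τ, half E e τ < N)
    (hS : Searching n N E s q H) {q' : ℕ} (hq : q' ≤ s.reg .qt) :
    spent n E s q' ≤ 8 * N + 22 * n := by
  have hinj : Set.InjOn (s.arr .order) (Finset.range q' : Set ℕ) := by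
    intro i hi j hj hij
    simp only [Finset.coe_range, Set.mem_Iio] at hi hj
    exact hS.bfs.inj i (by omega) j (by omega) hij
  calc spent n E s q' = ∑ v ∈ (Finset.range q').image (s.arr .order), vertexBudget n E v := by
        rw [Finset.sum_image hinj, spent]
    _ ≤ ∑ v ∈ Finset.range N, vertexBudget n E v := by
        refine Finset.sum_le_sum_of_subset fun v hv => ?_
        obtain ⟨i, hi, rfl⟩ := Finset.mem_image.1 hv
        rw [Finset.mem_range] at hi ⊢
        exact hS.bfs.lt i (by omega)
    _ = 8 * N + 22 * n := by
        have h1 := sum_length_incident (h := fun e => (E e).1) fun e he => hE e he false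
        have h2 := sum_length_incident (h := fun e => (E e).2) fun e he => hE e he true
        simp only [vertexBudget, Finset.sum_add_distrib, ← Finset.mul_sum, h1, h2]
        simp
        ring

theorem spent_eq {s' : State} (h : Extends s s') (hq : q ≤ s.reg .qt) :
    spent n E s' q = spent n E s q :=
  Finset.sum_congr rfl fun i hi => by rw [h.2 i ((Finset.mem_range.1 hi).trans_le hq)]

/-- Only half-edges at processed vertices have been handled. -/
def HandledFrom (E : ℕ → ℕ × ℕ) (s : State) (q : ℕ) (H : Set (ℕ × Bool)) : Prop :=
  ∀ e σ, (e, σ) ∈ H → ∃ i < q, s.arr .order i = half E e σ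

/-- The body of the loop that processes the queue. -/
def processVertex : Cmd :=
  .block [.load .u .order .qh, .incr .qh, .load .p .parentEdge .u] ;;
    scan .head1 .next1 .end2 ;; scan .head2 .next2 .end1

/-- The constant `8` in the vertex budget consists of the loop test, three instructions, and two
steps of overhead for each scan. The loop test is not part of this body, hence the `- 1`. -/
theorem processVertex_runs (hs : Inputs n N s)
    (hG : GraphStored n N (fun e => (E e).1) (fun e => (E e).2) s)
    (hE : ∀ e < n, ∀ τ, half E e τ < N) (hS : Searching n N E s (s.reg .qh) H)
    (hH : HandledFrom E s (s.reg .qh) H) (hq : s.reg .qh < s.reg .qt) :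
    Runs Ev processVertex s (vertexBudget n E (s.arr .order (s.reg .qh)) - 1 + R) fun φ s' =>
      R ≤ φ ∧ s'.reg .qh = s.reg .qh + 1 ∧ Extends s s' ∧ ∃ H',
        Searching n N E s' (s'.reg .qh) H' ∧ HandledFrom E s' (s'.reg .qh) H' := by
  set q := s.reg .qh with hqdef
  set u := s.arr .order q with hudef
  have huN : u < N := hS.bfs.lt q hq
  set L₁ := incident (fun e => (E e).1) n u with hL₁
  set L₂ := incident (fun e => (E e).2) n u with hL₂
  have hbud : vertexBudget n E u = 8 + 11 * L₁.length + 11 * L₂.length := rfl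
  have hnotin : ∀ e σ, half E e σ = u → (e, σ) ∉ H := fun e σ hu he => by
    obtain ⟨i, hi, hie⟩ := hH e σ he
    have := hS.bfs.inj i (by omega) q hq (hie.trans hu)
    omega
  refine Runs.block_seq _ (4 + 11 * L₁.length + 11 * L₂.length + R) (by simp; omega) ?_
  generalize hs1 : List.foldl (Instr.apply Ev) s
    [Instr.load .u .order .qh, .incr .qh, .load .p .parentEdge .u] = s1
  have hin1 : Inputs n N s1 := hs1 ▸ hs.of_fixes (block_fixes _ _) (by decide)
  have h1a : s1.arr = s.arr := by simp [← hs1, Instr.apply, State.setReg]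
  have h1u : s1.reg .u = u := by simp [← hs1, Instr.apply, State.setReg, hudef, hqdef]
  have h1p : s1.reg .p = s.arr .parentEdge u := by
    simp [← hs1, Instr.apply, State.setReg, hudef, hqdef]
  have h1h : s1.reg .qh = q + 1 := by simp [← hs1, Instr.apply, State.setReg, hqdef]
  have h1q : s1.reg .qt = s.reg .qt := by simp [← hs1, Instr.apply, State.setReg]
  have h1b : s1.reg .bad = s.reg .bad := by simp [← hs1, Instr.apply, State.setReg]
  have hS1 : Searching n N E s1 q H := by
    refine ⟨?_, ?_⟩ <;> rw [h1a, h1q]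
    · rw [h1b]; exact hS.bfs
    · exact hS.seen
  have hext1 : Extends s s1 := ⟨h1q.ge, fun i _ => by rw [h1a]⟩
  have hscan := scan_runs (Ev := Ev) .head1 .next1 .end2 (R := 2 + 11 * L₂.length + R) (σ := false)
    (L := L₁) hin1 (by decide) (by decide) hS1 (h1q ▸ hq) (by rw [h1a, h1u]) (by rw [h1a, h1u, h1p])
    (by rw [h1a, h1u]; exact hG.list1 u huN) nodup_incident
    (fun e he => ⟨(mem_incident.1 he).1, (mem_incident.1 he).2.trans h1u.symm,
      hnotin _ _ (mem_incident.1 he).2⟩) (fun e he => by rw [h1a]; exact hG.end2 e he) hE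
  refine Runs.seq (hscan.fixes.mono (by omega)) ?_
  · rintro φ2 s2 ⟨⟨hφ2, hsc⟩, hf⟩
    have hin2 : Inputs n N s2 := hin1.of_fixes hf (by decide)
    have h2u : s2.reg .u = u := (hf.reg _ (by decide)).trans h1u
    have h2p : s2.reg .p = s1.reg .p := hf.reg _ (by decide)
    have h2h : s2.reg .qh = q + 1 := (hf.reg _ (by decide)).trans h1h
    have hq2 : q < s2.reg .qt := (h1q ▸ hq).trans_le hsc.ext.1
    have hext2 : Extends s s2 := hext1.trans hsc.ext
    have harr : ∀ A, A ∉ (scan .head1 .next1 .end2).arrs → s2.arr A = s.arr A := fun A hA => by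
      rw [hf.arr A hA, h1a]
    have hscan2 := scan_runs (Ev := Ev) .head2 .next2 .end1 (R := R) (σ := true)
      (L := L₂) hin2 (by decide) (by decide) hsc.searching hq2 (by rw [hext2.2 q hq, h2u])
      (by rw [h2u, h2p, ← hsc.parentEdge, h1u])
      (by rw [harr _ (by decide), harr _ (by decide), h2u]; exact hG.list2 u huN) nodup_incident
      (fun e he => by
        obtain ⟨h1, h2⟩ := mem_incident.1 he
        refine ⟨h1, h2.trans h2u.symm, ?_⟩
        -- The first scan handled half-edges of the other side only. Thus the second half of a loop
        -- at `u` is still new.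
        rintro (h | h)
        · exact hnotin e true h2 h
        · exact absurd h.2 (by simp)) (fun e he => by rw [harr _ (by decide)]; exact hG.end1 e he) hE
    refine (hscan2.fixes.mono (by omega)).weaken fun φ' s' h => ?_
    obtain ⟨⟨h1, h2⟩, h3⟩ := h
    have hext3 : Extends s s' := hext2.trans h2.ext
    have h3h : s'.reg .qh = q + 1 := (h3.reg _ (by decide)).trans h2h
    have hq3 : q < s'.reg .qt := hq.trans_le hext3.1
    refine ⟨h1, h3h, hext3,
      H ∪ {x | x.1 ∈ L₁ ∧ x.2 = false} ∪ {x | x.1 ∈ L₂ ∧ x.2 = true}, ?_, ?_⟩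
    · rw [h3h]
      refine ⟨h2.searching.bfs.advance hq3 fun e he σ hσ => ?_, h2.searching.seen⟩
      rw [hext3.2 q hq] at hσ
      cases σ
      · exact Or.inl (Or.inr ⟨mem_incident.2 ⟨he, hσ⟩, rfl⟩)
      · exact Or.inr ⟨mem_incident.2 ⟨he, hσ⟩, rfl⟩
    · rw [h3h]
      rintro e σ ((he | ⟨he, hσ⟩) | ⟨he, hσ⟩)
      · obtain ⟨i, hi, hie⟩ := hH e σ he
        exact ⟨i, by omega, by rw [hext3.2 i (by omega), hie]⟩
      all_goals
        refine ⟨q, by omega, ?_⟩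
        dsimp only at he hσ
        subst hσ
        rw [hext3.2 q hq]
        exact (mem_incident.1 he).2.symm

/-- The result of the search: the vertices are `ord 0, …, ord (N - 1)`, and `bad` is set if and
only if there is a cycle. -/
structure Searched (n N : ℕ) (E : ℕ → ℕ × ℕ) (s : State) : Prop where
  inj : ∀ i < N, ∀ j < N, s.arr .order i = s.arr .order j → i = j
  surj : ∀ v < N, ∃ i < N, s.arr .order i = v
  lt : ∀ i < N, s.arr .order i < N
  tree : ∀ i < N, s.arr .parentEdge (s.arr .order i) ≠ n →
    s.arr .parentEdge (s.arr .order i) < n ∧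
    ∃ j < i, s.arr .order j = s.arr .parent (s.arr .order i) ∧
      Joins E (s.arr .parentEdge (s.arr .order i)) (s.arr .order j) (s.arr .order i)
  bad_le : s.reg .bad ≤ 1
  bad_iff : s.reg .bad = 0 ↔ IsForest E {e | e < n}
  edges : s.reg .bad = 0 → ∀ e < n, ∃ i < N, s.arr .parentEdge (s.arr .order i) = e

theorem Searching.searched (hE : ∀ e < n, ∀ τ, half E e τ < N)
    (hS : Searching n N E s (s.reg .qt) H)
    (hr : ∀ v < N, ∃ i < s.reg .qt, s.arr .order i = v) : Searched n N E s := by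
  -- The order is injective into the vertices and covers all of them, so counting gives equality.
  have hqt : s.reg .qt = N := by
    apply le_antisymm
    · have := Finset.card_le_card_of_injOn (s := Finset.range (s.reg .qt)) (t := Finset.range N)
        (s.arr .order) (fun i hi => by simpa using hS.bfs.lt i (by simpa using hi))
        (fun i hi j hj hij => hS.bfs.inj i (by simpa using hi) j (by simpa using hj) hij)
      simpa using this
    · have := Finset.card_le_card_of_surjOn (s := Finset.range (s.reg .qt)) (t := Finset.range N)
        (s.arr .order) (fun v hv => by simpa using hr v (by simpa using hv))
      simpa using this
  have hb := hS.bfs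
  refine ⟨?_, ?_, ?_, ?_, ?_, hb.isForest_iff hr fun e he => hE e he false, ?_⟩
  · rw [← hqt]; exact hb.inj
  · rw [hqt] at hr; exact hr
  · rw [← hqt]; exact fun i hi => hqt ▸ hb.lt i hi
  · rw [← hqt]
    intro i hi hpe
    obtain ⟨h1, j, hj, h2, σ, -, h3, h4⟩ := hb.tree i hi hpe
    exact ⟨h1, j, hj, h2, by
      have := joins_half (E := E) (e := s.arr .parentEdge (s.arr .order i)) (σ := σ)
      rwa [h3, h4] at this⟩
  · rcases hb.bad with h | h
    · omega
    · exact h.1.le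
  · intro h0 e he
    rw [h0] at hb
    obtain ⟨-, i, hi, h⟩ := hb.mem_treeEdges hr (fun e he => hE e he false) he
    exact ⟨i, hqt ▸ hi, h⟩

/-- The cost of the nested loop is amortised: the expenses for processed vertices are charged to one
global account of `8 N + 22 n`, independent of how these vertices are distributed over the
components. -/
theorem search_runs (hs : Inputs n N s) (hb : s.reg .bad = 0)
    (hG : GraphStored n N (fun e => (E e).1) (fun e => (E e).2) s)
    (hseen : ∀ v < N, s.arr .seen v = 0) (hE : ∀ e < n, ∀ τ, half E e τ < N) :
    Runs Ev search s (18 * N + 22 * n + 4 + R) fun φ s' => R ≤ φ ∧ Searched n N E s' := by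
  refine Runs.block_seq _ (18 * N + 22 * n + 1 + R) (by simp; omega) ?_
  have hGf : ∀ s', search.Fixes s s' → GraphStored n N (fun e => (E e).1) (fun e => (E e).2) s' := by
    intro s' hf
    constructor <;> rw [hf.arr _ (by decide)]
    · exact hG.end1
    · exact hG.end2
    · rw [hf.arr _ (by decide)]; exact hG.list1
    · rw [hf.arr _ (by decide)]; exact hG.list2
  -- A value of `r` costs at most ten steps beyond vertex processing: three tests, including the
  -- last one of the inner loop, the load, five steps for the visit, and the increment.
  refine (Runs.loop_fixes (φ' := 18 * N + 22 * n + R) (fun φ s' => ∃ H, s'.reg .r ≤ N ∧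
    Searching n N E s' (s'.reg .qh) H ∧ HandledFrom E s' (s'.reg .qh) H ∧
    s'.reg .qh = s'.reg .qt ∧ (∀ v < s'.reg .r, ∃ i < s'.reg .qt, s'.arr .order i = v) ∧
    10 * (N - s'.reg .r) + (8 * N + 22 * n) + R ≤ φ + spent n E s' (s'.reg .qh))
    ?_ (by omega) ?_).weaken ?_
  · rintro φ s' ⟨H, hr, hS, hH, hqq, hv, hφ⟩ hf hlt
    have hf0 : search.Fixes s s' := ((block_fixes _ _).mono (by decide) (by decide)
      (by decide)).trans (hf.mono (by decide) (by decide) (by decide))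
    have hin : Inputs n N s' := hs.of_fixes hf0 (by decide)
    simp only [Test.Holds, hin.N] at hlt
    have hsp := spent_le hE hS hqq.le
    refine ⟨φ - 1, by omega, ?_⟩
    refine Runs.block_seq _ (φ - 2) (by simp; omega) ?_
    generalize hs1 : List.foldl (Instr.apply Ev) s' [Instr.load .t .seen .r] = s1
    have hfx1 : (Cmd.block [Instr.load .t .seen .r]).Fixes s' s1 := hs1 ▸ block_fixes _ _
    have hin1 : Inputs n N s1 := hin.of_fixes hfx1 (by decide)
    have h1a : s1.arr = s'.arr := by simp [← hs1, Instr.apply, State.setReg]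
    have h1t : s1.reg .t = s'.arr .seen (s'.reg .r) := by simp [← hs1, Instr.apply, State.setReg]
    have h1r : s1.reg .r = s'.reg .r := hfx1.reg _ (by decide)
    have h1h : s1.reg .qh = s'.reg .qh := hfx1.reg _ (by decide)
    have h1q : s1.reg .qt = s'.reg .qt := hfx1.reg _ (by decide)
    have hS1 : Searching n N E s1 (s1.reg .qh) H := by
      refine ⟨?_, ?_⟩ <;> rw [h1a, h1q]
      · rw [h1h, hfx1.reg .bad (by decide)]; exact hS.bfs
      · exact hS.seen
    have hH1 : HandledFrom E s1 (s1.reg .qh) H := by rw [HandledFrom, h1a, h1h]; exact hH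
    have hv1 : ∀ v < s1.reg .r, ∃ i < s1.reg .qt, s1.arr .order i = v := by
      rw [h1a, h1q, h1r]; exact hv
    have hφ1 : 10 * (N - s'.reg .r) + (8 * N + 22 * n) + R ≤ φ + spent n E s1 (s1.reg .qh) := by
      rw [spent, h1a, h1h]; exact hφ
    have hf1 : search.Fixes s s1 := hf0.trans (hfx1.mono (by decide) (by decide) (by decide))
    refine Runs.seq (Q := fun ψ s2 => ∃ H, s2.reg .r = s'.reg .r ∧
      Searching n N E s2 (s2.reg .qh) H ∧ HandledFrom E s2 (s2.reg .qh) H ∧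
      s2.reg .qh = s2.reg .qt ∧ (∀ v < s2.reg .r + 1, ∃ i < s2.reg .qt, s2.arr .order i = v) ∧
      10 * (N - (s2.reg .r + 1)) + (8 * N + 22 * n) + R + 1 ≤ ψ + spent n E s2 (s2.reg .qh)) ?_ ?_
    · refine Runs.ite (φ - 3) (by omega) (fun ht => ?_) (fun ht => ?_)
      · simp only [Test.Holds, h1t, hin1.zero] at ht
        refine Runs.seq (Q := fun ψ s2 => ψ = φ - 8 ∧ Visited s1 (s'.reg .r) n s2 ∧
          (visit .r .n).Fixes s1 s2) ?_ ?_
        · rw [show φ - 3 = 5 + (φ - 8) by omega]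
          refine (visit_runs hin1 .r .n).fixes.weaken fun ψ s2 h => ⟨h.1.1, ?_, h.2⟩
          rw [← h1r]
          have := h.1.2
          rwa [hin1.n] at this
        · rintro ψ s2 ⟨rfl, hvis, hfx2⟩
          have hin2 : Inputs n N s2 := hin1.of_fixes hfx2 (by decide)
          have hf2 : search.Fixes s s2 := hf1.trans (hfx2.mono (by decide) (by decide) (by decide))
          have h2h : s2.reg .qh = s1.reg .qh := hfx2.reg _ (by decide)
          have h2r : s2.reg .r = s'.reg .r := (hfx2.reg _ (by decide)).trans h1r
          have h2q : s2.reg .qt = s1.reg .qt + 1 := by rw [hvis.reg, Function.update_self]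
          have hqh1 : s1.reg .qh = s1.reg .qt := by rw [h1h, h1q, hqq]
          have hS2 : Searching n N E s2 (s2.reg .qh) H := by
            rw [h2h]
            exact hS1.visit_root hvis hqh1 (by rw [h1a]; exact ht) hlt
          have hext := hvis.extends
          have hH2 : HandledFrom E s2 (s2.reg .qh) H := by
            intro e σ he
            obtain ⟨i, hi, hie⟩ := hH1 e σ he
            exact ⟨i, h2h ▸ hi, by rw [hext.2 i (by omega), hie]⟩
          have hsp2 : spent n E s2 (s2.reg .qh) = spent n E s1 (s1.reg .qh) := by
            rw [h2h]; exact spent_eq hext hqh1.le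
          have hr2 : ∃ i < s2.reg .qt, s2.arr .order i = s'.reg .r :=
            ⟨s1.reg .qt, by omega, by rw [hvis.order, Function.update_self]⟩
          refine (Runs.loop_fixes (φ' := φ - 9) (fun ψ s3 => ∃ H,
            Searching n N E s3 (s3.reg .qh) H ∧ HandledFrom E s3 (s3.reg .qh) H ∧
            Extends s2 s3 ∧ 10 * (N - (s'.reg .r + 1)) + (8 * N + 22 * n) + R + 1 ≤
              ψ + spent n E s3 (s3.reg .qh)) ?_ (by omega) ?_).weaken ?_
          · rintro ψ s3 ⟨H, hS3, hH3, hext3, hψ⟩ hfx3 hlt3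
            simp only [Test.Holds] at hlt3
            have hin3 : Inputs n N s3 := hin2.of_fixes hfx3 (by decide)
            -- The account is not exceeded even after this vertex, so `ψ` covers its budget and the
            -- truncated subtractions below are exact.
            have hsp3 := spent_le hE hS3 (Nat.succ_le_of_lt hlt3)
            have hsucc : spent n E s3 (s3.reg .qh).succ = spent n E s3 (s3.reg .qh) +
              vertexBudget n E (s3.arr .order (s3.reg .qh)) := Finset.sum_range_succ _ _
            have hpos : 8 ≤ vertexBudget n E (s3.arr .order (s3.reg .qh)) := by
              rw [vertexBudget]; omega
            refine ⟨ψ - 1, by omega, ?_⟩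
            rw [show ψ - 1 = vertexBudget n E (s3.arr .order (s3.reg .qh)) - 1 +
              (ψ - vertexBudget n E (s3.arr .order (s3.reg .qh))) by omega]
            refine (processVertex_runs hin3 (hGf s3 (hf2.trans (hfx3.mono (by decide) (by decide)
              (by decide)))) hE hS3 hH3 hlt3).weaken ?_
            rintro χ s4 ⟨h1, h2, h3, H', h4, h5⟩
            refine ⟨H', h4, h5, hext3.trans h3, ?_⟩
            rw [h2, spent_eq h3 (Nat.succ_le_of_lt hlt3)]
            omega
          · exact ⟨H, hS2, hH2, Extends.refl _, by omega⟩
          · rintro ψ s3 ⟨⟨H, hS3, hH3, hext3, hψ⟩, hlt3, hfx3⟩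
            simp only [Test.Holds] at hlt3
            have h3r : s3.reg .r = s'.reg .r := (hfx3.reg _ (by decide)).trans h2r
            refine ⟨H, h3r, hS3, hH3, le_antisymm hS3.bfs.q_le (by omega), fun v hv => ?_, ?_⟩
            · rw [h3r] at hv
              rcases Nat.lt_succ_iff_lt_or_eq.1 hv with hv | rfl
              · exact hext3.reached (hext.reached (hv1 v (h1r ▸ hv)))
              · exact hext3.reached hr2
            · rw [h3r]; exact hψ
      · simp only [Test.Holds, h1t, hin1.zero] at ht
        refine Runs.block _ (φ - 3) (by simp) ⟨H, h1r, hS1, hH1, by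
          simp only [List.foldl_nil]; rw [h1h, h1q, hqq], ?_, ?_⟩
        · simp only [List.foldl_nil]
          intro v hv
          rcases Nat.lt_succ_iff_lt_or_eq.1 hv with hv | rfl
          · exact hv1 v hv
          · by_contra hcon
            refine ht ((hS.seen _ hlt).2 fun i hi h => hcon ⟨i, h1q ▸ hi, ?_⟩)
            rw [h1a, h1r, h]
        · simp only [List.foldl_nil]
          rw [h1r]
          omega
    · rintro ψ s2 ⟨H, h2r, hS2, hH2, hq2, hv2, hψ⟩
      have hsp2 := spent_le hE hS2 hq2.le
      refine Runs.block _ (ψ - 1) (by simp; omega) ?_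
      simp only [List.foldl_cons, List.foldl_nil, Instr.apply, State.setReg]
      refine ⟨H, ?_, ⟨?_, ?_⟩, ?_, ?_, ?_, ?_⟩ <;>
        simp only [Function.update_self, ne_eq, reduceCtorEq, not_false_eq_true,
          Function.update_of_ne]
      · omega
      · exact hS2.bfs
      · exact hS2.seen
      · exact hH2
      · exact hq2
      · exact hv2
      · unfold spent at hψ ⊢
        dsimp only
        omega
  · simp only [List.foldl_cons, List.foldl_nil, Instr.apply, State.setReg]
    refine ⟨∅, ?_, ⟨?_, ?_⟩, ?_, ?_, ?_, ?_⟩ <;>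
      simp only [Function.update_self, ne_eq, reduceCtorEq, not_false_eq_true,
        Function.update_of_ne, hs.zero, hb]
    · exact Nat.zero_le _
    · exact bfs_start
    · simpa using hseen
    · simp [HandledFrom]
    · simp
    · simp [spent]; omega
  · rintro φ s' ⟨⟨H, hr, hS, hH, hqq, hv, hφ⟩, hlt, hf⟩
    have hin : Inputs n N s' := (hs.of_fixes (block_fixes _ _) (by decide)).of_fixes hf (by decide)
    simp only [Test.Holds, hin.N] at hlt
    have hrN : s'.reg .r = N := by omega
    have hsp := spent_le hE hS hqq.le
    rw [hqq] at hS
    rw [hrN] at hv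
    exact ⟨by omega, hS.searched hE hv⟩

end SearchLoop

/-! ### Back-substitution and the loop of attempts. -/

section Creation

variable {Ev : Env} {s : State} {n N R : ℕ}

theorem cast_subMod {m : ℕ} (hm : 0 < m) (x y : ℕ) :
    (((x + (m - y % m)) % m : ℕ) : ZMod m) = x - y := by
  rw [ZMod.natCast_mod, Nat.cast_add, Nat.cast_sub (Nat.mod_lt _ hm).le, ZMod.natCast_self,
    ZMod.natCast_mod]
  ring

/-- A parent precedes its child in the search order, so its entry is final when the child is
computed. The worst round takes twelve steps. -/
theorem solve_runs {E : ℕ → ℕ × ℕ} (hs : Inputs n N s) (hS : Searched n N E s)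
    (hm : 0 < Ev.modulus) :
    Runs Ev solve s (12 * N + 2 + R) fun φ s' => R ≤ φ ∧ (∀ v < N, s'.arr .g v < Ev.modulus) ∧
      ∀ i < N, s.arr .parentEdge (s.arr .order i) ≠ n →
        (s'.arr .g (s.arr .order i) : ZMod Ev.modulus) +
          s'.arr .g (s.arr .parent (s.arr .order i)) +
          Ev.h₃ s.third (s.arr .parentEdge (s.arr .order i)) =
        s.arr .val (s.arr .parentEdge (s.arr .order i)) := by
  refine Runs.block_seq _ (12 * N + 1 + R) (by simp; omega) ?_
  set ord := s.arr .order with hord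
  set pe := s.arr .parentEdge with hpe
  set par := s.arr .parent with hpar
  refine (Runs.loop_fixes (φ' := 12 * N + R) (fun φ s' => s'.reg .i ≤ N ∧
    12 * (N - s'.reg .i) + R ≤ φ ∧ ∀ j < s'.reg .i, s'.arr .g (ord j) < Ev.modulus ∧
      (pe (ord j) ≠ n → (s'.arr .g (ord j) : ZMod Ev.modulus) + s'.arr .g (par (ord j)) +
        Ev.h₃ s.third (pe (ord j)) = s.arr .val (pe (ord j)))) ?_ (by omega) ?_).weaken ?_
  · rintro φ s' ⟨h1, h2, h3⟩ hf hb
    have hf0 : solve.Fixes s s' := ((block_fixes _ _).mono (by decide) (by decide)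
      (by decide)).trans (hf.mono (by decide) (by decide) (by decide))
    have hin : Inputs n N s' := hs.of_fixes hf0 (by decide)
    have hord' : s'.arr .order = ord := hf0.arr _ (by decide)
    have hpe' : s'.arr .parentEdge = pe := hf0.arr _ (by decide)
    have hpar' : s'.arr .parent = par := hf0.arr _ (by decide)
    have hval' : s'.arr .val = s.arr .val := hf0.arr _ (by decide)
    have hthird' : s'.third = s.third := hf0.third (by decide)
    simp only [Test.Holds, hin.N] at hb
    set i := s'.reg .i with hi
    -- Writing the entry of `ord i` disturbs no equation: the order is injective, so the write hits
    -- neither an earlier vertex nor a parent, which is itself an earlier vertex.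
    have key : ∀ (z : ℕ) (g' : ℕ → ℕ), g' = Function.update (s'.arr .g) (ord i) z →
        z < Ev.modulus → (pe (ord i) ≠ n → (z : ZMod Ev.modulus) + s'.arr .g (par (ord i)) +
          Ev.h₃ s.third (pe (ord i)) = s.arr .val (pe (ord i))) →
        ∀ j < i + 1, g' (ord j) < Ev.modulus ∧
          (pe (ord j) ≠ n → (g' (ord j) : ZMod Ev.modulus) + g' (par (ord j)) +
            Ev.h₃ s.third (pe (ord j)) = s.arr .val (pe (ord j))) := by
      rintro z _ rfl hz heq j hj
      have hparj : pe (ord j) ≠ n → Function.update (s'.arr .g) (ord i) z (par (ord j)) =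
          s'.arr .g (par (ord j)) := by
        intro hne
        obtain ⟨-, j', hj', h, -⟩ := hS.tree j (by omega) hne
        rw [← hpar, ← hord] at h
        refine Function.update_of_ne (fun h' => ?_) _ _
        have := hS.inj j' (by omega) i hb (h.trans h')
        omega
      rcases Nat.lt_succ_iff_lt_or_eq.1 hj with hj' | rfl
      · have hne : ord j ≠ ord i := fun h => hj'.ne (hS.inj j (by omega) i hb h)
        rw [Function.update_of_ne hne]
        refine ⟨(h3 j hj').1, fun hpn => ?_⟩
        rw [hparj hpn]
        exact (h3 j hj').2 hpn
      · rw [Function.update_self]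
        refine ⟨hz, fun hpn => ?_⟩
        rw [hparj hpn]
        exact heq hpn
    refine ⟨φ - 1, by omega, ?_⟩
    refine Runs.block_seq _ (φ - 3) (by simp; omega) ?_
    generalize hs1 : List.foldl (Instr.apply Ev) s'
      [Instr.load .w .order .i, .load .e .parentEdge .w] = s1
    have hin1 : Inputs n N s1 := hs1 ▸ hin.of_fixes (block_fixes _ _) (by decide)
    have h1a : s1.arr = s'.arr := by simp [← hs1, Instr.apply, State.setReg]
    have h1w : s1.reg .w = ord i := by
      simp [← hs1, Instr.apply, State.setReg, hord', hi]
    have h1e : s1.reg .e = pe (ord i) := by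
      simp [← hs1, Instr.apply, State.setReg, hord', hpe', hi]
    have h1i : s1.reg .i = i := by simp [← hs1, Instr.apply, State.setReg, hi]
    have h1t : s1.third = s.third := by
      rw [← hthird']; simp [← hs1, Instr.apply, State.setReg]
    refine Runs.seq (Q := fun ψ s2 => s2.reg .i = i ∧ φ - 11 ≤ ψ ∧ ∀ j < i + 1,
      s2.arr .g (ord j) < Ev.modulus ∧
      (pe (ord j) ≠ n → (s2.arr .g (ord j) : ZMod Ev.modulus) + s2.arr .g (par (ord j)) +
        Ev.h₃ s.third (pe (ord j)) = s.arr .val (pe (ord j)))) ?_ ?_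
    · refine Runs.ite (φ - 4) (by omega) (fun ht => ?_) (fun ht => ?_)
      · simp only [Test.Holds, hin1.n, h1e] at ht
        refine Runs.block _ (φ - 5) (by simp; omega) ?_
        simp only [List.foldl_cons, List.foldl_nil, Instr.apply, State.setArr]
        refine ⟨h1i, by omega, key 0 _ ?_ hm fun h => absurd ht h⟩
        rw [Function.update_self, h1a, h1w, hin1.zero]
      · simp only [Test.Holds, hin1.n, h1e] at ht
        refine Runs.block _ (φ - 11) (by simp; omega) ?_
        simp only [List.foldl_cons, List.foldl_nil, Instr.apply, State.setArr, State.setReg]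
        simp only [Function.update_self, ne_eq, reduceCtorEq, not_false_eq_true,
          Function.update_of_ne, h1a, h1w, h1e, h1i, h1t, hval', hpar']
        refine ⟨trivial, le_rfl, key _ _ rfl (Nat.mod_lt _ hm) fun _ => ?_⟩
        rw [cast_subMod hm, cast_subMod hm]
        ring
    · rintro ψ s2 ⟨h4, h5, h6⟩
      refine Runs.block _ (ψ - 1) (by simp; omega) ?_
      simp only [List.foldl_cons, List.foldl_nil, Instr.apply, State.setReg, Function.update_self,
        h4]
      exact ⟨by omega, by omega, h6⟩
  · simp [Instr.apply, State.setReg, hs.zero]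
  · rintro φ s' ⟨⟨h1, h2, h3⟩, hb, hf⟩
    have hin : Inputs n N s' := (hs.of_fixes (block_fixes _ _) (by decide)).of_fixes hf (by decide)
    simp only [Test.Holds, hin.N] at hb
    refine ⟨by omega, fun v hv => ?_, fun i hi => (h3 i (by omega)).2⟩
    obtain ⟨i, hi, rfl⟩ := hS.surj v hv
    exact (h3 i (by omega)).1

/-- The edges that are given by the pair number `t`. -/
def Env.edges (Ev : Env) (t e : ℕ) : ℕ × ℕ := (Ev.h₁ t e, Ev.h₂ t e)

/-- The body of the main loop: one attempt with fresh hash functions. -/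
def attempt : Cmd :=
  .block [.drawPair, .copy .bad .zero] ;; clearGraph ;; buildGraph ;; search

/-- A bound for the cost of an attempt. -/
def attemptBudget (n N : ℕ) : ℕ := 23 * N + 34 * n + 10

/-- The budget is the sum of `2`, `5 N + 2`, `12 n + 2` and `18 N + 22 n + 4`. -/
theorem attempt_runs (hs : Inputs n N s)
    (hN : ∀ e < n, Ev.h₁ (s.pair + 1) e < N ∧ Ev.h₂ (s.pair + 1) e < N) :
    Runs Ev attempt s (attemptBudget n N) fun _ s' => s'.pair = s.pair + 1 ∧
      s'.third = s.third ∧ Inputs n N s' ∧ s'.arr .val = s.arr .val ∧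
      Searched n N (Ev.edges s'.pair) s' := by
  have hmain : Runs Ev attempt s (attemptBudget n N) fun _ s' => s'.pair = s.pair + 1 ∧
      s'.third = s.third ∧ Searched n N (Ev.edges (s.pair + 1)) s' := by
    refine Runs.block_seq _ (23 * N + 34 * n + 8) (by simp [attemptBudget]; omega) ?_
    generalize hs1 : List.foldl (Instr.apply Ev) s [Instr.drawPair, .copy .bad .zero] = s1
    have hin1 : Inputs n N s1 := hs1 ▸ hs.of_fixes (block_fixes _ _) (by decide)
    have h1p : s1.pair = s.pair + 1 := by simp [← hs1, Instr.apply, State.setReg]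
    have h1t : s1.third = s.third := by simp [← hs1, Instr.apply, State.setReg]
    have h1b : s1.reg .bad = 0 := by simp [← hs1, Instr.apply, State.setReg, hs.zero]
    refine Runs.seq ((clearGraph_runs (R := 18 * N + 34 * n + 6) hin1).fixes.mono (by omega)) ?_
    rintro φ2 s2 ⟨⟨hφ2, hc⟩, hf2⟩
    have hin2 : Inputs n N s2 := hin1.of_fixes hf2 (by decide)
    have h2p : s2.pair = s.pair + 1 := (hf2.pair (by decide)).trans h1p
    refine Runs.seq ((buildGraph_runs (R := 18 * N + 22 * n + 4) hin2
      fun v hv => ⟨(hc v hv).1, (hc v hv).2.1⟩).fixes.mono (by omega)) ?_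
    rintro φ3 s3 ⟨⟨hφ3, hG⟩, hf3⟩
    have hin3 : Inputs n N s3 := hin2.of_fixes hf3 (by decide)
    rw [h2p] at hG
    have h3p : s3.pair = s.pair + 1 := (hf3.pair (by decide)).trans h2p
    have h3t : s3.third = s.third := ((hf3.third (by decide)).trans (hf2.third (by decide))).trans h1t
    refine ((search_runs (R := 0) (E := Ev.edges (s.pair + 1)) hin3 ?_ hG ?_ ?_).fixes.mono
      (by omega)).weaken ?_
    · rw [hf3.reg _ (by decide), hf2.reg _ (by decide), h1b]
    · intro v hv
      rw [hf3.arr _ (by decide)]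
      exact (hc v hv).2.2
    · intro e he σ
      cases σ
      · exact (hN e he).1
      · exact (hN e he).2
    · rintro φ4 s4 ⟨⟨-, h4⟩, hf4⟩
      exact ⟨(hf4.pair (by decide)).trans h3p, (hf4.third (by decide)).trans h3t, h4⟩
  refine hmain.fixes.weaken ?_
  rintro φ s' ⟨⟨h1, h2, h3⟩, hf⟩
  exact ⟨h1, h2, hs.of_fixes hf (by decide), hf.arr _ (by decide), h1 ▸ h3⟩

/-- The pair number `t` gives a simple acyclic graph. -/
def Env.Good (Ev : Env) (n t : ℕ) : Prop := IsForest (Ev.edges t) {e | e < n}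

/-- The result of the main loop which was started in `s`. -/
structure Succeeded (Ev : Env) (n N : ℕ) (s s' : State) : Prop where
  lt : s.pair < s'.pair
  good : Ev.Good n s'.pair
  first : ∀ t, s.pair < t → t < s'.pair → ¬ Ev.Good n t
  third : s'.third = s.third
  inputs : Inputs n N s'
  val : s'.arr .val = s.arr .val
  searched : Searched n N (Ev.edges s'.pair) s'
  bad : s'.reg .bad = 0

/-- By determinism each round is the run described by `attempt_runs`, so the loop stops precisely at
a good pair. The `+ 1` per attempt is the loop test, and the last `1` is the final test. -/
theorem attempts_sound {s' : State} {κ : Cost}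
    (hN : ∀ t, ∀ e < n, Ev.h₁ t e < N ∧ Ev.h₂ t e < N) (hs : Inputs n N s) (hb : s.reg .bad = 1)
    (h : Exec Ev (.loop (.eq .bad .one) attempt) s κ s') :
    Succeeded Ev n N s s' ∧
      κ.steps ≤ (s'.pair - s.pair) * (attemptBudget n N + 1) + 1 := by
  generalize hc : Cmd.loop (.eq .bad .one) attempt = c at h
  induction h with
  | block | seq | ite_true | ite_false => cases hc
  | loop_done hb' =>
    cases hc
    exact absurd (hb.trans hs.one.symm) hb'
  | @loop_step b c s s₁ s₂ κ₁ κ₂ hb' hx hx' _ ih =>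
    cases hc
    obtain ⟨κ', s', φ', h1, h2, h3, h4, h5, h6, h7⟩ := attempt_runs hs (hN _)
    obtain ⟨rfl, rfl⟩ := hx.deterministic h1
    have hg := h7.bad_iff
    have hble := h7.bad_le
    rcases (show s₁.reg .bad = 0 ∨ s₁.reg .bad = 1 by omega) with h0 | h0
    · cases hx' with
      | loop_step hb'' => exact absurd (h0.symm.trans (hb''.trans h5.one)) zero_ne_one
      | loop_done =>
        refine ⟨⟨by omega, hg.1 h0, fun t h8 h9 => by omega, h4, h5, h6, h7, h0⟩, ?_⟩
        rw [h3]
        simp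
        omega
    · obtain ⟨h8, h9⟩ := ih h5 h0 rfl
      have hlt := h8.lt
      refine ⟨⟨by omega, h8.good, fun t h10 h11 => ?_, h8.third.trans h4, h8.inputs,
        h8.val.trans h6, h8.searched, h8.bad⟩, ?_⟩
      · rcases Nat.lt_or_ge s₁.pair t with ht | ht
        · exact h8.first t ht h11
        · rw [show t = s₁.pair by omega]
          exact fun hgood => absurd (hg.2 hgood) (by omega)
      · have : s₂.pair - s.pair = (s₂.pair - s₁.pair) + 1 := by omega
        rw [this, add_mul, one_mul]
        simp
        omega

/-- The loop cannot pass a good pair, so the distance to `t` serves as the variant. -/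
theorem attempts_terminate
    (hN : ∀ t, ∀ e < n, Ev.h₁ t e < N ∧ Ev.h₂ t e < N) (hs : Inputs n N s) (hb : s.reg .bad = 1) {t : ℕ} (ht : s.pair < t)
    (hgood : Ev.Good n t) :
    ∃ κ s', Exec Ev (.loop (.eq .bad .one) attempt) s κ s' := by
  obtain ⟨r, hr⟩ : ∃ r, r = t - s.pair := ⟨_, rfl⟩
  induction r generalizing s with
  | zero => omega
  | succ r ih =>
    obtain ⟨κ', s', φ', h1, h2, h3, h4, h5, h6, h7⟩ := attempt_runs hs (hN _)
    have hb' : (Test.eq .bad .one).Holds s := hb.trans hs.one.symm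
    have hg := h7.bad_iff
    have hble := h7.bad_le
    rcases (show s'.reg .bad = 0 ∨ s'.reg .bad = 1 by omega) with h0 | h0
    · refine ⟨_, _, Exec.loop_step hb' h1 (Exec.loop_done ?_)⟩
      simp [Test.Holds, h0, h5.one]
    · rcases Nat.lt_or_ge s'.pair t with hlt | hge
      · obtain ⟨κ, s'', h⟩ := ih h5 h0 hlt (by omega)
        exact ⟨_, _, Exec.loop_step hb' h1 h⟩
      · have : s'.pair = t := by omega
        exact absurd (hg.2 (this ▸ hgood)) (by omega)

/-- The result of the creation algorithm. -/
structure Created (Ev : Env) (n N : ℕ) (s s' : State) : Prop where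
  one_le : 1 ≤ s'.pair
  good : Ev.Good n s'.pair
  first : ∀ t, 1 ≤ t → t < s'.pair → ¬ Ev.Good n t
  third : s'.third = 1
  lt_modulus : ∀ v < N, s'.arr .g v < Ev.modulus
  solves : ∀ e < n, (s'.arr .g (Ev.h₁ s'.pair e) : ZMod Ev.modulus) +
    s'.arr .g (Ev.h₂ s'.pair e) + Ev.h₃ 1 e = s.arr .val e

/-- Back-substitution guarantees the equations of the tree edges. After a successful search these
are all edges. -/
theorem solve_spec {s₀ s' : State} {κ : Cost} (hS : Succeeded Ev n N s₀ s)
    (hm : 0 < Ev.modulus) (h₀ : s₀.pair = 0) (ht : s₀.third = 0)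
    (h : Exec Ev (.block [.drawThird] ;; solve) s κ s') :
    s'.pair = s.pair ∧ Created Ev n N s₀ s' ∧ κ.steps ≤ 12 * N + 3 := by
  cases h with
  | @seq _ _ _ s₁ _ κ₁ κ₂ hx hx' =>
  have hk1 : κ₁.steps = 1 := by cases hx; rfl
  obtain rfl : s₁ = { s with third := s.third + 1 } := by cases hx; rfl
  have hin : Inputs n N { s with third := s.third + 1 } :=
    ⟨hS.inputs.n, hS.inputs.N, hS.inputs.zero, hS.inputs.one⟩
  have hse : Searched n N (Ev.edges s.pair) { s with third := s.third + 1 } :=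
    ⟨hS.searched.inj, hS.searched.surj, hS.searched.lt, hS.searched.tree, hS.searched.bad_le,
      hS.searched.bad_iff, hS.searched.edges⟩
  obtain ⟨κ', s'', φ', h1, h2, -, h4, h5⟩ := solve_runs (Ev := Ev) (R := 0) hin hse hm
  obtain ⟨rfl, rfl⟩ := hx'.deterministic h1
  have hf := hx'.fixes
  have hp : s'.pair = s.pair := hf.pair (by decide)
  have hth : s.third + 1 = 1 := by rw [hS.third, ht]
  refine ⟨hp, ⟨by have := hS.lt; omega, hp ▸ hS.good, fun t h6 h7 => hS.first t (by omega) (hp ▸ h7),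
    (hf.third (by decide)).trans hth, h4, fun e he => ?_⟩, by simp; omega⟩
  rw [hp]
  obtain ⟨i, hi, hie⟩ := hS.searched.edges hS.bad e he
  have h6 := h5 i hi (by rw [show _ = e from hie]; exact he.ne)
  obtain ⟨-, j, -, h7, h8⟩ := hS.searched.tree i hi (by rw [hie]; exact he.ne)
  dsimp only at h6
  rw [hth, hie, ← h7, hS.val] at h6
  rw [hie] at h8
  simp only [Joins, Env.edges, Prod.mk.injEq] at h8
  -- The search may have followed the edge in either direction; the equation is symmetric in its
  -- ends.
  rcases h8 with h8 | h8
  · rw [← h6, h8.1, h8.2]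
    ring
  · rw [← h6, h8.1, h8.2]

theorem create_sound {s' : State} {κ : Cost}
    (hN : ∀ t, ∀ e < n, Ev.h₁ t e < N ∧ Ev.h₂ t e < N) (hs : Inputs n N s) (hp : s.pair = 0)
    (ht : s.third = 0) (hm : 0 < Ev.modulus) (h : Exec Ev createProgram s κ s') :
    Created Ev n N s s' ∧
      κ.steps ≤ s'.pair * (attemptBudget n N + 1) + (12 * N + 5) := by
  cases h with
  | @seq _ _ _ s₁ _ κ₁ κ₂ hx hx' =>
  cases hx' with
  | @seq _ _ _ s₂ _ κ₃ κ₄ hx₂ hx₃ =>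
  have hk1 : κ₁.steps = 1 := by cases hx; rfl
  have hf := hx.fixes
  have hin1 : Inputs n N s₁ := hs.of_fixes hf (by decide)
  have hb : s₁.reg .bad = 1 := by cases hx; simp [Instr.apply, State.setReg, hs.one]
  have h1p : s₁.pair = 0 := (hf.pair (by decide)).trans hp
  have h1t : s₁.third = 0 := (hf.third (by decide)).trans ht
  obtain ⟨h1, h2⟩ := attempts_sound hN hin1 hb hx₂
  obtain ⟨h3, h4, h5⟩ := solve_spec h1 hm h1p h1t hx₃
  have hval : s₁.arr .val = s.arr .val := hf.arr _ (by decide)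
  refine ⟨⟨h4.one_le, h4.good, h4.first, h4.third, h4.lt_modulus, ?_⟩, ?_⟩
  · rw [← hval]; exact h4.solves
  · rw [h1p, Nat.sub_zero] at h2
    rw [h3]
    simp
    omega

theorem create_terminates
    (hN : ∀ t, ∀ e < n, Ev.h₁ t e < N ∧ Ev.h₂ t e < N) (hs : Inputs n N s) (hp : s.pair = 0)
    (hm : 0 < Ev.modulus) {t : ℕ} (ht1 : 1 ≤ t) (hgood : Ev.Good n t) :
    ∃ κ s', Exec Ev createProgram s κ s' := by
  have hx := Exec.block (E := Ev) [.copy .bad .one] s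
  have hf := hx.fixes
  have hin1 := hs.of_fixes hf (by decide)
  have hb : (List.foldl (Instr.apply Ev) s [.copy .bad .one]).reg .bad = 1 := by
    simp [Instr.apply, State.setReg, hs.one]
  obtain ⟨κ, s₂, hx₂⟩ := attempts_terminate hN hin1 hb (t := t)
    (by rw [hf.pair (by decide), hp]; omega) hgood
  obtain ⟨h1, -⟩ := attempts_sound hN hin1 hb hx₂
  have hin : Inputs n N { s₂ with third := s₂.third + 1 } :=
    ⟨h1.inputs.n, h1.inputs.N, h1.inputs.zero, h1.inputs.one⟩
  have hse : Searched n N (Ev.edges s₂.pair) { s₂ with third := s₂.third + 1 } :=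
    ⟨h1.searched.inj, h1.searched.surj, h1.searched.lt, h1.searched.tree, h1.searched.bad_le,
      h1.searched.bad_iff, h1.searched.edges⟩
  obtain ⟨κ', s₃, -, hx₃, -⟩ := solve_runs (Ev := Ev) (R := 0) hin hse hm
  exact ⟨_, _, hx.seq (hx₂.seq ((Exec.block [.drawThird] s₂).seq hx₃))⟩

end Creation

/-! ### The table as a string of bits. -/

section Table

theorem length_tableBits (N b : ℕ) (g : ℕ → ℕ) : (tableBits N b g).length = N * b := by
  simp [tableBits, List.length_flatMap]

theorem getD_tableBits {N b : ℕ} {g : ℕ → ℕ} {i j : ℕ} (hj : j < N) (hi : i < b) :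
    (tableBits N b g).getD (j * b + i) false = (g j).testBit i := by
  induction N with
  | zero => omega
  | succ N ih =>
    have hs : tableBits (N + 1) b g =
        tableBits N b g ++ (List.range b).map fun i => (g N).testBit i := by
      simp [tableBits, List.range_succ]
    rw [hs]
    rcases Nat.lt_succ_iff_lt_or_eq.1 hj with hj' | rfl
    · rw [List.getD_append _ _ _ _ ?_, ih hj']
      rw [length_tableBits]
      nlinarith
    · rw [List.getD_append_right _ _ _ _ (by rw [length_tableBits]; omega), length_tableBits]
      simp [hi]

theorem sum_testBit (x b : ℕ) :
    ∑ i ∈ Finset.range b, (x.testBit i).toNat * 2 ^ i = x % 2 ^ b := by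
  induction b with
  | zero => simp [Nat.mod_one]
  | succ b ih => rw [Finset.sum_range_succ, ih, Nat.mod_pow_succ, Nat.toNat_testBit, mul_comm (2 ^ b)]

theorem readCell_tableBits {N b : ℕ} {g : ℕ → ℕ} {j : ℕ} (hj : j < N) (hg : g j < 2 ^ b) :
    readCell b (tableBits N b g) j = g j := by
  rw [readCell, Finset.sum_congr rfl fun i hi => by
    rw [getD_tableBits hj (Finset.mem_range.1 hi)], sum_testBit, Nat.mod_eq_of_lt hg]

end Table

/-! ### Output and cost of a query. -/

section Query

variable {D : Type*} {k N m : ℕ}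

/-- The value that a query computes. -/
def queryValue (F : Filter D N m) (x : D) : ℕ :=
  ((readCell (Nat.clog 2 m) F.bits (F.h₁ x) + readCell (Nat.clog 2 m) F.bits (F.h₂ x)) % m +
    (F.h₃ x : ℕ)) % m

/-- Both branches cost the same: seven instructions, one test and one copy. Uniqueness is
determinism of the machine. -/
theorem answers_iff {F : Filter D N m} {x : D} {o : Option (BitVec k)} {κ : Cost} :
    Answers F x o κ ↔
      o = (if queryValue F x < 2 ^ k then some (BitVec.ofNat k (queryValue F x)) else none) ∧
        κ = ⟨9, 3, 2⟩ := by
  have hex : ∃ s : State, Exec (queryEnv F x) queryProgram (queryInit k F) ⟨9, 3, 2⟩ s ∧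
      s.reg .a = queryValue F x ∧
      s.reg .found = if queryValue F x < 2 ^ k then 1 else 0 := by
    have hblock := Exec.block (E := queryEnv F x) [.hash1 .x .zero, .hash2 .y .zero,
      .load .a .g .x, .load .b .g .y, .addMod .a .b, .hash3 .d .zero, .addMod .a .d] (queryInit k F)
    generalize hs1 : List.foldl (Instr.apply (queryEnv F x)) (queryInit k F) [.hash1 .x .zero,
      .hash2 .y .zero, .load .a .g .x, .load .b .g .y, .addMod .a .b, .hash3 .d .zero,
      .addMod .a .d] = s1 at hblock
    have h1a : s1.reg .a = queryValue F x := by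
      simp [← hs1, Instr.apply, State.setReg, queryEnv, queryInit, queryValue]
    have h1r : s1.reg .range = 2 ^ k := by
      simp [← hs1, Instr.apply, State.setReg, queryInit]
    have h1o : s1.reg .one = 1 := by simp [← hs1, Instr.apply, State.setReg, queryInit]
    have h1z : s1.reg .zero = 0 := by simp [← hs1, Instr.apply, State.setReg, queryInit]
    by_cases hlt : queryValue F x < 2 ^ k
    · refine ⟨_, hblock.seq (Exec.ite_true ?_ (Exec.block [.copy .found .one] s1)), ?_, ?_⟩
      · simp only [Test.Holds, h1a, h1r]; exact hlt
      · simp [Instr.apply, State.setReg, h1a]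
      · simp [Instr.apply, State.setReg, h1o, hlt]
    · refine ⟨_, hblock.seq (Exec.ite_false ?_ (Exec.block [.copy .found .zero] s1)), ?_, ?_⟩
      · simp only [Test.Holds, h1a, h1r]; exact hlt
      · simp [Instr.apply, State.setReg, h1a]
      · simp [Instr.apply, State.setReg, h1z, hlt]
  obtain ⟨s, hs, ha, hf⟩ := hex
  have ho : (if s.reg .found = 1 then some (BitVec.ofNat k (s.reg .a)) else none) =
      if queryValue F x < 2 ^ k then some (BitVec.ofNat k (queryValue F x)) else none := by
    rw [ha, hf]
    split_ifs <;> simp_all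
  constructor
  · rintro ⟨s', hs', rfl⟩
    obtain ⟨rfl, rfl⟩ := hs'.deterministic hs
    exact ⟨ho, rfl⟩
  · rintro ⟨rfl, rfl⟩
    exact ⟨s, hs, ho.symm⟩

theorem answers_none_iff {F : Filter D N m} {x : D} :
    (∃ κ, Answers F x (none : Option (BitVec k)) κ) ↔ 2 ^ k ≤ queryValue F x := by
  simp only [answers_iff, exists_and_left, exists_eq, and_true]
  split_ifs with h
  · simp [h]
  · simpa using h

end Query

/-! ### From the random source to the stored filter. -/

section Create

variable {D : Type*} {S : Finset D} {k N m : ℕ}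

/-- The edges that are given by the pair number `t`. -/
def sample (key : Fin S.card ≃ S) (ω : HashSource D N m) (t : ℕ) (i : Fin S.card) :
    Fin N × Fin N :=
  (ω.1 (t, false, (key i : D)), ω.1 (t, true, (key i : D)))

theorem good_iff {key : Fin S.card ≃ S} {ω : HashSource D N m} {t : ℕ} :
    (createEnv key ω).Good S.card t ↔ IsForest (sample key ω t) Set.univ := by
  have himg : {e : ℕ | e < S.card} = (Fin.val : Fin S.card → ℕ) '' Set.univ := by
    rw [Set.image_univ, Fin.range_val]
    rfl
  rw [Env.Good, himg]
  refine isForest_image Fin.val_injective.injOn Fin.val_injective fun i _ => ?_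
  simp [Env.edges, createEnv, sample]

theorem simpleAcyclic_iff {key : Fin S.card ≃ S} {ω : HashSource D N m} {t : ℕ} :
    SimpleAcyclic S (fun x => ω.1 (t, false, x)) (fun x => ω.1 (t, true, x)) ↔
      IsForest (sample key ω t) Set.univ := by
  have himg : (S : Set D) = (fun i => (key i : D)) '' Set.univ := by
    ext x
    constructor
    · intro hx
      exact ⟨key.symm ⟨x, hx⟩, trivial, by simp⟩
    · rintro ⟨i, -, rfl⟩
      exact (key i).2
  rw [simpleAcyclic_iff_isForest, himg]
  exact isForest_image (g := id) (Subtype.val_injective.comp key.injective).injOn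
    Function.injective_id fun i _ => rfl

theorem createEnv_lt [NeZero N] (key : Fin S.card ≃ S) (ω : HashSource D N m) (t e : ℕ) :
    (createEnv key ω).h₁ t e < N ∧ (createEnv key ω).h₂ t e < N := by
  have : 0 < N := Nat.pos_of_ne_zero (NeZero.ne N)
  constructor <;> simp only [createEnv] <;> split_ifs <;> first | exact Fin.is_lt _ | assumption

theorem createInit_inputs (f : S → BitVec k) (key : Fin S.card ≃ S) :
    Inputs S.card N (createInit N f key) := ⟨rfl, rfl, rfl, rfl⟩

theorem exec_create_sound [NeZero N] [NeZero m] {f : S → BitVec k} {key : Fin S.card ≃ S} {ω : HashSource D N m}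
    {κ : Cost} {s : State}
    (h : Exec (createEnv key ω) createProgram (createInit N f key) κ s) :
    Created (createEnv key ω) S.card N (createInit N f key) s ∧
      κ.steps ≤ s.pair * (attemptBudget S.card N + 1) + (12 * N + 5) :=
  create_sound (fun t e _ => createEnv_lt key ω t e) (createInit_inputs f key) rfl rfl
    (Nat.pos_of_ne_zero (NeZero.ne m)) h

theorem exec_create_exists [NeZero N] [NeZero m] (f : S → BitVec k) {key : Fin S.card ≃ S} {ω : HashSource D N m}
    {t : ℕ} (ht : 1 ≤ t) (h : IsForest (sample key ω t) Set.univ) :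
    ∃ κ s, Exec (createEnv key ω) createProgram (createInit N f key) κ s :=
  create_terminates (fun t e _ => createEnv_lt key ω t e) (createInit_inputs f key) rfl
    (Nat.pos_of_ne_zero (NeZero.ne m)) ht (good_iff.2 h)

/-- The filter that is stored at the end of the creation. -/
def storedFilter (ω : HashSource D N m) (s : State) : Filter D N m where
  bits := tableBits N (Nat.clog 2 m) (s.arr .g)
  h₁ := fun x => ω.1 (s.pair, false, x)
  h₂ := fun x => ω.1 (s.pair, true, x)
  h₃ := fun x => ω.2 (s.third, x)

/-- Entries are below `m ≤ 2 ^ clog 2 m`, so no bit is lost in a cell. -/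
theorem readCell_storedFilter {f : S → BitVec k} {key : Fin S.card ≃ S} {ω : HashSource D N m}
    {s : State} (h : Created (createEnv key ω) S.card N (createInit N f key) s) (v : Fin N) :
    readCell (Nat.clog 2 m) (storedFilter ω s).bits v = s.arr .g v :=
  readCell_tableBits v.2 ((h.lt_modulus v v.2).trans_le (Nat.le_pow_clog one_lt_two m))

theorem storedFilter_solves {f : S → BitVec k} {key : Fin S.card ≃ S} {ω : HashSource D N m}
    {s : State} (h : Created (createEnv key ω) S.card N (createInit N f key) s) (x : S) :
    (readCell (Nat.clog 2 m) (storedFilter ω s).bits ((storedFilter ω s).h₁ x) : ZMod m) +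
      readCell (Nat.clog 2 m) (storedFilter ω s).bits ((storedFilter ω s).h₂ x) +
      (((storedFilter ω s).h₃ x : ℕ) : ZMod m) = ((f x).toNat : ZMod m) := by
  rw [readCell_storedFilter h, readCell_storedFilter h]
  have := h.solves (key.symm x) (Fin.is_lt _)
  simp only [createEnv, createInit, Fin.is_lt, dite_true, Fin.eta, Equiv.apply_symm_apply] at this
  simp only [storedFilter, h.third]
  exact this

theorem cast_queryValue (F : Filter D N m) (x : D) :
    (queryValue F x : ZMod m) = (readCell (Nat.clog 2 m) F.bits (F.h₁ x) : ZMod m) +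
      (readCell (Nat.clog 2 m) F.bits (F.h₂ x) : ZMod m) + ((F.h₃ x : ℕ) : ZMod m) := by
  simp [queryValue]

theorem queryValue_lt [NeZero m] (F : Filter D N m) (x : D) : queryValue F x < m :=
  Nat.mod_lt _ (Nat.pos_of_ne_zero (NeZero.ne m))

/-- The computed value is reduced modulo `m`, so a congruence with a number below `m` is an
equality. -/
theorem queryValue_eq [NeZero m] {F : Filter D N m} {x : D} {a : ℕ} (ha : a < m)
    (h : (readCell (Nat.clog 2 m) F.bits (F.h₁ x) : ZMod m) +
      (readCell (Nat.clog 2 m) F.bits (F.h₂ x) : ZMod m) + ((F.h₃ x : ℕ) : ZMod m) = (a : ZMod m)) :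
    queryValue F x = a := by
  rw [← cast_queryValue, ZMod.natCast_eq_natCast_iff] at h
  exact Nat.ModEq.eq_of_lt_of_lt h (queryValue_lt F x) ha

theorem creates_iff {f : S → BitVec k} {key : Fin S.card ≃ S} {ω : HashSource D N m}
    {F : Filter D N m} : Creates f key ω F ↔
      ∃ κ s, Exec (createEnv key ω) createProgram (createInit N f key) κ s ∧
        F = storedFilter ω s := Iff.rfl

theorem Creates.unique {f : S → BitVec k} {key : Fin S.card ≃ S} {ω : HashSource D N m}
    {F F' : Filter D N m} (h : Creates f key ω F) (h' : Creates f key ω F') : F = F' := by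
  obtain ⟨κ, s, hs, rfl⟩ := h
  obtain ⟨κ', s', hs', rfl⟩ := h'
  obtain ⟨-, rfl⟩ := hs.deterministic hs'
  rfl

/-- The properties of a filter that has been created. -/
theorem Creates.properties [NeZero N] [NeZero m] {f : S → BitVec k} {key : Fin S.card ≃ S} {ω : HashSource D N m}
    {F : Filter D N m} (hkm : 2 ^ k ≤ m) (h : Creates f key ω F) :
    (∃ t, 1 ≤ t ∧ F.h₁ = (fun x => ω.1 (t, false, x)) ∧ F.h₂ = (fun x => ω.1 (t, true, x)) ∧
      SimpleAcyclic S F.h₁ F.h₂ ∧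
      ∀ j, 1 ≤ j → j < t →
        ¬ SimpleAcyclic S (fun x => ω.1 (j, false, x)) (fun x => ω.1 (j, true, x))) ∧
    F.h₃ = (fun x => ω.2 (1, x)) ∧
    (∀ x : S, ((readCell (Nat.clog 2 m) F.bits (F.h₁ x) : ZMod m)
        + (readCell (Nat.clog 2 m) F.bits (F.h₂ x) : ZMod m) + ((F.h₃ x : ℕ) : ZMod m))
        = ((f x).toNat : ZMod m)) ∧
    F.bits.length = N * ⌈Real.logb 2 (m : ℝ)⌉₊ ∧
    (∀ x : D, ∃! r : Option (BitVec k) × Cost, Answers F x r.1 r.2) ∧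
    (∀ (x : D) (o : Option (BitVec k)) (κ : Cost), Answers F x o κ →
      κ.steps ≤ 9 ∧ κ.hashes = 3 ∧ κ.lookups = 2) ∧
    (∀ x : S, ∃ κ, Answers F (x : D) (some (f x)) κ) := by
  obtain ⟨κ, s, hs, hF⟩ := creates_iff.1 h
  have hc := (exec_create_sound hs).1
  have hsolve := storedFilter_solves hc
  rw [← hF] at hsolve
  refine ⟨⟨s.pair, hc.one_le, ?_, ?_, ?_, fun j h1 h2 => ?_⟩, ?_, hsolve, ?_, fun x => ?_, ?_,
    fun x => ?_⟩
  · rw [hF]; rfl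
  · rw [hF]; rfl
  · rw [hF]; exact simpleAcyclic_iff.2 (good_iff.1 hc.good)
  · exact fun h => hc.first j h1 h2 (good_iff.2 (simpleAcyclic_iff.1 h))
  · rw [hF]; simp [storedFilter, hc.third]
  · rw [hF, storedFilter, length_tableBits, ← Real.natCeil_logb_natCast, Nat.cast_ofNat]
  · refine ⟨(_, ⟨9, 3, 2⟩), answers_iff.2 ⟨rfl, rfl⟩, ?_⟩
    rintro ⟨o, κ⟩ h
    obtain ⟨h1, h2⟩ := answers_iff.1 h
    exact Prod.ext h1 h2
  · rintro x o κ h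
    obtain ⟨-, rfl⟩ := answers_iff.1 h
    exact ⟨le_rfl, rfl, rfl⟩
  · have hlt : (f x).toNat < 2 ^ k := (f x).isLt
    have hv := queryValue_eq (hlt.trans_le hkm) (hsolve x)
    refine ⟨_, answers_iff.2 ⟨?_, rfl⟩⟩
    rw [hv, if_pos hlt, BitVec.ofNat_toNat, BitVec.setWidth_eq]

end Create

open MeasureTheory Measure

/-! ### Measurability of the creation time and of the query events. -/

section Measurability

variable {D : Type*} {S : Finset D} {k N m : ℕ}

/-- A function which depends on finitely many hash values is measurable. -/
theorem measurable_of_finite_support [NeZero N] [NeZero m] {β : Type*} [MeasurableSpace β]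
    (I : Finset (ℕ × Bool × D)) (J : Finset (ℕ × D)) {F : HashSource D N m → β}
    (h : ∀ ω ω' : HashSource D N m, (∀ i ∈ I, ω.1 i = ω'.1 i) → (∀ j ∈ J, ω.2 j = ω'.2 j) →
      F ω = F ω') : Measurable F := by
  -- `F` factors through this projection to a finite type, on which every function is measurable.
  let π : HashSource D N m → (I → Fin N) × (J → Fin m) := fun ω => (fun i => ω.1 i, fun j => ω.2 j)
  have hπ : Measurable π := by fun_prop
  have hF : Function.FactorsThrough F π := fun ω ω' hω => by
    obtain ⟨h1, h2⟩ := Prod.mk.inj hω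
    exact h ω ω' (fun i hi => congrFun h1 ⟨i, hi⟩) fun j hj => congrFun h2 ⟨j, hj⟩
  have hcomp : F = Function.extend π F (fun _ => F default) ∘ π :=
    funext fun ω => (hF.extend_apply _ ω).symm
  rw [hcomp]
  exact (measurable_of_finite _).comp hπ

/-- The hash values at the keys in `T` of the functions up to number `τ`. -/
def AgreeOn (T : Finset D) (τ : ℕ) (ω ω' : HashSource D N m) : Prop :=
  ∀ t ≤ τ, ∀ x ∈ T, (∀ b, ω.1 (t, b, x) = ω'.1 (t, b, x)) ∧ ω.2 (t, x) = ω'.2 (t, x)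

theorem AgreeOn.symm {T : Finset D} {τ : ℕ} {ω ω' : HashSource D N m} (h : AgreeOn T τ ω ω') :
    AgreeOn T τ ω' ω := fun t ht x hx =>
  ⟨fun b => ((h t ht x hx).1 b).symm, (h t ht x hx).2.symm⟩

theorem AgreeOn.mono {T T' : Finset D} {τ : ℕ} {ω ω' : HashSource D N m} (h : AgreeOn T τ ω ω')
    (hT : T' ⊆ T) : AgreeOn T' τ ω ω' := fun t ht x hx => h t ht x (hT hx)

theorem measurable_of_agreeOn [NeZero N] [NeZero m] {β : Type*} [MeasurableSpace β]
    {T : Finset D} {τ : ℕ} {F : HashSource D N m → β}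
    (h : ∀ ω ω', AgreeOn T τ ω ω' → F ω = F ω') : Measurable F := by
  refine measurable_of_finite_support (Finset.range (τ + 1) ×ˢ Finset.univ ×ˢ T)
    (Finset.range (τ + 1) ×ˢ T) fun ω ω' h1 h2 => h ω ω' fun t ht x hx => ⟨fun b => h1 _ ?_, h2 _ ?_⟩
  · simp [hx]; omega
  · simp [hx]; omega

theorem AgreeOn.exec {f : S → BitVec k} {key : Fin S.card ≃ S} {τ : ℕ} {ω ω' : HashSource D N m}
    (h : AgreeOn S τ ω ω') {κ : Cost} {s : State} (hp : s.pair ≤ τ) (ht : s.third ≤ τ)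
    (hs : Exec (createEnv key ω) createProgram (createInit N f key) κ s) :
    Exec (createEnv key ω') createProgram (createInit N f key) κ s := by
  refine hs.congr_env ⟨rfl, fun t h1 => ?_, fun t h1 => ?_, fun t h1 => ?_⟩ <;>
    funext i <;> simp only [createEnv] <;> split_ifs with hi <;> try rfl
  · rw [(h t (h1.trans hp) _ (key ⟨i, hi⟩).2).1]
  · rw [(h t (h1.trans hp) _ (key ⟨i, hi⟩).2).1]
  · rw [(h t (h1.trans ht) _ (key ⟨i, hi⟩).2).2]

/-- The infimum is split according to a bound `τ` on the numbers of the functions drawn. For fixed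
`τ` only finitely many hash values matter, by `AgreeOn.exec`. -/
theorem measurable_creationTime [NeZero N] [NeZero m] (f : S → BitVec k) (key : Fin S.card ≃ S) :
    Measurable fun ω : HashSource D N m => creationTime f key ω := by
  have heq : (fun ω : HashSource D N m => creationTime f key ω) = fun ω =>
      ⨅ τ : ℕ, ⨅ (κ : Cost) (s : State) (_ : s.pair ≤ τ ∧ s.third ≤ τ ∧
        Exec (createEnv key ω) createProgram (createInit N f key) κ s), (κ.steps : ℝ≥0∞) := by
    funext ω
    apply le_antisymm
    · exact le_iInf fun τ => le_iInf fun κ => le_iInf fun s => le_iInf fun h =>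
        iInf_le_of_le κ (iInf_le_of_le s (iInf_le _ h.2.2))
    · exact le_iInf fun κ => le_iInf fun s => le_iInf fun h =>
        iInf_le_of_le (max s.pair s.third) (iInf_le_of_le κ (iInf_le_of_le s
          (iInf_le _ ⟨le_max_left _ _, le_max_right _ _, h⟩)))
  rw [heq]
  refine Measurable.iInf fun τ => measurable_of_agreeOn (T := S) (τ := τ) fun ω ω' h => ?_
  refine iInf_congr fun κ => iInf_congr fun s => iInf_congr_Prop ?_ fun _ => rfl
  exact ⟨fun hs => ⟨hs.1, hs.2.1, h.exec hs.1 hs.2.1 hs.2.2⟩,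
    fun hs => ⟨hs.1, hs.2.1, h.symm.exec hs.1 hs.2.1 hs.2.2⟩⟩

/-- The filter is created and the value computed by the query at `x` is in `A`. -/
def queryEvent (f : S → BitVec k) (key : Fin S.card ≃ S) (x : D) (A : Set ℕ) :
    Set (HashSource D N m) :=
  {ω | ∃ F, Creates f key ω F ∧ queryValue F x ∈ A}

/-- The same splitting by `τ` works, with the hash values at `x` added to those at the keys. -/
theorem measurableSet_queryEvent [NeZero N] [NeZero m] (f : S → BitVec k) (key : Fin S.card ≃ S)
    (x : D) (A : Set ℕ) : MeasurableSet (queryEvent (N := N) (m := m) f key x A) := by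
  classical
  have heq : queryEvent (N := N) (m := m) f key x A = ⋃ τ : ℕ, {ω | ∃ κ s, (s.pair ≤ τ ∧ s.third ≤ τ ∧
      Exec (createEnv key ω) createProgram (createInit N f key) κ s) ∧
        queryValue (storedFilter ω s) x ∈ A} := by
    ext ω
    simp only [queryEvent, Set.mem_iUnion]
    constructor
    · rintro ⟨_, ⟨κ, s, h, rfl⟩, hA⟩
      exact ⟨max s.pair s.third, κ, s, ⟨le_max_left _ _, le_max_right _ _, h⟩, hA⟩
    · rintro ⟨τ, κ, s, h, hA⟩
      exact ⟨_, ⟨κ, s, h.2.2, rfl⟩, hA⟩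
  rw [heq]
  refine MeasurableSet.iUnion fun τ => measurableSet_setOfPred.2 ?_
  refine measurable_of_agreeOn (T := insert x S) (τ := τ) ?_
  have key' : ∀ ω ω' : HashSource D N m, AgreeOn (insert x S) τ ω ω' →
      (∃ κ s, (s.pair ≤ τ ∧ s.third ≤ τ ∧
        Exec (createEnv key ω) createProgram (createInit N f key) κ s) ∧
          queryValue (storedFilter ω s) x ∈ A) →
      ∃ κ s, (s.pair ≤ τ ∧ s.third ≤ τ ∧
        Exec (createEnv key ω') createProgram (createInit N f key) κ s) ∧
          queryValue (storedFilter ω' s) x ∈ A := by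
    rintro ω ω' h ⟨κ, s, ⟨h1, h2, h3⟩, hA⟩
    refine ⟨κ, s, ⟨h1, h2, (h.mono (Finset.subset_insert x S)).exec h1 h2 h3⟩, ?_⟩
    have hx := h s.pair h1 x (Finset.mem_insert_self x S)
    have hx' := h s.third h2 x (Finset.mem_insert_self x S)
    simpa only [queryValue, storedFilter, ← hx.1, ← hx'.2] using hA
  exact fun ω ω' h => propext ⟨key' ω ω' h, key' ω' ω h.symm⟩

end Measurability

/-! ### The expected running time. -/

section Attempts

variable {D : Type*} {S : Finset D} {k N m : ℕ}

/-- The edges which are given by a sequence of ends. -/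
def toEdges {n : ℕ} (y : Fin n × Bool → Fin N) (i : Fin n) : Fin N × Fin N :=
  (y (i, false), y (i, true))

/-- None of the first `j` pairs of hash functions gives a simple acyclic graph. -/
def failures (key : Fin S.card ≃ S) (j : ℕ) : Set (HashSource D N m) :=
  {ω | ∀ t ∈ Finset.Icc 1 j, ¬ IsForest (sample key ω t) Set.univ}

theorem failures_eq_preimage (key : Fin S.card ≃ S) (j : ℕ) :
    failures (N := N) (m := m) key j =
      (fun (ω : HashSource D N m) t (p : Fin S.card × Bool) => ω.1 (t, p.2, (key p.1 : D))) ⁻¹'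
        (Set.pi (Finset.Icc 1 j : Set ℕ) fun _ => {y | IsForest (toEdges y) Set.univ}ᶜ) := by
  ext ω
  simp only [failures, Set.mem_preimage, Set.mem_pi, Finset.mem_coe]
  rfl

theorem measurableSet_failures (key : Fin S.card ≃ S) (j : ℕ) :
    MeasurableSet (failures (N := N) (m := m) key j) := by
  rw [failures_eq_preimage]
  refine MeasurableSet.preimage ?_ (by fun_prop)
  exact MeasurableSet.pi (Finset.countable_toSet _) fun _ _ => Set.Finite.measurableSet
    (Set.toFinite _)

variable [NeZero N] [NeZero m]

/-- The probability measure on sequences of `n` edges. -/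
noncomputable def edgeMeasure (n N : ℕ) [NeZero N] : Measure (Fin n × Bool → Fin N) :=
  infinitePi fun _ => (PMF.uniformOfFintype (Fin N)).toMeasure

instance (n : ℕ) : IsProbabilityMeasure (edgeMeasure n N) := by
  unfold edgeMeasure
  infer_instance

instance : IsProbabilityMeasure (hashMeasure D N m) := by
  unfold hashMeasure
  infer_instance

/-- The measure is uniform on `N ^ (2 n)` points, so the probability is a quotient of cardinalities.
-/
theorem edgeMeasure_forest (n : ℕ) :
    edgeMeasure n N {y | IsForest (toEdges y) Set.univ} =
      (forests N n).card * ((N : ℝ≥0∞) ^ 2)⁻¹ ^ n := by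
  classical
  have hsing : ∀ y : Fin n × Bool → Fin N, edgeMeasure n N {y} = ((N : ℝ≥0∞) ^ 2)⁻¹ ^ n := by
    intro y
    rw [edgeMeasure, infinitePi_singleton_of_fintype]
    simp only [PMF.toMeasure_apply_singleton _ _ (measurableSet_singleton _),
      PMF.uniformOfFintype_apply, Fintype.card_fin, Finset.prod_const, Finset.card_univ,
      Fintype.card_prod, Fintype.card_bool]
    rw [ENNReal.inv_pow, mul_comm n 2, pow_mul]
  have hset : {y : Fin n × Bool → Fin N | IsForest (toEdges y) Set.univ} =
      ((Finset.univ.filter fun y : Fin n × Bool → Fin N => IsForest (toEdges y) Set.univ :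
        Finset (Fin n × Bool → Fin N)) : Set (Fin n × Bool → Fin N)) := by
    ext y
    simp
  have hcard : (Finset.univ.filter fun y : Fin n × Bool → Fin N =>
      IsForest (toEdges y) Set.univ).card = (forests N n).card := by
    refine Finset.card_bij' (fun y _ => toEdges y)
      (fun E _ p => if p.2 then (E p.1).2 else (E p.1).1) ?_ ?_ ?_ ?_
    · intro y hy
      simpa [mem_forests] using hy
    · intro E hE
      have : toEdges (fun p : Fin n × Bool => if p.2 then (E p.1).2 else (E p.1).1) = E := by
        funext i
        simp [toEdges]
      rw [Finset.mem_filter, this]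
      exact ⟨Finset.mem_univ _, mem_forests.1 hE⟩
    · intro y _
      funext ⟨i, b⟩
      cases b <;> simp [toEdges]
    · intro E _
      funext i
      simp [toEdges]
  rw [hset, ← sum_measure_singleton]
  simp only [hsing, Finset.sum_const, hcard, nsmul_eq_mul]

/-- Independence of the attempts: restricting a product measure along an injection of index sets and
then currying gives a product over the attempts. -/
theorem map_hashMeasure_sample (key : Fin S.card ≃ S) :
    (hashMeasure D N m).map (fun ω t (p : Fin S.card × Bool) => ω.1 (t, p.2, (key p.1 : D))) =
      infinitePi fun _ : ℕ => edgeMeasure S.card N := by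
  have h1 : (hashMeasure D N m).map Prod.fst = infinitePi
      fun _ : ℕ × Bool × D => (PMF.uniformOfFintype (Fin N)).toMeasure := by
    rw [hashMeasure, Measure.map_fst_prod]
    simp
  let j : ℕ × (Fin S.card × Bool) → ℕ × Bool × D := fun p => (p.1, p.2.2, (key p.2.1 : D))
  have hj : Function.Injective j := by
    rintro ⟨t, i, b⟩ ⟨t', i', b'⟩ h
    simp only [j, Prod.mk.injEq] at h
    obtain ⟨rfl, rfl, h⟩ := h
    rw [key.injective (Subtype.val_injective h)]
  have h2 := map_infinitePi_infinitePi_of_inj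
    (P := fun _ : ℕ × Bool × D => (PMF.uniformOfFintype (Fin N)).toMeasure) hj
  have h3 := infinitePi_map_curry (ι := ℕ) (κ := Fin S.card × Bool)
    (fun _ _ => (PMF.uniformOfFintype (Fin N)).toMeasure)
  rw [← h2, ← h1, Measure.map_map (by fun_prop) (by fun_prop),
    Measure.map_map (by fun_prop) (by fun_prop)] at h3
  exact h3

theorem hashMeasure_failures (key : Fin S.card ≃ S) (j : ℕ) :
    hashMeasure D N m (failures key j) =
      (edgeMeasure S.card N {y | IsForest (toEdges y) Set.univ}ᶜ) ^ j := by
  have hm : ∀ A : Set (Fin S.card × Bool → Fin N), MeasurableSet A := fun A =>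
    Set.Finite.measurableSet (Set.toFinite _)
  rw [failures_eq_preimage, ← Measure.map_apply (by fun_prop)
    (MeasurableSet.pi (Finset.countable_toSet _) fun _ _ => hm _), map_hashMeasure_sample,
    infinitePi_pi _ fun _ _ => hm _, Finset.prod_const, Nat.card_Icc, Nat.add_sub_cancel]

theorem hashMeasure_failures_le {p : ℝ} (hp : p * ((N : ℝ) ^ 2) ^ S.card ≤ (forests N S.card).card)
    (hp0 : 0 ≤ p) (key : Fin S.card ≃ S) (j : ℕ) :
    hashMeasure D N m (failures key j) ≤ (1 - ENNReal.ofReal p) ^ j := by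
  have hN : (N : ℝ≥0∞) ≠ 0 := Nat.cast_ne_zero.2 (NeZero.ne N)
  have hN2 : (N : ℝ≥0∞) ^ 2 ≠ 0 := pow_ne_zero 2 hN
  have hN2' : (N : ℝ≥0∞) ^ 2 ≠ ∞ := ENNReal.pow_ne_top (ENNReal.natCast_ne_top N)
  have h1 : ENNReal.ofReal p ≤ edgeMeasure S.card N {y | IsForest (toEdges y) Set.univ} := by
    rw [edgeMeasure_forest]
    have h2 : ENNReal.ofReal p * ((N : ℝ≥0∞) ^ 2) ^ S.card ≤ (forests N S.card).card := by
      have := ENNReal.ofReal_le_ofReal hp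
      rwa [ENNReal.ofReal_mul hp0, ENNReal.ofReal_natCast, ENNReal.ofReal_pow (by positivity),
        ENNReal.ofReal_pow (by positivity), ENNReal.ofReal_natCast] at this
    calc ENNReal.ofReal p
        = ENNReal.ofReal p * ((N : ℝ≥0∞) ^ 2) ^ S.card * ((N : ℝ≥0∞) ^ 2)⁻¹ ^ S.card := by
          rw [mul_assoc, ← mul_pow, ENNReal.mul_inv_cancel hN2 hN2', one_pow, mul_one]
      _ ≤ _ := mul_le_mul_left h2 _
  rw [hashMeasure_failures, prob_compl_eq_one_sub (Set.Finite.measurableSet (Set.toFinite _))]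
  exact pow_le_pow_left₀ (zero_le) (tsub_le_tsub_left h1 1) j

/-- This is the tail-sum formula for the number of pairs drawn: it equals the number of `j ≥ 0` for
which the first `j` pairs all fail. The right side is infinite if no pair is good, so the bound
holds for every `ω`. -/
theorem creationTime_le (f : S → BitVec k) (key : Fin S.card ≃ S) (ω : HashSource D N m) :
    creationTime f key ω ≤
      ∑' j : ℕ, (failures key j).indicator (fun _ => ((attemptBudget S.card N + 1 : ℕ) : ℝ≥0∞)) ω +
        ((12 * N + 5 : ℕ) : ℝ≥0∞) := by
  by_cases h : ∃ t, 1 ≤ t ∧ IsForest (sample key ω t) Set.univ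
  · obtain ⟨t, ht, hF⟩ := h
    obtain ⟨κ, s, hs⟩ := exec_create_exists (N := N) (m := m) f ht hF
    obtain ⟨hc, hcost⟩ := exec_create_sound hs
    have h1 : creationTime f key ω ≤ κ.steps := iInf_le_of_le κ (iInf_le_of_le s (iInf_le _ hs))
    refine h1.trans ((Nat.cast_le.2 hcost).trans ?_)
    rw [Nat.cast_add]
    gcongr
    refine le_trans (le_of_eq ?_) (ENNReal.sum_le_tsum (Finset.range s.pair))
    rw [Finset.sum_congr rfl fun j hj => Set.indicator_of_mem (?_ : ω ∈ failures key j) _]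
    · simp
      ring
    · intro t ht hF
      rw [Finset.mem_Icc] at ht
      rw [Finset.mem_range] at hj
      exact hc.first t ht.1 (by omega) (good_iff.2 hF)
  · have hmem : ∀ j, ω ∈ failures key j := fun j t ht hF => h ⟨t, (Finset.mem_Icc.1 ht).1, hF⟩
    simp only [Set.indicator_of_mem (hmem _)]
    rw [ENNReal.tsum_const_eq_top_of_ne_zero (by simp)]
    simp

/-- The failure probabilities are dominated by a geometric series with sum `1 / p`. -/
theorem lintegral_creationTime_le {p : ℝ}
    (hp : p * ((N : ℝ) ^ 2) ^ S.card ≤ (forests N S.card).card) (hp0 : 0 < p) (hp1 : p ≤ 1)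
    (f : S → BitVec k) (key : Fin S.card ≃ S) :
    ∫⁻ ω, creationTime f key ω ∂(hashMeasure D N m) ≤
      ENNReal.ofReal ((attemptBudget S.card N + 1 : ℕ) / p + (12 * N + 5 : ℕ)) := by
  have hp1' : ENNReal.ofReal p ≤ 1 := by
    rw [← ENNReal.ofReal_one]
    exact ENNReal.ofReal_le_ofReal hp1
  calc ∫⁻ ω, creationTime f key ω ∂(hashMeasure D N m)
      ≤ ∫⁻ ω, (∑' j : ℕ, (failures key j).indicator
          (fun _ => ((attemptBudget S.card N + 1 : ℕ) : ℝ≥0∞)) ω +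
          ((12 * N + 5 : ℕ) : ℝ≥0∞)) ∂(hashMeasure D N m) :=
        lintegral_mono (creationTime_le f key)
    _ = ∑' j : ℕ, ((attemptBudget S.card N + 1 : ℕ) : ℝ≥0∞) * hashMeasure D N m (failures key j) +
          ((12 * N + 5 : ℕ) : ℝ≥0∞) := by
        rw [lintegral_add_right _ measurable_const, lintegral_tsum fun j =>
          (measurable_const.indicator (measurableSet_failures key j)).aemeasurable]
        simp only [lintegral_indicator (measurableSet_failures key _), lintegral_const,
          Measure.restrict_apply MeasurableSet.univ, Set.univ_inter, measure_univ, mul_one]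
    _ ≤ ∑' j : ℕ, ((attemptBudget S.card N + 1 : ℕ) : ℝ≥0∞) * (1 - ENNReal.ofReal p) ^ j +
          ((12 * N + 5 : ℕ) : ℝ≥0∞) := by
        gcongr with j
        exact hashMeasure_failures_le hp hp0.le key j
    _ = ENNReal.ofReal ((attemptBudget S.card N + 1 : ℕ) / p + (12 * N + 5 : ℕ)) := by
        rw [ENNReal.tsum_mul_left, ENNReal.tsum_geometric, ENNReal.sub_sub_cancel ENNReal.one_ne_top
          hp1', ENNReal.ofReal_add (by positivity) (by positivity), ENNReal.ofReal_div_of_pos hp0,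
          ENNReal.ofReal_natCast, ENNReal.ofReal_natCast, ENNReal.div_eq_inv_mul, mul_comm]

/-- A finite integral makes the creation time finite almost surely, and an infimum over no runs
would be infinite. -/
theorem ae_exists_creates {p : ℝ}
    (hp : p * ((N : ℝ) ^ 2) ^ S.card ≤ (forests N S.card).card) (hp0 : 0 < p) (hp1 : p ≤ 1)
    (f : S → BitVec k) (key : Fin S.card ≃ S) :
    ∀ᵐ ω ∂(hashMeasure D N m), ∃ F : Filter D N m, Creates f key ω F := by
  have h := ae_lt_top (measurable_creationTime f key)
    (ne_top_of_le_ne_top ENNReal.ofReal_ne_top (lintegral_creationTime_le (m := m) hp hp0 hp1 f key))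
  filter_upwards [h] with ω hω
  simp only [creationTime, iInf_lt_iff] at hω
  obtain ⟨κ, s, hs, -⟩ := hω
  exact ⟨_, κ, s, hs, rfl⟩

end Attempts

/-! ### Uniformity of the query value off `S`. -/

section Shift

variable {D : Type*} {S : Finset D} {k N m : ℕ} [NeZero m]

theorem map_uniform_add_one :
    ((PMF.uniformOfFintype (Fin m)).toMeasure).map (fun a => a + 1) =
      (PMF.uniformOfFintype (Fin m)).toMeasure := by
  refine Measure.ext_of_singleton fun a => ?_
  have hpre : (fun a : Fin m => a + 1) ⁻¹' {a} = {a - 1} := by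
    ext b
    exact eq_sub_iff_add_eq.symm
  rw [Measure.map_apply (measurable_of_finite _) (measurableSet_singleton _), hpre,
    PMF.toMeasure_apply_singleton _ _ (measurableSet_singleton _),
    PMF.toMeasure_apply_singleton _ _ (measurableSet_singleton _)]
  simp

open Classical in
/-- Add one to the value of the first function `h₃` at `x`. -/
noncomputable def shiftThird (x : D) (ω : HashSource D N m) : HashSource D N m :=
  (ω.1, fun j => if j = (1, x) then ω.2 j + 1 else ω.2 j)

/-- The creation evaluates hash functions at keys from `S` only. -/
theorem createEnv_shiftThird {x : D} (hx : x ∉ S) (key : Fin S.card ≃ S) (ω : HashSource D N m) :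
    createEnv key (shiftThird x ω) = createEnv key ω := by
  have hne : ∀ t i, (t, (key i : D)) ≠ (1, x) := fun t i h =>
    hx ((Prod.mk.inj h).2 ▸ (key i).2)
  simp [createEnv, shiftThird, hne]

theorem cast_queryValue_shiftThird {x : D} {ω : HashSource D N m} {s : State} (hs : s.third = 1) :
    (queryValue (storedFilter (shiftThird x ω) s) x : ZMod m) =
      queryValue (storedFilter ω s) x + 1 := by
  rw [cast_queryValue, cast_queryValue]
  simp only [storedFilter, shiftThird, hs, if_true, Fin.val_add, ZMod.natCast_mod, Nat.cast_add]
  have h1 : (((1 : Fin m) : ℕ) : ZMod m) = 1 := by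
    rw [Fin.val_one', ZMod.natCast_mod, Nat.cast_one]
  rw [h1]
  ring

/-- Events are expressed by residues so that the shift also handles the wrap-around from `m - 1` to
`0`. -/
theorem queryEvent_eq_cast (f : S → BitVec k) (key : Fin S.card ≃ S) (x : D) {a : ℕ} (ha : a < m) :
    queryEvent (N := N) (m := m) f key x {v | (v : ZMod m) = (a : ZMod m)} =
      queryEvent f key x {a} := by
  ext ω
  refine exists_congr fun F => and_congr_right fun _ => ?_
  rw [Set.mem_ofPred_eq, Set.mem_singleton_iff, ZMod.natCast_eq_natCast_iff]
  exact ⟨fun h => Nat.ModEq.eq_of_lt_of_lt h (queryValue_lt F x) ha, fun h => h ▸ Nat.ModEq.refl _⟩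

theorem queryEvent_none (f : S → BitVec k) (key : Fin S.card ≃ S) (x : D) :
    {ω : HashSource D N m | ∃ F, Creates f key ω F ∧
      ∃ κ, Answers F x (none : Option (BitVec k)) κ} =
      queryEvent f key x (Finset.Ico (2 ^ k) m : Finset ℕ) := by
  ext ω
  refine exists_congr fun F => and_congr_right fun _ => ?_
  rw [answers_none_iff]
  simp [queryValue_lt F x]

variable [NeZero N]

/-- The shift acts on each coordinate separately, and translation preserves the uniform distribution
on `Fin m`. -/
theorem measurePreserving_shiftThird (x : D) :
    MeasurePreserving (shiftThird x) (hashMeasure D N m) (hashMeasure D N m) := by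
  classical
  let f : ℕ × D → Fin m → Fin m := fun j a => if j = (1, x) then a + 1 else a
  have hf : ∀ j, Measurable (f j) := fun j => measurable_of_finite _
  have h := infinitePi_map_pi (fun _ : ℕ × D => (PMF.uniformOfFintype (Fin m)).toMeasure) hf
  have hmap : ∀ j, ((PMF.uniformOfFintype (Fin m)).toMeasure).map (f j) =
      (PMF.uniformOfFintype (Fin m)).toMeasure := by
    intro j
    by_cases hj : j = (1, x)
    · have : f j = fun a => a + 1 := by funext a; simp [f, hj]
      rw [this, map_uniform_add_one]
    · have : f j = id := by funext a; simp [f, hj]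
      rw [this, Measure.map_id]
  simp only [hmap] at h
  have h' : MeasurePreserving (fun (y : ℕ × D → Fin m) j => f j (y j))
      (infinitePi fun _ => (PMF.uniformOfFintype (Fin m)).toMeasure)
      (infinitePi fun _ => (PMF.uniformOfFintype (Fin m)).toMeasure) :=
    ⟨measurable_pi_lambda _ fun j => (hf j).comp (measurable_pi_apply j), h⟩
  have h'' := (MeasurePreserving.id (infinitePi fun _ : ℕ × Bool × D =>
    (PMF.uniformOfFintype (Fin N)).toMeasure)).prod h'
  convert! h'' using 1

theorem preimage_shiftThird (f : S → BitVec k) (key : Fin S.card ≃ S) {x : D} (hx : x ∉ S)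
    (a : ℕ) :
    shiftThird x ⁻¹' queryEvent (N := N) (m := m) f key x {v | (v : ZMod m) = ((a + 1 : ℕ) : ZMod m)} =
      queryEvent f key x {v | (v : ZMod m) = (a : ZMod m)} := by
  ext ω
  constructor
  · rintro ⟨_, ⟨κ, s, hs, rfl⟩, h⟩
    rw [createEnv_shiftThird hx] at hs
    refine ⟨_, ⟨κ, s, hs, rfl⟩, ?_⟩
    change (queryValue (storedFilter (shiftThird x ω) s) x : ZMod m) = _ at h
    rw [cast_queryValue_shiftThird (exec_create_sound hs).1.third, Nat.cast_succ] at h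
    exact add_right_cancel h
  · rintro ⟨_, ⟨κ, s, hs, rfl⟩, h⟩
    refine ⟨_, ⟨κ, s, (createEnv_shiftThird hx key ω).symm ▸ hs, rfl⟩, ?_⟩
    change (queryValue (storedFilter (shiftThird x ω) s) x : ZMod m) = _
    rw [cast_queryValue_shiftThird (exec_create_sound hs).1.third, Nat.cast_succ,
      show (queryValue (storedFilter ω s) x : ZMod m) = a from h]

/-- Off `S` the value computed by a query is uniformly distributed. -/
theorem hashMeasure_queryEvent_singleton (f : S → BitVec k) (key : Fin S.card ≃ S) {x : D}
    (hx : x ∉ S) {a : ℕ} (ha : a < m) :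
    hashMeasure D N m (queryEvent f key x {a}) = hashMeasure D N m (queryEvent f key x {0}) := by
  have hm : 0 < m := Nat.pos_of_ne_zero (NeZero.ne m)
  rw [← queryEvent_eq_cast f key x ha, ← queryEvent_eq_cast f key x hm]
  clear ha
  induction a with
  | zero => rfl
  | succ a ih =>
    rw [← ih, ← preimage_shiftThird f key hx a,
      (measurePreserving_shiftThird x).measure_preimage
        (measurableSet_queryEvent f key x _).nullMeasurableSet]

theorem hashMeasure_queryEvent (f : S → BitVec k) (key : Fin S.card ≃ S) {x : D} (hx : x ∉ S)
    {A : Finset ℕ} (hA : ∀ a ∈ A, a < m) :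
    hashMeasure D N m (queryEvent f key x A) =
      A.card * hashMeasure D N m (queryEvent f key x {0}) := by
  have hU : queryEvent (N := N) (m := m) f key x (A : Set ℕ) =
      ⋃ a ∈ A, queryEvent f key x {a} := by
    ext ω
    simp [queryEvent, and_comm]
  rw [hU, measure_biUnion_finset ?_ fun a _ => measurableSet_queryEvent f key x _,
    Finset.sum_congr rfl fun a ha => hashMeasure_queryEvent_singleton f key hx (hA a ha)]
  · simp
  · intro a _ b _ hab
    refine Set.disjoint_left.2 ?_
    rintro ω ⟨F, hF, h1⟩ ⟨F', hF', h2⟩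
    rw [hF.unique hF'] at h1
    exact hab (h1.symm.trans h2)

theorem hashMeasure_queryEvent_of_ae {f : S → BitVec k} {key : Fin S.card ≃ S}
    (hae : ∀ᵐ ω ∂(hashMeasure D N m), ∃ F : Filter D N m, Creates f key ω F) {x : D} (hx : x ∉ S)
    {A : Finset ℕ} (hA : ∀ a ∈ A, a < m) :
    hashMeasure D N m (queryEvent f key x A) = A.card / m := by
  have hm0 : (m : ℝ≥0∞) ≠ 0 := Nat.cast_ne_zero.2 (NeZero.ne m)
  -- The `m` equally likely values exhaust the almost sure event that a filter is created.
  have htotal : (m : ℝ≥0∞) * hashMeasure D N m (queryEvent f key x {0}) = 1 := by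
    have h := hashMeasure_queryEvent (N := N) (m := m) f key hx (A := Finset.range m) (by simp)
    rw [Finset.card_range] at h
    rw [← h, ← measure_univ (μ := hashMeasure D N m)]
    refine measure_congr ?_
    filter_upwards [hae] with ω hω
    obtain ⟨F, hF⟩ := hω
    exact propext ⟨fun _ => trivial, fun _ => ⟨F, hF, by simpa using queryValue_lt F x⟩⟩
  rw [hashMeasure_queryEvent f key hx hA, ENNReal.div_eq_inv_mul, mul_comm]
  congr 1
  exact ENNReal.eq_inv_of_mul_eq_one_left (by rw [mul_comm]; exact htotal)

end Shift

/-- It uses `N ≤ (c + 1) n` and `n ≥ 1`; the `45` is `34` plus the additive constant `10 + 1`. -/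
theorem budget_le {c p : ℝ} (hc : 2 < c) (hp0 : 0 < p) {n N : ℕ} (hn : 0 < n)
    (hN : N = ⌈c * (n : ℝ)⌉₊) :
    ((attemptBudget n N + 1 : ℕ) : ℝ) / p + ((12 * N + 5 : ℕ) : ℝ) ≤
      ((23 * (c + 1) + 45) / p + (12 * (c + 1) + 5)) * n := by
  have hn' : (1 : ℝ) ≤ n := by exact_mod_cast hn
  have hNle : (N : ℝ) ≤ (c + 1) * n := by
    have := Nat.ceil_lt_add_one (show 0 ≤ c * (n : ℝ) by positivity)
    rw [← hN] at this
    linarith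
  have h1 : ((attemptBudget n N + 1 : ℕ) : ℝ) ≤ (23 * (c + 1) + 45) * n := by
    simp only [attemptBudget]
    push_cast
    linarith
  have h2 : ((12 * N + 5 : ℕ) : ℝ) ≤ (12 * (c + 1) + 5) * n := by
    push_cast
    linarith
  calc _ ≤ (23 * (c + 1) + 45) * n / p + (12 * (c + 1) + 5) * n := by gcongr
    _ = _ := by ring

end Bloomier

open Bloomier MeasureTheory in
theorem mainTheorem1 :
    ∃ q : ℕ, ∀ c : ℝ, 2 < c → ∃ C : ℝ, ∀ (D : Type*) (S : Finset D) (k m N : ℕ)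
      [NeZero N] [NeZero m] (f : S → BitVec k) (key : Fin S.card ≃ S),
      S.Nonempty → N = ⌈c * (S.card : ℝ)⌉₊ → 2 ^ k ≤ m →
      -- the creation time
      Measurable (fun ω : HashSource D N m => creationTime f key ω) ∧
      ∫⁻ ω, creationTime f key ω ∂(hashMeasure D N m) ≤ ENNReal.ofReal (C * (S.card : ℝ)) ∧
      -- with probability one a (unique) filter is produced
      (∀ᵐ ω ∂(hashMeasure D N m), ∃! F : Filter D N m, Creates f key ω F) ∧
      -- every filter that is produced has the following properties
      (∀ (ω : HashSource D N m) (F : Filter D N m), Creates f key ω F →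
        -- the hash functions are the first pair that gives a simple acyclic graph, and `h₃`
        (∃ t, 1 ≤ t ∧ F.h₁ = (fun x => ω.1 (t, false, x)) ∧ F.h₂ = (fun x => ω.1 (t, true, x)) ∧
          SimpleAcyclic S F.h₁ F.h₂ ∧
          ∀ j, 1 ≤ j → j < t →
            ¬ SimpleAcyclic S (fun x => ω.1 (j, false, x)) (fun x => ω.1 (j, true, x))) ∧
        F.h₃ = (fun x => ω.2 (1, x)) ∧
        -- the table solves the system of equations
        (∀ x : S, ((readCell (Nat.clog 2 m) F.bits (F.h₁ x) : ZMod m)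
            + (readCell (Nat.clog 2 m) F.bits (F.h₂ x) : ZMod m) + ((F.h₃ x : ℕ) : ZMod m))
            = ((f x).toNat : ZMod m)) ∧
        -- the space
        F.bits.length = ⌈c * (S.card : ℝ)⌉₊ * ⌈Real.logb 2 (m : ℝ)⌉₊ ∧
        -- the query time; the answer is unique
        (∀ x : D, ∃! r : Option (BitVec k) × Cost, Answers F x r.1 r.2) ∧
        (∀ (x : D) (o : Option (BitVec k)) (κ : Cost), Answers F x o κ →
          κ.steps ≤ q ∧ κ.hashes = 3 ∧ κ.lookups = 2) ∧
        -- correctness on `S`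
        (∀ x : S, ∃ κ, Answers F (x : D) (some (f x)) κ)) ∧
      -- the answer off `S`
      (∀ x : D, x ∉ S →
        MeasurableSet {ω : HashSource D N m | ∃ F, Creates f key ω F ∧
          ∃ κ, Answers F x (none : Option (BitVec k)) κ} ∧
        hashMeasure D N m {ω : HashSource D N m | ∃ F, Creates f key ω F ∧
          ∃ κ, Answers F x (none : Option (BitVec k)) κ}
          = ENNReal.ofReal (1 - (2 : ℝ) ^ k / (m : ℝ))) := by
  refine ⟨9, fun c hc => ?_⟩
  obtain ⟨p, hp0, hp1, hp⟩ := exists_le_card_forests hc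
  refine ⟨(23 * (c + 1) + 45) / p + (12 * (c + 1) + 5), ?_⟩
  intro D S k m N _ _ f key hS hN hkm
  have hn : 0 < S.card := hS.card_pos
  have hforest := hp S.card N hn hN
  have hae := ae_exists_creates (m := m) hforest hp0 hp1 f key
  refine ⟨measurable_creationTime f key,
    (lintegral_creationTime_le hforest hp0 hp1 f key).trans
      (ENNReal.ofReal_le_ofReal (budget_le hc hp0 hn hN)), ?_, ?_, fun x hx => ?_⟩
  · filter_upwards [hae] with ω hω
    obtain ⟨F, hF⟩ := hω
    exact ⟨F, hF, fun F' hF' => hF'.unique hF⟩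
  · intro ω F hF
    rw [← hN]
    exact hF.properties hkm
  · rw [queryEvent_none]
    refine ⟨measurableSet_queryEvent f key x _, ?_⟩
    have hm : (0 : ℝ) < m := Nat.cast_pos.2 (Nat.pos_of_ne_zero (NeZero.ne m))
    -- The rejected values are those in `[2 ^ k, m)`; `2 ^ k ≤ m` makes the natural subtraction
    -- exact.
    rw [hashMeasure_queryEvent_of_ae hae hx fun a ha => (Finset.mem_Ico.1 ha).2, Nat.card_Ico,
      ← ENNReal.ofReal_natCast, ← ENNReal.ofReal_natCast m, ← ENNReal.ofReal_div_of_pos hm,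
      Nat.cast_sub hkm, sub_div, div_self hm.ne', Nat.cast_pow, Nat.cast_ofNat]
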